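/- Let $n\ge 1$, $p\in(1,\infty)$, $p'=p/(p-1)$. For $\tau\in\mathbb R$ put $S_\tau u=[\mathrm i\tau u,\nabla_x u]^\top$. For $r\in(1,\infty)$ let $\mathrm W^{1,r}_\tau$ denote, if $\tau\ne0$, the Sobolev space of all $u\in\mathrm L^r(\mathbb R^n)$ with weak gradient in $\mathrm L^r(\mathbb R^n)^n$, and, if $\tau=0$, the homogeneous Sobolev space of all $u\in\mathrm L^r_{\mathrm{loc}}(\mathbb R^n)$ with weak gradient in $\mathrm L^r(\mathbb R^n)^n$, modulo constants; in both cases with the norm $\|u\|_{\mathrm W^{1,r}_\tau}=\|S_\tau u\|_{\mathrm L^r(\mathbb R^n;\mathbb C^{1+n})}$. Let $\mathrm W^{-1,r}_\tau$ be the space of bounded anti-linear functionals on $\mathrm W^{1,r'}_\tau$, $r'=r/(r-1)$, with the dual norm; elements of $\mathrm W^{-1,p}_\tau$ and $\mathrm W^{-1,2}_\tau$ are identified if they agree on all smooth compactly supported functions, which gives a meaning to $\mathrm W^{-1,p}_\tau\cap \mathrm W^{-1,2}_\tau$. Let $A\in\mathrm L^\infty(\mathbb R^n;\mathbb C^{(1+n)\times(1+n)})$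 be strongly elliptic: there is $\lambda>0$ with $\operatorname{Re}\langle A(x)\xi,\xi\rangle\ge\lambda|\xi|^2$ for a.e. $x\in\mathbb R^n$ and all $\xi\in\mathbb C^{1+n}$. Define $S_\tau^*:\mathrm L^2(\mathbb R^n;\mathbb C^{1+n})\to\mathrm W^{-1,2}_\tau$ by $\langle S_\tau^*f,v\rangle=\int_{\mathbb R^n} f\cdot\overline{S_\tau v}\,\mathrm dx$, and let $L_\tau=S_\tau^*AS_\tau:\mathrm W^{1,2}_\tau\to\mathrm W^{-1,2}_\tau$, that is, $\langle L_\tau u,v\rangle=\int_{\mathbb R^n}AS_\tau u\cdot\overline{S_\tau v}\,\mathrm dx$, which is an isomorphism by the Lax--Milgram lemma. Then for every $\tau\in\mathbb R$ the following are equivalent: (i) $S_\tau L_\tau^{-1}S_\tau^*$ is $\mathrm L^p$-bounded: there is a constant $C$ such that $\|S_\tau L_\tau^{-1}S_\tau^*f\|_{p}\le C\|f\|_{p}$ for all $f\in \mathrm L^p\cap\mathrm L^2(\mathbb R^n;\mathbb C^{1+n})$. (ii) There is a constant $C$ such that, for all $u\in\mathrm W^{-1,p}_\tau\cap\mathrm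 W^{-1,2}_\tau$, one has $L_\tau^{-1}u\in\mathrm W^{1,p}_\tau$ and $\|L_\tau^{-1}u\|_{\mathrm W^{1,p}_\tau}\le C\|u\|_{\mathrm W^{-1,p}_\tau}$. Moreover, there is a constant $K$ depending only on $p$ and $n$ (not on $A$, $\lambda$ or $\tau$) such that (i) with constant $C$ implies (ii) with constant $KC$, and (ii) with constant $C$ implies (i) with constant $KC$. -/

import Mathlib

open MeasureTheory Filter Topology
open scoped ENNReal NNReal ContDiff

noncomputable section

namespace TauSobolev

/-- Smooth, compactly supported, complex-valued functions on `ℝⁿ`. -/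
structure IsTestFun {n : ℕ} (φ : EuclideanSpace ℝ (Fin n) → ℂ) : Prop where
  smooth : ContDiff ℝ ∞ φ
  compact : HasCompactSupport φ

/-- `g` is the distributional gradient of `u` on `ℝⁿ`:
`∫ u ∂ᵢφ = - ∫ gᵢ φ` for all test functions `φ` and all `i`. -/
def HasWeakGradient {n : ℕ} (u : EuclideanSpace ℝ (Fin n) → ℂ)
    (g : EuclideanSpace ℝ (Fin n) → EuclideanSpace ℂ (Fin n)) : Prop :=
  ∀ φ : EuclideanSpace ℝ (Fin n) → ℂ, IsTestFun φ → ∀ i : Fin n,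
    ∫ x, u x * fderiv ℝ φ x (EuclideanSpace.single i 1) = - ∫ x, g x i * φ x

section Basic

variable {n : ℕ}

theorem IsTestFun.continuous {φ : EuclideanSpace ℝ (Fin n) → ℂ} (h : IsTestFun φ) :
    Continuous φ := h.smooth.continuous

theorem IsTestFun.continuous_partial {φ : EuclideanSpace ℝ (Fin n) → ℂ} (h : IsTestFun φ)
    (v : EuclideanSpace ℝ (Fin n)) : Continuous fun x => fderiv ℝ φ x v :=
  (h.smooth.continuous_fderiv (by simp)).clm_apply continuous_const

theorem IsTestFun.compact_partial {φ : EuclideanSpace ℝ (Fin n) → ℂ} (h : IsTestFun φ)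
    (v : EuclideanSpace ℝ (Fin n)) : HasCompactSupport fun x => fderiv ℝ φ x v :=
  h.compact.fderiv_apply (𝕜 := ℝ) v

theorem locallyIntegrable_of_memLp_compact {p : ℝ≥0∞} [Fact (1 ≤ p)]
    {u : EuclideanSpace ℝ (Fin n) → ℂ}
    (h : ∀ K, IsCompact K → MemLp u p (volume.restrict K)) : LocallyIntegrable u := by
  rw [locallyIntegrable_iff]
  intro K hK
  have : IsFiniteMeasure (volume.restrict K) := ⟨by simpa using hK.measure_lt_top⟩
  exact (h K hK).integrable Fact.out

theorem locallyIntegrable_of_memLp {p : ℝ≥0∞} [Fact (1 ≤ p)] {F : Type*} [NormedAddCommGroup F]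
    {u : EuclideanSpace ℝ (Fin n) → F} (h : MemLp u p) : LocallyIntegrable u :=
  h.locallyIntegrable Fact.out

theorem integrable_mul_test {u ψ : EuclideanSpace ℝ (Fin n) → ℂ} (hu : LocallyIntegrable u)
    (hψ : Continuous ψ) (hc : HasCompactSupport ψ) : Integrable fun x => u x * ψ x := by
  simpa [mul_comm] using hu.integrable_smul_left_of_hasCompactSupport hψ hc

theorem locallyIntegrable_coord {m : ℕ}
    {g : EuclideanSpace ℝ (Fin n) → EuclideanSpace ℂ (Fin m)} (hg : LocallyIntegrable g)
    (i : Fin m) : LocallyIntegrable fun x => g x i := by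
  rw [locallyIntegrable_iff] at hg ⊢
  intro K hK
  exact (hg K hK).eval_piLp i

theorem HasWeakGradient.congr {u u' : EuclideanSpace ℝ (Fin n) → ℂ}
    {g g' : EuclideanSpace ℝ (Fin n) → EuclideanSpace ℂ (Fin n)} (h : HasWeakGradient u g)
    (hu : u =ᵐ[volume] u') (hg : g =ᵐ[volume] g') : HasWeakGradient u' g' := by
  intro φ hφ i
  rw [integral_congr_ae (g := fun x => u x * fderiv ℝ φ x (EuclideanSpace.single i 1)),
    h φ hφ i, integral_congr_ae]
  · filter_upwards [hg] with x hx using by rw [hx]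
  · filter_upwards [hu] with x hx using by rw [hx]

theorem HasWeakGradient.add {u u' : EuclideanSpace ℝ (Fin n) → ℂ}
    {g g' : EuclideanSpace ℝ (Fin n) → EuclideanSpace ℂ (Fin n)}
    (h : HasWeakGradient u g) (h' : HasWeakGradient u' g')
    (hu : LocallyIntegrable u) (hu' : LocallyIntegrable u')
    (hg : LocallyIntegrable g) (hg' : LocallyIntegrable g') :
    HasWeakGradient (fun x => u x + u' x) (fun x => g x + g' x) := by
  intro φ hφ i
  simp only [add_mul, PiLp.add_apply]
  rw [integral_add, integral_add, h φ hφ i, h' φ hφ i, neg_add]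
  · exact integrable_mul_test (locallyIntegrable_coord hg i) hφ.continuous hφ.compact
  · exact integrable_mul_test (locallyIntegrable_coord hg' i) hφ.continuous hφ.compact
  · exact integrable_mul_test hu (hφ.continuous_partial _) (hφ.compact_partial _)
  · exact integrable_mul_test hu' (hφ.continuous_partial _) (hφ.compact_partial _)

theorem HasWeakGradient.smul {u : EuclideanSpace ℝ (Fin n) → ℂ}
    {g : EuclideanSpace ℝ (Fin n) → EuclideanSpace ℂ (Fin n)}
    (h : HasWeakGradient u g) (c : ℂ) :
    HasWeakGradient (fun x => c * u x) (fun x => c • g x) := by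
  intro φ hφ i
  simp only [mul_assoc, PiLp.smul_apply, smul_eq_mul, integral_const_mul, h φ hφ i, mul_neg]

theorem HasWeakGradient.unique {u : EuclideanSpace ℝ (Fin n) → ℂ}
    {g g' : EuclideanSpace ℝ (Fin n) → EuclideanSpace ℂ (Fin n)}
    (h : HasWeakGradient u g) (h' : HasWeakGradient u g')
    (hg : LocallyIntegrable g) (hg' : LocallyIntegrable g') : g =ᵐ[volume] g' := by
  have key : ∀ i, ∀ᵐ x ∂(volume : Measure (EuclideanSpace ℝ (Fin n))), g x i = g' x i := by
    intro i
    apply ae_eq_of_integral_contDiff_smul_eq (locallyIntegrable_coord hg i)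
      (locallyIntegrable_coord hg' i)
    intro φ hφ hc
    have ht : IsTestFun fun x => (φ x : ℂ) :=
      ⟨Complex.ofRealCLM.contDiff.comp hφ, hc.comp_left (g := ((↑) : ℝ → ℂ)) (by simp)⟩
    have := (h _ ht i).symm.trans (h' _ ht i)
    simpa [mul_comm, Complex.real_smul] using this
  filter_upwards [ae_all_iff.2 key] with x hx
  ext i
  exact hx i

end Basic

/-- The functions underlying `W^{1,p}_τ(ℝⁿ)`: (classes of a.e. equal) functions `u ∈ L^p_loc` with
weak gradient in `L^p`, which, if `τ ≠ 0`, are in `L^p` themselves. For `τ ≠ 0` this is the usual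
inhomogeneous Sobolev space, for `τ = 0` the homogeneous one before dividing out constants. -/
def sobolevSubmodule (n : ℕ) (τ : ℝ) (p : ℝ≥0∞) [Fact (1 ≤ p)] :
    Submodule ℂ (EuclideanSpace ℝ (Fin n) →ₘ[volume] ℂ) where
  carrier := {u | (∀ K, IsCompact K → MemLp u p (volume.restrict K)) ∧
    (τ ≠ 0 → MemLp u p volume) ∧
    ∃ g : EuclideanSpace ℝ (Fin n) → EuclideanSpace ℂ (Fin n),
      MemLp g p volume ∧ HasWeakGradient u g}
  zero_mem' := by
    have h0 := AEEqFun.coeFn_zero (μ := (volume : Measure (EuclideanSpace ℝ (Fin n)))) (β := ℂ)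
    refine ⟨fun K _ => ?_, fun _ => ?_, 0, MemLp.zero, ?_⟩
    · exact (memLp_congr_ae (ae_restrict_of_ae h0)).2 MemLp.zero
    · exact (memLp_congr_ae h0).2 MemLp.zero
    · refine HasWeakGradient.congr (u := 0) (g := 0) ?_ h0.symm ae_eq_rfl
      intro φ _ i
      simp
  add_mem' := by
    rintro u v ⟨hu1, hu2, g, hg, hgu⟩ ⟨hv1, hv2, k, hk, hkv⟩
    have h0 := AEEqFun.coeFn_add u v
    refine ⟨fun K hK => ?_, fun hτ => ?_, fun x => g x + k x, hg.add hk, ?_⟩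
    · exact (memLp_congr_ae (ae_restrict_of_ae h0)).2 ((hu1 K hK).add (hv1 K hK))
    · exact (memLp_congr_ae h0).2 ((hu2 hτ).add (hv2 hτ))
    · exact (hgu.add hkv (locallyIntegrable_of_memLp_compact hu1)
        (locallyIntegrable_of_memLp_compact hv1) (locallyIntegrable_of_memLp hg)
        (locallyIntegrable_of_memLp hk)).congr h0.symm ae_eq_rfl
  smul_mem' := by
    rintro c u ⟨hu1, hu2, g, hg, hgu⟩
    have h0 := AEEqFun.coeFn_smul c u
    refine ⟨fun K hK => ?_, fun hτ => ?_, fun x => c • g x, hg.const_smul c, ?_⟩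
    · exact (memLp_congr_ae (ae_restrict_of_ae h0)).2 ((hu1 K hK).const_smul c)
    · exact (memLp_congr_ae h0).2 ((hu2 hτ).const_smul c)
    · exact (hgu.smul c).congr h0.symm ae_eq_rfl

/-- The type of functions underlying `W^{1,p}_τ(ℝⁿ)`. -/
def SobolevFun (n : ℕ) (τ : ℝ) (p : ℝ≥0∞) [Fact (1 ≤ p)] : Type :=
  ↥(sobolevSubmodule n τ p)

section Functions

variable {n : ℕ} {τ : ℝ} {p : ℝ≥0∞} [Fact (1 ≤ p)]

instance : AddCommGroup (SobolevFun n τ p) :=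
  inferInstanceAs (AddCommGroup ↥(sobolevSubmodule n τ p))

instance : Module ℂ (SobolevFun n τ p) :=
  inferInstanceAs (Module ℂ ↥(sobolevSubmodule n τ p))

/-- The underlying function of an element of `SobolevFun n τ p`. -/
def SobolevFun.toFun (u : SobolevFun n τ p) : EuclideanSpace ℝ (Fin n) → ℂ :=
  (u.1 : EuclideanSpace ℝ (Fin n) →ₘ[volume] ℂ)

/-- The weak gradient `∇ₓ u`. -/
def SobolevFun.grad (u : SobolevFun n τ p) :
    EuclideanSpace ℝ (Fin n) → EuclideanSpace ℂ (Fin n) :=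
  u.2.2.2.choose

theorem SobolevFun.memLp_compact (u : SobolevFun n τ p) :
    ∀ K, IsCompact K → MemLp u.toFun p (volume.restrict K) := u.2.1

theorem SobolevFun.memLp (u : SobolevFun n τ p) (hτ : τ ≠ 0) : MemLp u.toFun p volume := u.2.2.1 hτ

theorem SobolevFun.memLp_grad (u : SobolevFun n τ p) : MemLp u.grad p volume :=
  u.2.2.2.choose_spec.1

theorem SobolevFun.hasWeakGradient (u : SobolevFun n τ p) : HasWeakGradient u.toFun u.grad :=
  u.2.2.2.choose_spec.2

theorem SobolevFun.toFun_add (u v : SobolevFun n τ p) :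
    (u + v).toFun =ᵐ[volume] fun x => u.toFun x + v.toFun x := AEEqFun.coeFn_add u.1 v.1

theorem SobolevFun.toFun_smul (c : ℂ) (u : SobolevFun n τ p) :
    (c • u).toFun =ᵐ[volume] fun x => c * u.toFun x := AEEqFun.coeFn_smul c u.1

theorem SobolevFun.locallyIntegrable (u : SobolevFun n τ p) : LocallyIntegrable u.toFun :=
  locallyIntegrable_of_memLp_compact u.memLp_compact

theorem SobolevFun.grad_add (u v : SobolevFun n τ p) :
    (u + v).grad =ᵐ[volume] fun x => u.grad x + v.grad x :=
  (u + v).hasWeakGradient.unique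
    ((u.hasWeakGradient.add v.hasWeakGradient u.locallyIntegrable v.locallyIntegrable
      (locallyIntegrable_of_memLp u.memLp_grad) (locallyIntegrable_of_memLp v.memLp_grad)).congr
      (SobolevFun.toFun_add u v).symm ae_eq_rfl)
    (locallyIntegrable_of_memLp (u + v).memLp_grad)
    (locallyIntegrable_of_memLp (u.memLp_grad.add v.memLp_grad))

theorem SobolevFun.grad_smul (c : ℂ) (u : SobolevFun n τ p) :
    (c • u).grad =ᵐ[volume] fun x => c • u.grad x :=
  (c • u).hasWeakGradient.unique
    ((u.hasWeakGradient.smul c).congr (SobolevFun.toFun_smul c u).symm ae_eq_rfl)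
    (locallyIntegrable_of_memLp (c • u).memLp_grad)
    (locallyIntegrable_of_memLp (u.memLp_grad.const_smul c))

/-- `S_τ u = [iτ u, ∇ₓ u]ᵀ` as a function with values in `ℂ^{1+n}`. -/
def SobolevFun.tauGrad (u : SobolevFun n τ p) (x : EuclideanSpace ℝ (Fin n)) :
    EuclideanSpace ℂ (Fin (n + 1)) :=
  WithLp.toLp 2 (Fin.cons (Complex.I * τ * u.toFun x) fun i => u.grad x i)

theorem SobolevFun.memLp_tauGrad (u : SobolevFun n τ p) : MemLp u.tauGrad p volume := by
  refine MemLp.of_eval_piLp fun i => ?_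
  refine Fin.cases ?_ (fun i => ?_) i
  · by_cases hτ : τ = 0
    · simp [SobolevFun.tauGrad, hτ]
    · simpa [SobolevFun.tauGrad] using (u.memLp hτ).const_mul (Complex.I * τ)
  · simpa [SobolevFun.tauGrad] using u.memLp_grad.eval_piLp i

/-- `S_τ` as a linear map from the functions underlying `W^{1,p}_τ` to `L^p(ℝⁿ; ℂ^{1+n})`. -/
def SobolevFun.tauGradₗ (n : ℕ) (τ : ℝ) (p : ℝ≥0∞) [Fact (1 ≤ p)] :
    SobolevFun n τ p →ₗ[ℂ]
      Lp (EuclideanSpace ℂ (Fin (n + 1))) p (volume : Measure (EuclideanSpace ℝ (Fin n))) where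
  toFun u := u.memLp_tauGrad.toLp u.tauGrad
  map_add' u v := by
    rw [← MemLp.toLp_add]
    apply MemLp.toLp_congr
    filter_upwards [SobolevFun.toFun_add u v, SobolevFun.grad_add u v] with x h1 h2
    ext i
    refine Fin.cases ?_ (fun i => ?_) i
    · simp [SobolevFun.tauGrad, h1, mul_add]
    · simp [SobolevFun.tauGrad, h2]
  map_smul' c u := by
    rw [RingHom.id_apply, ← MemLp.toLp_const_smul]
    apply MemLp.toLp_congr
    filter_upwards [SobolevFun.toFun_smul c u, SobolevFun.grad_smul c u] with x h1 h2
    ext i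
    refine Fin.cases ?_ (fun i => ?_) i
    · simp only [SobolevFun.tauGrad, h1, Fin.cons_zero, Pi.smul_apply, PiLp.smul_apply, smul_eq_mul]
      ring
    · simp [SobolevFun.tauGrad, h2]

/-- The seminorm `‖u‖ = ‖S_τ u‖_p`. -/
instance : SeminormedAddCommGroup (SobolevFun n τ p) :=
  SeminormedAddCommGroup.induced _ _ (SobolevFun.tauGradₗ n τ p)

instance : NormedSpace ℂ (SobolevFun n τ p) :=
  NormedSpace.induced ℂ _ _ (SobolevFun.tauGradₗ n τ p)

theorem SobolevFun.norm_def (u : SobolevFun n τ p) : ‖u‖ = ‖SobolevFun.tauGradₗ n τ p u‖ := rfl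

end Functions

/-- The space `W^{1,p}_τ(ℝⁿ)` with norm `‖S_τ u‖_p`. Functions at distance zero are
identified: a.e. equal functions if `τ ≠ 0`, functions that differ by a constant (that is, have the
same gradient) if `τ = 0`, where this is the homogeneous Sobolev space. -/
abbrev SobolevSpace (n : ℕ) (τ : ℝ) (p : ℝ≥0∞) [Fact (1 ≤ p)] : Type :=
  SeparationQuotient (SobolevFun n τ p)

/-- The space `X^*` of bounded anti-linear functionals on `X`. -/
abbrev AntiDual (X : Type*) [SeminormedAddCommGroup X] [NormedSpace ℂ X] : Type _ :=
  X →L⋆[ℂ] ℂ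

/-- The function `f` represents the element `u` of `W^{1,p}_τ(ℝⁿ)`. -/
def Represents {n : ℕ} {τ : ℝ} {p : ℝ≥0∞} [Fact (1 ≤ p)] (f : EuclideanSpace ℝ (Fin n) → ℂ)
    (u : SobolevSpace n τ p) : Prop :=
  ∃ w : SobolevFun n τ p, w.toFun =ᵐ[volume] f ∧ SeparationQuotient.mk w = u

/-- The isometry `S_τ : W^{1,p}_τ(ℝⁿ) → L^p(ℝⁿ; ℂ^{1+n})`. -/
def tauGradient (n : ℕ) (τ : ℝ) (p : ℝ≥0∞) [Fact (1 ≤ p)] :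
    SobolevSpace n τ p →ₗᵢ[ℂ]
      Lp (EuclideanSpace ℂ (Fin (n + 1))) p (volume : Measure (EuclideanSpace ℝ (Fin n))) where
  toLinearMap := (SeparationQuotient.liftCLM
    ((SobolevFun.tauGradₗ n τ p).mkContinuous 1 fun u => by rw [one_mul, u.norm_def])
    (fun x y h => by
      have h1 : ‖x - y‖ = 0 := by
        rw [← dist_eq_norm]; exact Metric.inseparable_iff.1 h
      rw [SobolevFun.norm_def, norm_eq_zero, map_sub, sub_eq_zero] at h1
      exact h1)).toLinearMap
  norm_map' := by
    rintro ⟨u⟩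
    rfl

section Translation

variable {n : ℕ}

theorem IsTestFun.translate {φ : EuclideanSpace ℝ (Fin n) → ℂ} (h : IsTestFun φ)
    (y : EuclideanSpace ℝ (Fin n)) : IsTestFun fun x => φ (x - y) := by
  refine ⟨h.smooth.comp (contDiff_id.sub contDiff_const), ?_⟩
  simpa [sub_eq_add_neg, Function.comp_def] using
    h.compact.comp_homeomorph (Homeomorph.addRight (-y))

/-- The derivative of `y ↦ ∫ w(x) φ(x - y) dx` in direction `h`, through the weak gradient. -/
theorem hasDerivAt_pairing {w : EuclideanSpace ℝ (Fin n) → ℂ}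
    {g : EuclideanSpace ℝ (Fin n) → EuclideanSpace ℂ (Fin n)} (hw : LocallyIntegrable w)
    (hg : LocallyIntegrable g) (hwg : HasWeakGradient w g)
    {φ : EuclideanSpace ℝ (Fin n) → ℂ} (hφ : IsTestFun φ) (h : EuclideanSpace ℝ (Fin n)) (t : ℝ) :
    HasDerivAt (fun t : ℝ => ∫ x, w x * φ (x - t • h))
      (∫ x, (∑ i, (h i : ℂ) * g x i) * φ (x - t • h)) t := by
  set ψ : EuclideanSpace ℝ (Fin n) → ℂ := fun z => φ (-z) with hψ
  have hψs : ContDiff ℝ ∞ ψ := hφ.smooth.comp contDiff_neg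
  have hψc : HasCompactSupport ψ := by
    simpa [Function.comp_def, hψ] using hφ.compact.comp_homeomorph (Homeomorph.neg _)
  have h1 : ContDiff ℝ 1 ψ := hψs.of_le (by exact_mod_cast le_top)
  have key := hψc.hasFDerivAt_convolution_right (ContinuousLinearMap.mul ℝ ℂ) hw h1 (t • h)
  have hline : HasDerivAt (fun t : ℝ => t • h) h t := by
    simpa using (hasDerivAt_id t).smul_const h
  have h2 := key.comp_hasDerivAt t hline
  rw [convolution_precompR_apply _ hw (hψc.fderiv ℝ) (h1.continuous_fderiv one_ne_zero)] at h2
  have e1 : (fun t : ℝ => ∫ x, w x * φ (x - t • h)) =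
      convolution w ψ (ContinuousLinearMap.mul ℝ ℂ) volume ∘ fun t : ℝ => t • h := by
    funext s
    simp [convolution_def, hψ]
  rw [e1]
  suffices hs : (∫ x, (∑ i, (h i : ℂ) * g x i) * φ (x - t • h)) =
      convolution w (fun a => fderiv ℝ ψ a h) (ContinuousLinearMap.mul ℝ ℂ) volume (t • h) by
    rw [hs]; exact h2
  rw [convolution_def]
  simp only [ContinuousLinearMap.mul_apply']
  have hT := hφ.translate (t • h)
  have e2 : ∀ x, fderiv ℝ ψ (t • h - x) h =
      -∑ i, (h i : ℂ) * fderiv ℝ (fun x => φ (x - t • h)) x (EuclideanSpace.single i 1) := by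
    intro x
    have hd : DifferentiableAt ℝ φ (x - t • h) :=
      (hφ.smooth.differentiable (by simp)) _
    have a1 : fderiv ℝ ψ (t • h - x) = -fderiv ℝ φ (x - t • h) := by
      have h4 : HasFDerivAt φ (fderiv ℝ φ (x - t • h)) (-(t • h - x)) := by
        rw [neg_sub]; exact hd.hasFDerivAt
      have h5 := (h4.comp (t • h - x) (hasFDerivAt_id (𝕜 := ℝ) (t • h - x)).neg).fderiv
      refine Eq.trans h5 ?_
      ext v
      simp
    have a2 : fderiv ℝ (fun x => φ (x - t • h)) x = fderiv ℝ φ (x - t • h) := by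
      rw [fderiv_comp_sub]
    rw [a1, a2]
    have hh : h = ∑ i, h i • EuclideanSpace.single i (1 : ℝ) := by
      ext j
      simp [Finset.sum_apply, Pi.single_apply]
    generalize fderiv ℝ φ (x - t • h) = D
    conv_lhs => rw [hh]
    simp
  simp_rw [e2, mul_neg, Finset.mul_sum, integral_neg]
  have i1 : ∀ i, Integrable fun x => w x * ((h i : ℂ) *
      fderiv ℝ (fun x => φ (x - t • h)) x (EuclideanSpace.single i 1)) := by
    intro i
    refine ((integrable_mul_test hw (hT.continuous_partial (EuclideanSpace.single i 1))
      (hT.compact_partial _)).const_mul (h i : ℂ)).congr (ae_of_all _ fun x => by ring)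
  have i2 : ∀ i, Integrable fun x => (h i : ℂ) * g x i * φ (x - t • h) := by
    intro i
    refine ((integrable_mul_test (locallyIntegrable_coord hg i) hT.continuous
      hT.compact).const_mul (h i : ℂ)).congr (ae_of_all _ fun x => by ring)
  simp_rw [Finset.sum_mul]
  rw [integral_finsetSum _ fun i _ => i1 i, integral_finsetSum _ fun i _ => i2 i,
    ← Finset.sum_neg_distrib]
  refine Finset.sum_congr rfl fun i _ => ?_
  have := hwg _ hT i
  calc ∫ x, (h i : ℂ) * g x i * φ (x - t • h)
      = (h i : ℂ) * ∫ x, g x i * φ (x - t • h) := by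
        rw [← integral_const_mul]; simp_rw [mul_assoc]
    _ = -((h i : ℂ) * ∫ x, w x *
          fderiv ℝ (fun x => φ (x - t • h)) x (EuclideanSpace.single i 1)) := by
        rw [this]; ring
    _ = _ := by
        rw [← integral_const_mul]
        congr 1
        refine integral_congr_ae (ae_of_all _ fun x => by ring)

theorem norm_integral_mul_le {f ψ : EuclideanSpace ℝ (Fin n) → ℂ} (hf : MemLp f 2)
    (hψ : MemLp ψ 2) :
    ‖∫ x, f x * ψ x‖ ≤ (eLpNorm f 2).toReal * (eLpNorm ψ 2).toReal := by
  rw [← ENNReal.toReal_mul, ← toReal_enorm]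
  refine ENNReal.toReal_mono (ENNReal.mul_ne_top hf.eLpNorm_ne_top hψ.eLpNorm_ne_top) ?_
  refine (enorm_integral_le_lintegral_enorm _).trans ?_
  rw [← eLpNorm_one_eq_lintegral_enorm]
  have h := eLpNorm_smul_le_mul_eLpNorm (p := 2) (q := 2) (r := 1) hψ.1 hf.1
  refine le_trans (le_of_eq ?_) h
  congr 1

theorem norm_dot_le (h : EuclideanSpace ℝ (Fin n)) (z : EuclideanSpace ℂ (Fin n)) :
    ‖∑ i, (h i : ℂ) * z i‖ ≤ ‖h‖ * ‖z‖ := by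
  have e : ∑ i, (h i : ℂ) * z i =
      inner ℂ (WithLp.toLp 2 fun i => (h i : ℂ) : EuclideanSpace ℂ (Fin n)) z := by
    simp [PiLp.inner_apply, mul_comm]
  have e' : ‖(WithLp.toLp 2 fun i => (h i : ℂ) : EuclideanSpace ℂ (Fin n))‖ = ‖h‖ := by
    simp [EuclideanSpace.norm_eq]
  rw [e, ← e']
  exact norm_inner_le_norm _ _

theorem norm_translate_pairing_le {w : EuclideanSpace ℝ (Fin n) → ℂ}
    {g : EuclideanSpace ℝ (Fin n) → EuclideanSpace ℂ (Fin n)} (hw : LocallyIntegrable w)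
    (hg : MemLp g 2) (hwg : HasWeakGradient w g)
    {φ : EuclideanSpace ℝ (Fin n) → ℂ} (hφ : IsTestFun φ) (h : EuclideanSpace ℝ (Fin n)) :
    ‖(∫ x, w x * φ (x - h)) - ∫ x, w x * φ x‖ ≤
      ‖h‖ * (eLpNorm g 2).toReal * (eLpNorm φ 2).toReal := by
  have hd := fun t : ℝ => hasDerivAt_pairing hw (locallyIntegrable_of_memLp hg) hwg hφ h t
  have := norm_image_sub_le_of_norm_deriv_le_segment_01'
    (C := ‖h‖ * (eLpNorm g 2).toReal * (eLpNorm φ 2).toReal)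
    (fun t _ => (hd t).hasDerivWithinAt) ?_
  · simpa using this
  intro t _
  have hφ2 : MemLp φ 2 := hφ.continuous.memLp_of_hasCompactSupport hφ.compact
  have hmp := measurePreserving_sub_right (volume : Measure (EuclideanSpace ℝ (Fin n))) (t • h)
  have hT : eLpNorm (fun x => φ (x - t • h)) 2 = eLpNorm φ 2 :=
    eLpNorm_comp_measurePreserving hφ2.1 hmp
  have hT2 : MemLp (fun x => φ (x - t • h)) 2 := hφ2.comp_measurePreserving hmp
  have hm : AEStronglyMeasurable (fun x => ∑ i, (h i : ℂ) * g x i) volume := by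
    refine Finset.aestronglyMeasurable_fun_sum _ fun i _ => ?_
    exact (hg.eval_piLp i).1.const_mul _
  have hb : eLpNorm (fun x => ∑ i, (h i : ℂ) * g x i) 2 ≤ ENNReal.ofReal ‖h‖ * eLpNorm g 2 :=
    eLpNorm_le_mul_eLpNorm_of_ae_le_mul (ae_of_all _ fun x => norm_dot_le h (g x)) 2
  have hfin : ENNReal.ofReal ‖h‖ * eLpNorm g 2 ≠ ⊤ :=
    ENNReal.mul_ne_top ENNReal.ofReal_ne_top hg.eLpNorm_ne_top
  have hf : MemLp (fun x => ∑ i, (h i : ℂ) * g x i) 2 := ⟨hm, hb.trans_lt hfin.lt_top⟩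
  refine (norm_integral_mul_le hf hT2).trans ?_
  rw [hT]
  gcongr
  refine (ENNReal.toReal_mono hfin hb).trans ?_
  rw [ENNReal.toReal_mul, ENNReal.toReal_ofReal (norm_nonneg _)]

/-- The space of test functions. -/
def testSubmodule (n : ℕ) : Submodule ℂ (EuclideanSpace ℝ (Fin n) → ℂ) where
  carrier := {φ | IsTestFun φ}
  zero_mem' := ⟨contDiff_const, HasCompactSupport.zero⟩
  add_mem' h k := ⟨h.smooth.add k.smooth, h.compact.add k.compact⟩
  smul_mem' c _ h := ⟨h.smooth.const_smul c, h.compact.smul_left (f := fun _ => c)⟩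

/-- Duality: a locally integrable function that is bounded on test functions in the `L²` norm is
in `L²`. -/
theorem eLpNorm_le_of_test {w : EuclideanSpace ℝ (Fin n) → ℂ} (hw : LocallyIntegrable w)
    {C : ℝ} (hC : 0 ≤ C)
    (h : ∀ φ, IsTestFun φ → ‖∫ x, w x * φ x‖ ≤ C * (eLpNorm φ 2).toReal) :
    eLpNorm w 2 ≤ ENNReal.ofReal C := by
  have hmem : ∀ φ : testSubmodule n, MemLp (φ : EuclideanSpace ℝ (Fin n) → ℂ) 2 :=
    fun φ => φ.2.continuous.memLp_of_hasCompactSupport φ.2.compact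
  let e : testSubmodule n →ₗ[ℂ] Lp ℂ 2 (volume : Measure (EuclideanSpace ℝ (Fin n))) :=
    { toFun := fun φ => (hmem φ).toLp _
      map_add' := fun φ ψ => MemLp.toLp_add (hmem φ) (hmem ψ)
      map_smul' := fun c φ => MemLp.toLp_const_smul c (hmem φ) }
  let f : testSubmodule n →ₗ[ℂ] ℂ :=
    { toFun := fun φ => ∫ x, w x * φ.1 x
      map_add' := fun φ ψ => by
        simp only [Submodule.coe_add, Pi.add_apply, mul_add]
        exact integral_add (integrable_mul_test hw φ.2.continuous φ.2.compact)
          (integrable_mul_test hw ψ.2.continuous ψ.2.compact)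
      map_smul' := fun c φ => by
        simp only [Submodule.coe_smul, Pi.smul_apply, smul_eq_mul, RingHom.id_apply]
        rw [← integral_const_mul]
        exact integral_congr_ae (ae_of_all _ fun x => by ring) }
  have hdense : DenseRange e := by
    refine (Lp.dense_hasCompactSupport_contDiff (F := ℂ)
      (μ := (volume : Measure (EuclideanSpace ℝ (Fin n)))) (p := 2) (by simp)).mono ?_
    rintro ψ ⟨φ, h1, h2, h3⟩
    refine ⟨⟨φ, ⟨h3, h2⟩⟩, ?_⟩
    refine Lp.ext ?_
    exact (MemLp.coeFn_toLp (hmem ⟨φ, ⟨h3, h2⟩⟩)).trans h1.symm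
  have hbd : ∀ φ, ‖f φ‖ ≤ C * ‖e φ‖ := by
    intro φ
    refine (h φ.1 φ.2).trans_eq ?_
    change _ = C * ‖(hmem φ).toLp _‖
    rw [Lp.norm_toLp]
  let F := f.extendOfNorm e
  let r := (InnerProductSpace.toDual ℂ _).symm F
  have hr : ‖r‖ ≤ C := by
    rw [LinearIsometryEquiv.norm_map]
    exact F.opNorm_le_bound hC (LinearMap.norm_extendOfNorm_apply_le hdense C hbd)
  have hwr : ∀ᵐ x, w x = star (r x) := by
    have hrl : LocallyIntegrable fun x => star (r x) :=
      locallyIntegrable_of_memLp (Lp.memLp r).star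
    refine ae_eq_of_integral_contDiff_smul_eq hw hrl fun φ hφ hc => ?_
    have ht : IsTestFun fun x => (φ x : ℂ) :=
      ⟨Complex.ofRealCLM.contDiff.comp hφ, hc.comp_left (g := ((↑) : ℝ → ℂ)) (by simp)⟩
    have h1 : F (e ⟨_, ht⟩) = f ⟨_, ht⟩ := LinearMap.extendOfNorm_eq hdense ⟨C, hbd⟩ _
    have h2 : inner ℂ r (e ⟨_, ht⟩) = F (e ⟨_, ht⟩) := InnerProductSpace.toDual_symm_apply
    rw [h1, L2.inner_def] at h2
    have h3 : f ⟨_, ht⟩ = ∫ x, φ x • w x := by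
      change ∫ x, w x * (φ x : ℂ) = _
      simp [mul_comm, Complex.real_smul]
    rw [← h3, ← h2]
    refine integral_congr_ae ?_
    filter_upwards [MemLp.coeFn_toLp (hmem ⟨_, ht⟩)] with x hx
    change inner ℂ (r x) ((hmem ⟨_, ht⟩).toLp _ x) = _
    rw [hx]
    simp [Complex.real_smul]
  rw [eLpNorm_congr_ae hwr]
  have : eLpNorm (fun x => star (r x)) 2 = eLpNorm r 2 volume :=
    eLpNorm_congr_norm_ae (ae_of_all _ fun x => by simp)
  rw [this, ← ENNReal.ofReal_toReal (Lp.memLp r).eLpNorm_ne_top, ← Lp.norm_def]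
  exact ENNReal.ofReal_le_ofReal hr

theorem eLpNorm_translate_sub_le {w : EuclideanSpace ℝ (Fin n) → ℂ}
    {g : EuclideanSpace ℝ (Fin n) → EuclideanSpace ℂ (Fin n)} (hw : LocallyIntegrable w)
    (hg : MemLp g 2) (hwg : HasWeakGradient w g) (h : EuclideanSpace ℝ (Fin n)) :
    eLpNorm (fun x => w (x + h) - w x) 2 ≤ ‖h‖ₑ * eLpNorm g 2 := by
  have hmp := measurePreserving_add_right (volume : Measure (EuclideanSpace ℝ (Fin n))) h
  have hwT : LocallyIntegrable fun x => w (x + h) := by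
    rw [locallyIntegrable_iff] at hw ⊢
    intro K hK
    have hK' : IsCompact ((Homeomorph.addRight h) '' K) := hK.image (Homeomorph.continuous _)
    have := (hmp.integrableOn_comp_preimage (Homeomorph.addRight h).measurableEmbedding
      (f := w) (s := (Homeomorph.addRight h) '' K)).2 (hw _ hK')
    rw [show (fun x : EuclideanSpace ℝ (Fin n) => x + h) = Homeomorph.addRight h from rfl,
      Set.preimage_image_eq _ (Homeomorph.injective _)] at this
    exact this
  refine (eLpNorm_le_of_test (hwT.sub hw) (C := ‖h‖ * (eLpNorm g 2).toReal) (by positivity)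
    fun φ hφ => ?_).trans_eq ?_
  · refine le_trans (le_of_eq ?_) (norm_translate_pairing_le hw hg hwg hφ h)
    congr 1
    simp only [Pi.sub_apply, sub_mul]
    rw [integral_sub (integrable_mul_test hwT hφ.continuous hφ.compact)
      (integrable_mul_test hw hφ.continuous hφ.compact),
      ← integral_sub_right_eq_self (fun x => w (x + h) * φ x) h]
    simp
  · rw [ENNReal.ofReal_mul (norm_nonneg _), ofReal_norm,
      ENNReal.ofReal_toReal hg.eLpNorm_ne_top]

end Translation

section Weight

variable {n : ℕ}

/-- The weight `(1 + |x|)^{-(n+3)}`, used to select representatives modulo constants. -/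
def weight (n : ℕ) (x : EuclideanSpace ℝ (Fin n)) : ℝ≥0 :=
  Real.toNNReal ((1 + ‖x‖) ^ (-((n : ℝ) + 3)))

theorem coe_weight (x : EuclideanSpace ℝ (Fin n)) :
    ((weight n x : ℝ≥0) : ℝ) = (1 + ‖x‖) ^ (-((n : ℝ) + 3)) :=
  Real.coe_toNNReal _ (by positivity)

theorem weight_pos (x : EuclideanSpace ℝ (Fin n)) : 0 < weight n x := by
  rw [← NNReal.coe_pos, coe_weight]; positivity

theorem continuous_weight : Continuous (weight n) := by
  refine continuous_real_toNNReal.comp ?_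
  refine Continuous.rpow_const (by fun_prop) fun x => Or.inl (by positivity)

theorem weight_le_one (x : EuclideanSpace ℝ (Fin n)) : weight n x ≤ 1 := by
  rw [← NNReal.coe_le_coe, coe_weight]
  exact Real.rpow_le_one_of_one_le_of_nonpos (by simp) (by linarith [Nat.cast_nonneg (α := ℝ) n])

theorem weight_mul_le (x h : EuclideanSpace ℝ (Fin n)) :
    weight n x * weight n (x + h) ≤ weight n h := by
  rw [← NNReal.coe_le_coe, NNReal.coe_mul, coe_weight, coe_weight, coe_weight,
    ← Real.mul_rpow (by positivity) (by positivity)]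
  refine Real.rpow_le_rpow_of_nonpos (by positivity) ?_ (by linarith [Nat.cast_nonneg (α := ℝ) n])
  have : ‖h‖ ≤ ‖x + h‖ + ‖x‖ := by
    simpa using norm_sub_le (x + h) x
  nlinarith [norm_nonneg x, norm_nonneg (x + h), mul_nonneg (norm_nonneg x) (norm_nonneg (x + h))]

/-- The finite measure with density `weight`. -/
def wMeasure (n : ℕ) : Measure (EuclideanSpace ℝ (Fin n)) :=
  volume.withDensity fun x => (weight n x : ℝ≥0∞)

theorem measurable_weight : Measurable fun x => (weight n x : ℝ≥0∞) :=
  continuous_weight.measurable.coe_nnreal_ennreal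

instance : IsFiniteMeasure (wMeasure n) := by
  refine isFiniteMeasure_withDensity (ne_of_lt ?_)
  refine finite_integral_one_add_norm (μ := (volume : Measure (EuclideanSpace ℝ (Fin n))))
    (r := (n : ℝ) + 3) ?_
  simp

theorem wMeasure_ac : wMeasure n ≪ volume := withDensity_absolutelyContinuous _ _

theorem volume_ac : (volume : Measure (EuclideanSpace ℝ (Fin n))) ≪ wMeasure n :=
  withDensity_absolutelyContinuous' measurable_weight.aemeasurable
    (ae_of_all _ fun x => by simpa using (weight_pos x).ne')

theorem wMeasure_le : wMeasure n ≤ volume := by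
  have := withDensity_mono (μ := (volume : Measure (EuclideanSpace ℝ (Fin n))))
    (f := fun x => (weight n x : ℝ≥0∞)) (g := 1)
    (ae_of_all _ fun x => by simpa using weight_le_one x)
  simpa [wMeasure] using this

theorem wMeasure_ne_zero : wMeasure n ≠ 0 := by
  intro h
  have := volume_ac (n := n)
  rw [h] at this
  have h2 := this (s := Set.univ) (by simp)
  exact NeZero.ne (volume : Measure (EuclideanSpace ℝ (Fin n))) (by simpa using h2)

theorem lintegral_wMeasure {f : EuclideanSpace ℝ (Fin n) → ℝ≥0∞} (hf : Measurable f) :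
    ∫⁻ x, f x ∂(wMeasure n) = ∫⁻ x, (weight n x : ℝ≥0∞) * f x :=
  lintegral_withDensity_eq_lintegral_mul _ measurable_weight hf

/-- `L²` with respect to `wMeasure` embeds into `L²_loc`. -/
theorem memLp_compact_of_wMeasure {u : EuclideanSpace ℝ (Fin n) → ℂ} (hu : MemLp u 2 (wMeasure n))
    {K : Set (EuclideanSpace ℝ (Fin n))} (hK : IsCompact K) : MemLp u 2 (volume.restrict K) := by
  rcases K.eq_empty_or_nonempty with rfl | hne
  · simp
  obtain ⟨x₀, hx₀, hmin⟩ := hK.exists_isMinOn hne (continuous_weight (n := n)).continuousOn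
  have hle : volume.restrict K ≤ ((weight n x₀)⁻¹ : ℝ≥0∞) • wMeasure n := by
    rw [Measure.le_iff]
    intro s hs
    rw [Measure.restrict_apply hs, Measure.smul_apply, smul_eq_mul, mul_comm, ← div_eq_mul_inv,
      ENNReal.le_div_iff_mul_le (Or.inl (by simpa using (weight_pos x₀).ne')) (Or.inl (by simp)),
      wMeasure, withDensity_apply _ hs, mul_comm]
    have hm := hK.measurableSet
    calc (weight n x₀ : ℝ≥0∞) * volume (s ∩ K)
        = ∫⁻ _ in s ∩ K, (weight n x₀ : ℝ≥0∞) := by simp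
      _ ≤ ∫⁻ x in s ∩ K, (weight n x : ℝ≥0∞) := by
          refine setLIntegral_mono' (hs.inter hm) fun x hx => ?_
          exact_mod_cast hmin hx.2
      _ ≤ _ := lintegral_mono_set Set.inter_subset_left
  exact (hu.smul_measure (by simpa using (weight_pos x₀).ne')).mono_measure hle

theorem eLpNorm_two_sq {α F : Type*} [MeasurableSpace α] [NormedAddCommGroup F] (μ : Measure α)
    (f : α → F) : eLpNorm f 2 μ ^ 2 = ∫⁻ x, ‖f x‖ₑ ^ 2 ∂μ := by
  have := eLpNorm_nnreal_pow_eq_lintegral (μ := μ) (f := f) (p := 2) (by norm_num)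
  simpa using this

/-- The constant in the weighted Poincaré inequality, squared. -/
def poincareSq (n : ℕ) : ℝ≥0∞ :=
  (wMeasure n Set.univ)⁻¹ * ∫⁻ h : EuclideanSpace ℝ (Fin n), (weight n h : ℝ≥0∞) * ‖h‖ₑ ^ 2

theorem poincareSq_lt_top : poincareSq n < ⊤ := by
  refine ENNReal.mul_lt_top ?_ ?_
  · simpa [ENNReal.inv_lt_top, pos_iff_ne_zero] using wMeasure_ne_zero
  · refine lt_of_le_of_lt ?_ (finite_integral_one_add_norm
      (μ := (volume : Measure (EuclideanSpace ℝ (Fin n)))) (r := (n : ℝ) + 1) (by simp))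
    refine lintegral_mono fun h => ?_
    have e : (weight n h : ℝ≥0∞) * ‖h‖ₑ ^ 2 =
        ENNReal.ofReal ((1 + ‖h‖) ^ (-((n : ℝ) + 3)) * ‖h‖ ^ 2) := by
      rw [ENNReal.ofReal_mul (by positivity), ENNReal.ofReal_pow (norm_nonneg _), ofReal_norm]
      rfl
    rw [e]
    refine ENNReal.ofReal_le_ofReal ?_
    have h1 : (0 : ℝ) < 1 + ‖h‖ := by positivity
    calc (1 + ‖h‖) ^ (-((n : ℝ) + 3)) * ‖h‖ ^ 2
        ≤ (1 + ‖h‖) ^ (-((n : ℝ) + 3)) * (1 + ‖h‖) ^ (2 : ℝ) := by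
          rw [Real.rpow_two]; gcongr; linarith
      _ = _ := by rw [← Real.rpow_add h1]; congr 1; ring

/-- A weighted Poincaré inequality. -/
theorem exists_sub_const_le {w : EuclideanSpace ℝ (Fin n) → ℂ}
    {g : EuclideanSpace ℝ (Fin n) → EuclideanSpace ℂ (Fin n)} (hw : LocallyIntegrable w)
    (hg : MemLp g 2) (hwg : HasWeakGradient w g) :
    ∃ c : ℂ, eLpNorm (fun x => w x - c) 2 (wMeasure n) ^ 2 ≤ poincareSq n * eLpNorm g 2 ^ 2 := by
  obtain ⟨v, hv, hwv⟩ := hw.aestronglyMeasurable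
  have hvL : LocallyIntegrable v := hw.congr hwv
  have hvg : HasWeakGradient v g := hwg.congr hwv ae_eq_rfl
  have hvm : Measurable v := hv.measurable
  have hmw : Measurable (weight n) := continuous_weight.measurable
  have hI : Measurable fun y => ∫⁻ x, ‖v x - v y‖ₑ ^ 2 ∂(wMeasure n) := by
    refine Measurable.lintegral_prod_right' (f := fun z : _ × _ => ‖v z.2 - v z.1‖ₑ ^ 2) ?_
    fun_prop
  obtain ⟨y, hy⟩ := exists_le_laverage (μ := wMeasure n) wMeasure_ne_zero hI.aemeasurable
  refine ⟨v y, ?_⟩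
  have hae : (fun x => w x - v y) =ᵐ[wMeasure n] fun x => v x - v y := by
    filter_upwards [wMeasure_ac.ae_le hwv] with x hx using by rw [hx]
  rw [eLpNorm_congr_ae hae, eLpNorm_two_sq]
  refine hy.trans ?_
  rw [laverage_eq, ENNReal.div_eq_inv_mul, poincareSq, mul_assoc]
  gcongr
  calc ∫⁻ y, ∫⁻ x, ‖v x - v y‖ₑ ^ 2 ∂(wMeasure n) ∂(wMeasure n)
      = ∫⁻ y, (weight n y : ℝ≥0∞) * ∫⁻ x, (weight n x : ℝ≥0∞) * ‖v x - v y‖ₑ ^ 2 := by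
        rw [lintegral_wMeasure hI]
        refine lintegral_congr fun y => ?_
        rw [lintegral_wMeasure (by fun_prop)]
    _ = ∫⁻ y, ∫⁻ h, (weight n y : ℝ≥0∞) * ((weight n (y + h) : ℝ≥0∞) *
          ‖v (y + h) - v y‖ₑ ^ 2) := by
        refine lintegral_congr fun y => ?_
        rw [← lintegral_add_left_eq_self
          (fun x => (weight n x : ℝ≥0∞) * ‖v x - v y‖ₑ ^ 2) y, lintegral_const_mul]
        fun_prop
    _ ≤ ∫⁻ y, ∫⁻ h, (weight n h : ℝ≥0∞) * ‖v (y + h) - v y‖ₑ ^ 2 := by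
        refine lintegral_mono fun y => lintegral_mono fun h => ?_
        simp only
        rw [← mul_assoc]
        gcongr
        exact_mod_cast weight_mul_le y h
    _ = ∫⁻ h, ∫⁻ y, (weight n h : ℝ≥0∞) * ‖v (y + h) - v y‖ₑ ^ 2 := by
        refine lintegral_lintegral_swap (Measurable.aemeasurable ?_)
        unfold Function.uncurry
        fun_prop
    _ ≤ ∫⁻ h, (weight n h : ℝ≥0∞) * ‖h‖ₑ ^ 2 * eLpNorm g 2 ^ 2 := by
        refine lintegral_mono fun h => ?_
        simp only
        rw [lintegral_const_mul _ (by fun_prop), mul_assoc, ← mul_pow,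
          ← eLpNorm_two_sq volume fun y => v (y + h) - v y]
        gcongr
        exact eLpNorm_translate_sub_le hvL hg hvg h
    _ = _ := by rw [lintegral_mul_const]; fun_prop

end Weight

section Complete

variable {n : ℕ}

theorem exists_sobolevFun {τ : ℝ} {p : ℝ≥0∞} [Fact (1 ≤ p)] {f : EuclideanSpace ℝ (Fin n) → ℂ}
    {g : EuclideanSpace ℝ (Fin n) → EuclideanSpace ℂ (Fin n)}
    (h1 : ∀ K, IsCompact K → MemLp f p (volume.restrict K)) (h2 : τ ≠ 0 → MemLp f p volume)
    (h3 : MemLp g p volume) (h4 : HasWeakGradient f g) :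
    ∃ u : SobolevFun n τ p, u.toFun =ᵐ[volume] f ∧ u.grad =ᵐ[volume] g := by
  have hm : AEStronglyMeasurable f volume := (locallyIntegrable_of_memLp_compact h1).aestronglyMeasurable
  have h0 := AEEqFun.coeFn_mk f hm
  let u : SobolevFun n τ p := ⟨AEEqFun.mk f hm,
    fun K hK => (memLp_congr_ae (ae_restrict_of_ae h0)).2 (h1 K hK),
    fun hτ => (memLp_congr_ae h0).2 (h2 hτ), g, h3, h4.congr h0.symm ae_eq_rfl⟩
  have hu : u.toFun =ᵐ[volume] f := h0
  exact ⟨u, hu, u.hasWeakGradient.unique (h4.congr hu.symm ae_eq_rfl)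
    (locallyIntegrable_of_memLp u.memLp_grad) (locallyIntegrable_of_memLp h3)⟩

theorem hasWeakGradient_const (c : ℂ) :
    HasWeakGradient (n := n) (fun _ => c) (fun _ => 0) := by
  intro φ hφ i
  have hi := (hφ.continuous_partial (EuclideanSpace.single i 1)).integrable_of_hasCompactSupport
    (μ := (volume : Measure (EuclideanSpace ℝ (Fin n)))) (hφ.compact_partial _)
  have := integral_mul_fderiv_eq_neg_fderiv_mul_of_integrable (𝕜 := ℂ)
    (μ := (volume : Measure (EuclideanSpace ℝ (Fin n)))) (f := fun _ => c) (g := φ)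
    (v := EuclideanSpace.single i 1) (by simp) (hi.const_mul c)
    ((hφ.continuous.integrable_of_hasCompactSupport hφ.compact).const_mul c)
    (fun x _ => by fun_prop) (fun x _ => (hφ.smooth.differentiable (by simp)) x)
  simpa using this

theorem mk_eq_mk {τ : ℝ} {p : ℝ≥0∞} [Fact (1 ≤ p)] {u v : SobolevFun n τ p}
    (h : u.tauGrad =ᵐ[volume] v.tauGrad) :
    (SeparationQuotient.mk u : SobolevSpace n τ p) = SeparationQuotient.mk v := by
  rw [SeparationQuotient.mk_eq_mk, Metric.inseparable_iff, dist_eq_norm, SobolevFun.norm_def,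
    map_sub, norm_eq_zero, sub_eq_zero]
  exact MemLp.toLp_congr u.memLp_tauGrad v.memLp_tauGrad h

theorem coe_tauGradient_mk {τ : ℝ} {p : ℝ≥0∞} [Fact (1 ≤ p)] (u : SobolevFun n τ p) :
    tauGradient n τ p (SeparationQuotient.mk u) =ᵐ[volume] u.tauGrad :=
  MemLp.coeFn_toLp u.memLp_tauGrad

theorem norm_mk_eq {τ : ℝ} {p : ℝ≥0∞} [Fact (1 ≤ p)] (u : SobolevFun n τ p) :
    ‖(SeparationQuotient.mk u : SobolevSpace n τ p)‖ = (eLpNorm u.tauGrad p volume).toReal :=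
  Lp.norm_toLp _ u.memLp_tauGrad

theorem norm_grad_le {τ : ℝ} {p : ℝ≥0∞} [Fact (1 ≤ p)] (u : SobolevFun n τ p)
    (x : EuclideanSpace ℝ (Fin n)) : ‖u.grad x‖ ≤ ‖u.tauGrad x‖ := by
  rw [EuclideanSpace.norm_eq, EuclideanSpace.norm_eq]
  refine Real.sqrt_le_sqrt ?_
  rw [Fin.sum_univ_succ]
  simp only [SobolevFun.tauGrad, Fin.cons_succ]
  have : 0 ≤ ‖(Fin.cons (Complex.I * τ * u.toFun x) fun i => u.grad x i : Fin (n + 1) → ℂ) 0‖ ^ 2 := by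
    positivity
  linarith

theorem norm_toFun_le {τ : ℝ} {p : ℝ≥0∞} [Fact (1 ≤ p)] (u : SobolevFun n τ p)
    (x : EuclideanSpace ℝ (Fin n)) : |τ| * ‖u.toFun x‖ ≤ ‖u.tauGrad x‖ := by
  have := PiLp.norm_apply_le (u.tauGrad x) 0
  simpa [SobolevFun.tauGrad] using this

/-- Every element of `W^{1,2}_τ` has a representative that is controlled in weighted `L²`. -/
theorem exists_good_rep (n : ℕ) (τ : ℝ) : ∃ C : ℝ, ∀ u : SobolevSpace n τ 2,
    ∃ w : SobolevFun n τ 2, SeparationQuotient.mk w = u ∧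
      MemLp w.toFun 2 (wMeasure n) ∧ (eLpNorm w.toFun 2 (wMeasure n)).toReal ≤ C * ‖u‖ := by
  by_cases hτ : τ = 0
  · subst hτ
    refine ⟨Real.sqrt (poincareSq n).toReal, ?_⟩
    rintro ⟨v⟩
    obtain ⟨c, hc⟩ := exists_sub_const_le v.locallyIntegrable v.memLp_grad v.hasWeakGradient
    have hwg : HasWeakGradient (fun x => v.toFun x + -c) (fun x => v.grad x + 0) :=
      v.hasWeakGradient.add (hasWeakGradient_const (-c)) v.locallyIntegrable
        continuous_const.locallyIntegrable (locallyIntegrable_of_memLp v.memLp_grad)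
        continuous_const.locallyIntegrable
    simp only [add_zero, ← sub_eq_add_neg] at hwg
    obtain ⟨w, hw1, hw2⟩ := exists_sobolevFun (τ := 0) (p := 2) (f := fun x => v.toFun x - c)
      (g := v.grad) (fun K hK => by
        have : IsFiniteMeasure (volume.restrict K) := ⟨by simpa using hK.measure_lt_top⟩
        exact (v.memLp_compact K hK).sub (memLp_const c)) (fun h => absurd rfl h) v.memLp_grad hwg
    have he : eLpNorm w.toFun 2 (wMeasure n) = eLpNorm (fun x => v.toFun x - c) 2 (wMeasure n) :=
      eLpNorm_congr_ae (wMeasure_ac.ae_le hw1)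
    have hfin : poincareSq n * eLpNorm v.grad 2 ^ 2 < ⊤ :=
      ENNReal.mul_lt_top poincareSq_lt_top (ENNReal.pow_lt_top v.memLp_grad.eLpNorm_lt_top)
    refine ⟨w, ?_, ⟨w.locallyIntegrable.aestronglyMeasurable.mono_ac wMeasure_ac, ?_⟩, ?_⟩
    · refine mk_eq_mk ?_
      filter_upwards [hw2] with x hx
      simp [SobolevFun.tauGrad, hx]
    · have h := hc.trans_lt hfin
      rw [← he] at h
      by_contra hcon
      rw [not_lt_top_iff.1 hcon] at h
      simp at h
    · rw [he]
      change _ ≤ _ * ‖(SeparationQuotient.mk v : SobolevSpace n 0 2)‖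
      rw [norm_mk_eq]
      have h1 := ENNReal.toReal_mono hfin.ne hc
      rw [ENNReal.toReal_pow, ENNReal.toReal_mul, ENNReal.toReal_pow] at h1
      have h2 : (eLpNorm v.grad 2 volume).toReal ≤ (eLpNorm v.tauGrad 2 volume).toReal :=
        ENNReal.toReal_mono v.memLp_tauGrad.eLpNorm_ne_top
          (eLpNorm_mono fun x => norm_grad_le v x)
      refine abs_le_of_sq_le_sq' ?_ (by positivity) |>.2
      rw [mul_pow, Real.sq_sqrt ENNReal.toReal_nonneg]
      refine h1.trans ?_
      gcongr
  · refine ⟨|τ|⁻¹, ?_⟩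
    rintro ⟨v⟩
    have hv := v.memLp hτ
    refine ⟨v, rfl, hv.mono_measure wMeasure_le, ?_⟩
    change _ ≤ _ * ‖(SeparationQuotient.mk v : SobolevSpace n τ 2)‖
    rw [norm_mk_eq]
    have h1 : eLpNorm v.toFun 2 volume ≤ ENNReal.ofReal |τ|⁻¹ * eLpNorm v.tauGrad 2 volume := by
      refine eLpNorm_le_mul_eLpNorm_of_ae_le_mul (ae_of_all _ fun x => ?_) 2
      rw [inv_mul_eq_div, le_div_iff₀ (by positivity), mul_comm]
      exact norm_toFun_le v x
    have h2 := (eLpNorm_mono_measure v.toFun wMeasure_le (p := 2)).trans h1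
    have h3 := ENNReal.toReal_mono
      (ENNReal.mul_ne_top ENNReal.ofReal_ne_top v.memLp_tauGrad.eLpNorm_ne_top) h2
    rwa [ENNReal.toReal_mul, ENNReal.toReal_ofReal (by positivity)] at h3

/-- Pairing with a continuous compactly supported function is continuous on weighted `L²`. -/
theorem exists_clm_weighted {ψ : EuclideanSpace ℝ (Fin n) → ℂ} (hψ : Continuous ψ)
    (hc : HasCompactSupport ψ) :
    ∃ Λ : Lp ℂ 2 (wMeasure n) →L[ℂ] ℂ, ∀ f, Λ f = ∫ x, f x * ψ x := by
  have hw0 : ∀ x : EuclideanSpace ℝ (Fin n), (weight n x : ℂ) ≠ 0 := fun x => by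
    exact_mod_cast (weight_pos x).ne'
  have hwc : Continuous fun x : EuclideanSpace ℝ (Fin n) => (weight n x : ℂ) :=
    Complex.continuous_ofReal.comp (NNReal.continuous_coe.comp continuous_weight)
  let k : EuclideanSpace ℝ (Fin n) → ℂ := fun x => star (ψ x * (weight n x : ℂ)⁻¹)
  have hkc : Continuous k := (hψ.mul (hwc.inv₀ hw0)).star
  have hks : HasCompactSupport k :=
    (hc.mul_right (f' := fun x => (weight n x : ℂ)⁻¹)).comp_left (g := star) (by simp)
  have hk : MemLp k 2 (wMeasure n) :=
    (hkc.memLp_of_hasCompactSupport (μ := volume) hks).mono_measure wMeasure_le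
  refine ⟨innerSL ℂ (hk.toLp k), fun f => ?_⟩
  rw [innerSL_apply_apply, L2.inner_def]
  have e : ∀ᵐ x ∂(wMeasure n), inner ℂ (hk.toLp k x) (f x) = f x * (ψ x * (weight n x : ℂ)⁻¹) := by
    filter_upwards [hk.coeFn_toLp] with x hx
    rw [hx]
    simp [k]
  rw [integral_congr_ae e]
  refine (integral_withDensity_eq_integral_smul continuous_weight.measurable _).trans ?_
  refine integral_congr_ae (ae_of_all _ fun x => ?_)
  change ((weight n x : ℝ≥0) • (f x * (ψ x * (weight n x : ℂ)⁻¹)) : ℂ) = f x * ψ x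
  rw [NNReal.smul_def, Complex.real_smul]
  have := hw0 x
  field_simp

/-- Pairing a component with a continuous compactly supported function is continuous on `L²`. -/
theorem exists_clm_coord {m : ℕ} {ψ : EuclideanSpace ℝ (Fin n) → ℂ} (hψ : Continuous ψ)
    (hc : HasCompactSupport ψ) (j : Fin m) :
    ∃ Γ : Lp (EuclideanSpace ℂ (Fin m)) 2 (volume : Measure (EuclideanSpace ℝ (Fin n))) →L[ℂ] ℂ,
      ∀ f, Γ f = ∫ x, f x j * ψ x := by
  let k : EuclideanSpace ℝ (Fin n) → EuclideanSpace ℂ (Fin m) :=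
    fun x => star (ψ x) • EuclideanSpace.single j (1 : ℂ)
  have hkc : Continuous k := hψ.star.smul continuous_const
  have hks : HasCompactSupport k :=
    (hc.comp_left (g := star) (by simp)).smul_right
  have hk : MemLp k 2 (volume : Measure (EuclideanSpace ℝ (Fin n))) :=
    hkc.memLp_of_hasCompactSupport hks
  refine ⟨innerSL ℂ (hk.toLp k), fun f => ?_⟩
  rw [innerSL_apply_apply, L2.inner_def]
  refine integral_congr_ae ?_
  filter_upwards [hk.coeFn_toLp] with x hx
  rw [hx]
  change inner ℂ (star (ψ x) • EuclideanSpace.single j (1 : ℂ)) (f x) = _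
  rw [inner_smul_left, EuclideanSpace.inner_single_left]
  simp [mul_comm]

/-- `W^{1,2}_τ(ℝⁿ)` is complete, as needed for the Lax–Milgram lemma. -/
instance (n : ℕ) (τ : ℝ) : CompleteSpace (SobolevSpace n τ 2) := by
  refine NormedAddCommGroup.completeSpace_of_summable_imp_tendsto fun u hu => ?_
  obtain ⟨C, hC⟩ := exists_good_rep n τ
  choose w hwu hw2 hwC using fun k => hC (u k)
  let F : ℕ → Lp ℂ 2 (wMeasure n) := fun k => (hw2 k).toLp _
  have hF : Summable F := by
    refine Summable.of_norm_bounded (hu.mul_left C) fun k => ?_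
    rw [Lp.norm_toLp]
    exact hwC k
  let G := fun k => tauGradient n τ 2 (u k)
  have hG : Summable G := by
    refine Summable.of_norm (hu.congr fun k => ?_)
    exact ((tauGradient n τ 2).norm_map (u k)).symm
  have hFw : ∀ k, F k =ᵐ[volume] (w k).toFun := fun k =>
    volume_ac.ae_le (hw2 k).coeFn_toLp
  have hGw : ∀ k, G k =ᵐ[volume] (w k).tauGrad := fun k => by
    simp only [G, ← hwu k]
    exact coe_tauGradient_mk (w k)
  set f : Lp ℂ 2 (wMeasure n) := ∑' k, F k with hf
  set g := ∑' k, G k with hg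
  have hf2 : MemLp f 2 (wMeasure n) := Lp.memLp f
  have hg2 : MemLp g 2 volume := Lp.memLp g
  have hfc : ∀ K, IsCompact K → MemLp f 2 (volume.restrict K) :=
    fun K hK => memLp_compact_of_wMeasure hf2 hK
  have hfl : LocallyIntegrable f := locallyIntegrable_of_memLp_compact hfc
  let g' : EuclideanSpace ℝ (Fin n) → EuclideanSpace ℂ (Fin n) :=
    fun x => WithLp.toLp 2 fun i => g x i.succ
  have hg' : MemLp g' 2 volume := MemLp.of_eval_piLp fun i => by
    simpa [g'] using hg2.eval_piLp i.succ
  have hwg : HasWeakGradient f g' := by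
    intro φ hφ i
    obtain ⟨Λ, hΛ⟩ := exists_clm_weighted (hφ.continuous_partial (EuclideanSpace.single i 1))
      (hφ.compact_partial _)
    obtain ⟨Γ, hΓ⟩ := exists_clm_coord hφ.continuous hφ.compact (i.succ : Fin (n + 1))
    have h1 := Λ.hasSum hF.hasSum
    have h2 := (Γ.hasSum hG.hasSum).neg
    have h3 : ∀ k, Λ (F k) = -Γ (G k) := by
      intro k
      rw [hΛ, hΓ]
      have := (w k).hasWeakGradient φ hφ i
      refine Eq.trans (integral_congr_ae ?_) (this.trans (congrArg Neg.neg (integral_congr_ae ?_)))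
      · filter_upwards [hFw k] with x hx using by rw [hx]
      · filter_upwards [hGw k] with x hx
        rw [hx]
        simp [SobolevFun.tauGrad]
    simp_rw [h3] at h1
    have h4 := h1.unique h2
    rw [hΛ, hΓ] at h4
    exact h4
  have hzero : ∀ᵐ x, Complex.I * τ * f x = g x 0 := by
    have hl : LocallyIntegrable fun x => Complex.I * τ * f x := hfl.smul (Complex.I * (τ : ℂ))
    refine ae_eq_of_integral_contDiff_smul_eq hl
      (locallyIntegrable_coord (locallyIntegrable_of_memLp hg2) 0) fun φ hφ hc => ?_
    have ht : IsTestFun fun x => (φ x : ℂ) :=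
      ⟨Complex.ofRealCLM.contDiff.comp hφ, hc.comp_left (g := ((↑) : ℝ → ℂ)) (by simp)⟩
    obtain ⟨Λ, hΛ⟩ := exists_clm_weighted ht.continuous ht.compact
    obtain ⟨Γ, hΓ⟩ := exists_clm_coord ht.continuous ht.compact (0 : Fin (n + 1))
    have h1 := (Λ.hasSum hF.hasSum).mul_left (Complex.I * (τ : ℂ))
    have h2 := Γ.hasSum hG.hasSum
    have h3 : ∀ k, Complex.I * (τ : ℂ) * Λ (F k) = Γ (G k) := by
      intro k
      rw [hΛ, hΓ, ← integral_const_mul]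
      refine integral_congr_ae ?_
      filter_upwards [hFw k, hGw k] with x hx hx'
      rw [hx, hx']
      simp [SobolevFun.tauGrad, mul_assoc]
    simp_rw [h3] at h1
    have h4 := h1.unique h2
    rw [hΛ, hΓ, ← integral_const_mul] at h4
    refine Eq.trans ?_ (h4.trans ?_) <;> refine integral_congr_ae (ae_of_all _ fun x => ?_)
    · simp only [Complex.real_smul]; ring
    · simp only [Complex.real_smul]; ring
  obtain ⟨a, ha1, ha2⟩ := exists_sobolevFun (τ := τ) hfc (fun hτ => by
    have h5 : MemLp (fun x => (Complex.I * (τ : ℂ))⁻¹ * g x 0) 2 volume :=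
      (hg2.eval_piLp 0).const_mul _
    refine (memLp_congr_ae ?_).2 h5
    filter_upwards [hzero] with x hx
    rw [← hx]
    have : (τ : ℂ) ≠ 0 := by exact_mod_cast hτ
    field_simp [Complex.I_ne_zero]) hg' hwg
  have hag : tauGradient n τ 2 (SeparationQuotient.mk a) = g := by
    refine Lp.ext ((coe_tauGradient_mk a).trans ?_)
    filter_upwards [ha1, ha2, hzero] with x h1 h2 h3
    ext i
    refine Fin.cases ?_ (fun i => ?_) i
    · simp [SobolevFun.tauGrad, h1, h3]
    · simp [SobolevFun.tauGrad, h2, g']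
  refine ⟨SeparationQuotient.mk a, ?_⟩
  rw [(tauGradient n τ 2).isometry.isEmbedding.tendsto_nhds_iff, hag]
  have := hG.hasSum.tendsto_sum_nat
  refine this.congr fun N => ?_
  simp [G]

end Complete

/-- The space `L^p(ℝⁿ; ℂ^{1+n})`. -/
abbrev LpVec (n : ℕ) (p : ℝ≥0∞) : Type :=
  Lp (EuclideanSpace ℂ (Fin (n + 1))) p (volume : Measure (EuclideanSpace ℝ (Fin n)))

/-- Coefficients `A ∈ L^∞(ℝⁿ; ℂ^{(1+n)×(1+n)})` with `Re ⟨A(x)ξ, ξ⟩ ≥ λ |ξ|²`, where `λ > 0`. -/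
structure IsStronglyElliptic {n : ℕ}
    (A : EuclideanSpace ℝ (Fin n) → Matrix (Fin (n + 1)) (Fin (n + 1)) ℂ) (lam : ℝ) : Prop where
  memLp_top : ∀ i j, MemLp (fun x => A x i j) ∞ volume
  pos : 0 < lam
  elliptic : ∀ᵐ x, ∀ ξ : EuclideanSpace ℂ (Fin (n + 1)),
    lam * ‖ξ‖ ^ 2 ≤ (inner ℂ ξ (Matrix.toEuclideanCLM (n := Fin (n + 1)) (𝕜 := ℂ) (A x) ξ)).re

/-- The operator `S_τ^* : L²(ℝⁿ; ℂ^{1+n}) → W^{-1,2}_τ(ℝⁿ)`,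
`⟨S_τ^* f, v⟩ = ∫ f · conj (S_τ v)`. -/
def tauDivergence (n : ℕ) (τ : ℝ) : LpVec n 2 →L[ℂ] AntiDual (SobolevSpace n τ 2) :=
  LinearMap.mkContinuous
    { toFun := fun f => (innerSLFlip ℂ f).comp (tauGradient n τ 2).toContinuousLinearMap
      map_add' := fun f g => by ext v; simp
      map_smul' := fun c f => by ext v; simp } 1 fun f => by
    refine ContinuousLinearMap.opNorm_le_bound _ (by positivity) fun v => ?_
    simp only [LinearMap.coe_mk, AddHom.coe_mk, ContinuousLinearMap.comp_apply,
      LinearIsometry.coe_toContinuousLinearMap, innerSLFlip_apply_apply]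
    refine (norm_inner_le_norm _ _).trans_eq ?_
    rw [LinearIsometry.norm_map]; ring

theorem tauDivergence_apply {n : ℕ} {τ : ℝ} (f : LpVec n 2) (v : SobolevSpace n τ 2) :
    tauDivergence n τ f v = ∫ x, inner ℂ (tauGradient n τ 2 v x) (f x) := by
  rw [← L2.inner_def]; rfl

section Operator

variable {n : ℕ} {A : EuclideanSpace ℝ (Fin n) → Matrix (Fin (n + 1)) (Fin (n + 1)) ℂ} {lam : ℝ}

theorem memLp_top_of_entries {α W : Type*} [MeasurableSpace α] {μ : Measure α} {m : ℕ}
    [NormedAddCommGroup W] [NormedSpace ℂ W] (Φ : Matrix (Fin m) (Fin m) ℂ →ₗ[ℂ] W)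
    {B : α → Matrix (Fin m) (Fin m) ℂ} (hB : ∀ i j, MemLp (fun x => B x i j) ∞ μ) :
    MemLp (fun x => Φ (B x)) ∞ μ := by
  have e : (fun x => Φ (B x)) = fun x => ∑ i, ∑ j, B x i j • Φ (Matrix.single i j 1) := by
    funext x
    conv_lhs => rw [Matrix.matrix_eq_sum_single (B x)]
    simp only [map_sum, ← map_smul, Matrix.smul_single, smul_eq_mul, mul_one]
  rw [e]
  exact memLp_finsetSum _ fun i _ => memLp_finsetSum _ fun j _ =>
    (ContinuousLinearMap.toSpanSingleton ℂ (Φ (Matrix.single i j 1))).comp_memLp' (hB i j)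

theorem IsStronglyElliptic.memLp_clm (hA : IsStronglyElliptic A lam) :
    MemLp (fun x => Matrix.toEuclideanCLM (n := Fin (n + 1)) (𝕜 := ℂ) (A x)) ∞
      (volume : Measure (EuclideanSpace ℝ (Fin n))) :=
  memLp_top_of_entries
    { toFun := fun M => Matrix.toEuclideanCLM (n := Fin (n + 1)) (𝕜 := ℂ) M
      map_add' := fun M N => map_add _ M N
      map_smul' := fun c M => map_smul _ c M } hA.memLp_top

/-- Multiplication by the coefficients as an operator on `L²(ℝⁿ; ℂ^{1+n})`. -/
def coeffMul (hA : IsStronglyElliptic A lam) : LpVec n 2 →L[ℂ] LpVec n 2 :=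
  (ContinuousLinearMap.id ℂ
    (EuclideanSpace ℂ (Fin (n + 1)) →L[ℂ] EuclideanSpace ℂ (Fin (n + 1)))).holderL
    volume ∞ 2 2 (hA.memLp_clm.toLp _)

theorem coe_coeffMul (hA : IsStronglyElliptic A lam) (f : LpVec n 2) :
    coeffMul hA f =ᵐ[volume]
      fun x => Matrix.toEuclideanCLM (n := Fin (n + 1)) (𝕜 := ℂ) (A x) (f x) := by
  refine (ContinuousLinearMap.coeFn_holder _ _ _).trans ?_
  filter_upwards [hA.memLp_clm.coeFn_toLp] with x hx
  rw [hx]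
  rfl

/-- The operator `L_τ = S_τ^* A S_τ : W^{1,2}_τ(ℝⁿ) → W^{-1,2}_τ(ℝⁿ)`. -/
def ellipticOperator (hA : IsStronglyElliptic A lam) (τ : ℝ) :
    SobolevSpace n τ 2 →L[ℂ] AntiDual (SobolevSpace n τ 2) :=
  (tauDivergence n τ).comp ((coeffMul hA).comp (tauGradient n τ 2).toContinuousLinearMap)

theorem ellipticOperator_apply (hA : IsStronglyElliptic A lam) (τ : ℝ)
    (u v : SobolevSpace n τ 2) :
    ellipticOperator hA τ u v = ∫ x, inner ℂ (tauGradient n τ 2 v x)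
      (Matrix.toEuclideanCLM (n := Fin (n + 1)) (𝕜 := ℂ) (A x) (tauGradient n τ 2 u x)) := by
  refine (tauDivergence_apply _ v).trans (integral_congr_ae ?_)
  filter_upwards [coe_coeffMul hA (tauGradient n τ 2 u)] with x hx
  exact congrArg _ hx

theorem re_inner_coeffMul (hA : IsStronglyElliptic A lam) (f : LpVec n 2) :
    lam * ‖f‖ ^ 2 ≤ (inner ℂ f (coeffMul hA f)).re := by
  have h1 : ‖f‖ ^ 2 = ∫ x, ‖f x‖ ^ 2 := by
    have h := inner_self_eq_norm_sq_to_K (𝕜 := ℂ) f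
    rw [L2.inner_def] at h
    have h2 : ∫ x, inner ℂ (f x) (f x) = ((∫ x, ‖f x‖ ^ 2 : ℝ) : ℂ) := by
      rw [← integral_complex_ofReal]
      refine integral_congr_ae (ae_of_all _ fun x => ?_)
      simp [inner_self_eq_norm_sq_to_K]
    rw [h2] at h
    have h4 := congrArg Complex.re h
    rw [Complex.ofReal_re] at h4
    rw [h4]
    exact (Complex.ofReal_re (‖f‖ ^ 2)).symm.trans (by norm_num)
  have hi : Integrable fun x => inner ℂ (f x) (coeffMul hA f x) := L2.integrable_inner f _
  have h3 : (∫ x, inner ℂ (f x) (coeffMul hA f x)).re =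
      ∫ x, (inner ℂ (f x) (coeffMul hA f x)).re := (integral_re hi).symm
  rw [L2.inner_def, h3, h1, ← integral_const_mul]
  have hsq : Integrable fun x => ‖f x‖ ^ 2 := (Lp.memLp f).integrable_norm_pow (by norm_num)
  refine integral_mono_ae (hsq.const_mul lam) hi.re ?_
  filter_upwards [coe_coeffMul hA f, hA.elliptic] with x hx he
  simp only [hx]
  exact he _

theorem re_ellipticOperator_self (hA : IsStronglyElliptic A lam) (τ : ℝ)
    (u : SobolevSpace n τ 2) : lam * ‖u‖ ^ 2 ≤ (ellipticOperator hA τ u u).re := by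
  rw [← (tauGradient n τ 2).norm_map u]
  exact re_inner_coeffMul hA _

theorem ellipticOperator_injective (hA : IsStronglyElliptic A lam) (τ : ℝ) :
    Function.Injective (ellipticOperator hA τ) := by
  rw [injective_iff_map_eq_zero]
  intro u hu
  have h := re_ellipticOperator_self hA τ u
  rw [hu] at h
  simp only [zero_apply, Complex.zero_re] at h
  have := hA.pos
  have h2 : ‖u‖ ^ 2 ≤ 0 := by
    by_contra hc
    push Not at hc
    nlinarith
  simpa using h2

/-- Solvability, by the Lax–Milgram lemma. -/
theorem ellipticOperator_surjective (hA : IsStronglyElliptic A lam) (τ : ℝ) :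
    Function.Surjective (ellipticOperator hA τ) := by
  intro F
  let R := LinearMap.range (tauGradient n τ 2).toLinearMap
  let S : SobolevSpace n τ 2 ≃ₗᵢ[ℂ] R := (tauGradient n τ 2).equivRange
  have hS : ∀ u, ((S u : R) : LpVec n 2) = tauGradient n τ 2 u := fun _ => rfl
  have hR : CompleteSpace R :=
    (completeSpace_congr (e := S.toEquiv) S.isometry.isUniformEmbedding).1 inferInstance
  let T : R →L[ℂ] R := R.orthogonalProjectionOnto.comp ((coeffMul hA).comp R.subtypeL)
  have hT : ∀ r s : R, inner ℂ r (T s) = inner ℂ (r : LpVec n 2) (coeffMul hA s) := by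
    intro r s
    change inner ℂ r (R.orthogonalProjectionOnto (coeffMul hA s)) = _
    rw [Submodule.inner_orthogonalProjectionOnto_eq_of_mem_left]
  have hU : IsUnit T := by
    refine ContinuousLinearMap.isUnit_of_forall_le_norm_inner_map T
      (c := Real.toNNReal lam) (Real.toNNReal_pos.2 hA.pos) fun r => ?_
    rw [Real.coe_toNNReal _ hA.pos.le, norm_inner_symm, hT, mul_comm]
    exact (re_inner_coeffMul hA r).trans (Complex.re_le_norm _)
  let ℓ : R →L[ℂ] ℂ :=
    LinearMap.mkContinuous
      { toFun := fun r => star (F (S.symm r))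
        map_add' := fun r s => by simp
        map_smul' := fun c r => by simp } ‖F‖ fun r => by
      have := F.le_opNorm (S.symm r)
      rw [S.symm.norm_map] at this
      simpa using this
  let z := (InnerProductSpace.toDual ℂ R).symm ℓ
  have hz : ∀ r, inner ℂ r z = F (S.symm r) := by
    intro r
    have h : inner ℂ z r = ℓ r := InnerProductSpace.toDual_symm_apply
    calc inner ℂ r z = star (inner ℂ z r) := (inner_conj_symm r z).symm
      _ = star (star (F (S.symm r))) := congrArg star h
      _ = _ := star_star _
  obtain ⟨r, hr⟩ := (ContinuousLinearMap.isUnit_iff_bijective.1 hU).2 z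
  refine ⟨S.symm r, ?_⟩
  ext v
  have h1 : ellipticOperator hA τ (S.symm r) v =
      inner ℂ ((S v : R) : LpVec n 2) (coeffMul hA (S (S.symm r) : R)) := rfl
  rw [h1, S.apply_symm_apply, ← hT, hr, hz, S.symm_apply_apply]

/-- The isomorphism `L_τ : W^{1,2}_τ(ℝⁿ) → W^{-1,2}_τ(ℝⁿ)`. -/
def ellipticEquiv (hA : IsStronglyElliptic A lam) (τ : ℝ) :
    SobolevSpace n τ 2 ≃L[ℂ] AntiDual (SobolevSpace n τ 2) :=
  ContinuousLinearEquiv.ofBijective (ellipticOperator hA τ)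
    (LinearMap.ker_eq_bot.2 (ellipticOperator_injective hA τ))
    (LinearMap.range_eq_top.2 (ellipticOperator_surjective hA τ))

/-- The Hodge projector `S_τ L_τ⁻¹ S_τ^*` on `L²(ℝⁿ; ℂ^{1+n})`. -/
def hodgeProjector (hA : IsStronglyElliptic A lam) (τ : ℝ) : LpVec n 2 →L[ℂ] LpVec n 2 :=
  (tauGradient n τ 2).toContinuousLinearMap.comp
    ((ellipticEquiv hA τ).symm.toContinuousLinearMap.comp (tauDivergence n τ))

/-- `S_τ L_τ⁻¹ S_τ^*` is `L^p`-bounded with bound `C`: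
`‖S_τ L_τ⁻¹ S_τ^* f‖_p ≤ C ‖f‖_p` for all `f ∈ L^p ∩ L²`. -/
def HodgeBounded (hA : IsStronglyElliptic A lam) (τ : ℝ) (p : ℝ≥0∞) (C : ℝ≥0) : Prop :=
  ∀ f : LpVec n 2, MemLp f p volume →
    eLpNorm (hodgeProjector hA τ f) p volume ≤ C * eLpNorm f p volume

end Operator

/-- An element of `W^{-1,2}_τ` and an element of `W^{-1,p}_τ = (W^{1,q}_τ)^*` (`q` the Hölder
conjugate of `p`) are the same distribution: they agree on all test functions. -/
def SameDistribution {n : ℕ} {τ : ℝ} {q : ℝ≥0∞} [Fact (1 ≤ q)]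
    (F₂ : AntiDual (SobolevSpace n τ 2)) (F : AntiDual (SobolevSpace n τ q)) : Prop :=
  ∀ φ : EuclideanSpace ℝ (Fin n) → ℂ, IsTestFun φ →
    ∀ (v₂ : SobolevSpace n τ 2) (v : SobolevSpace n τ q),
      Represents φ v₂ → Represents φ v → F₂ v₂ = F v

/-- `‖L_τ⁻¹ F‖_{W^{1,p}_τ} ≤ C ‖F‖_{W^{-1,p}_τ}` for all `F ∈ W^{-1,p}_τ ∩ W^{-1,2}_τ`, where
`W^{-1,p}_τ` is the anti-dual of `W^{1,q}_τ`. The element `F` of the intersection is given by its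
two incarnations `F₂ ∈ W^{-1,2}_τ` and `F ∈ W^{-1,p}_τ`; the inequality includes that the function
`L_τ⁻¹ F ∈ W^{1,2}_τ` belongs to `W^{1,p}_τ`. -/
def InverseBounded {n : ℕ} {A : EuclideanSpace ℝ (Fin n) → Matrix (Fin (n + 1)) (Fin (n + 1)) ℂ}
    {lam : ℝ} (hA : IsStronglyElliptic A lam) (τ : ℝ) (p q : ℝ≥0∞) [Fact (1 ≤ p)] [Fact (1 ≤ q)]
    (C : ℝ≥0) : Prop :=
  ∀ (F₂ : AntiDual (SobolevSpace n τ 2)) (F : AntiDual (SobolevSpace n τ q)),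
    SameDistribution F₂ F →
      ∃ (f : EuclideanSpace ℝ (Fin n) → ℂ) (w : SobolevSpace n τ p),
        Represents f ((ellipticEquiv hA τ).symm F₂) ∧ Represents f w ∧ ‖w‖ ≤ C * ‖F‖

end TauSobolev

end

/-! Write S for S_τ, L for L_τ, P = S L⁻¹ S^* and q = p'. The norm of W^{1,p}_τ is the L^p norm of
the τ-gradient, so both properties compare L^p norms of Su. Both implications keep the constant, so
K = 1 works.

From (ii) to (i): for f ∈ L^p ∩ L² the functional S^*f also acts on W^{1,q}_τ by v ↦ ∫ f · conj(Sv),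
with norm at most ‖f‖_p by Hölder (`exists_antiDual_eq_integral`). Property (ii) applied to S^*f is
then (i).

From (i) to (ii): instead of lifting F to a vector field that lies in L^p and in L² at once, one
argues by duality. Put u = L⁻¹F and h = A S u ∈ L². Then F = S^*h and Su = Ph. For φ ∈ L² ∩ L^q this
gives ⟨φ, Su⟩ = ⟨P^*φ, h⟩. Since P vanishes on the orthogonal complement of the closed range of S,
P^*φ = Sv for some v ∈ W^{1,2}_τ, and so ⟨φ, Su⟩ = F(v). By duality P^* is L^q-bounded with the
constant C of (i), hence v ∈ W^{1,q}_τ with norm at most C‖φ‖_q. Therefore |⟨φ, Su⟩| ≤ C‖F‖‖φ‖_q,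
and the converse of Hölder's inequality (`eLpNorm_le_of_inner`) puts Su in L^p.

The delicate point is the meaning of F(v): the two incarnations of F agree on test functions only.
They agree at v (`SameDistribution.apply_mk_eq`) because test functions approximate v in W^{1,2}_τ
and W^{1,q}_τ simultaneously (`exists_isTestFun_tauDist_le`). Mollification reduces to smooth v,
which is then cut off. For τ = 0 the function v need not lie in any L^r, so its mean over a ball of
radius comparable to R is subtracted before cutting off at scale R. Poincaré's inequality then shows
that (v - c)∇χ_R is bounded in L^r, but not that it is small. Averaging over N scales with disjoint
annuli repairs this: the mean of N bounded, disjointly supported functions has norm O(N^{1/r-1}),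
which tends to 0 as r > 1. The construction does not involve r, so it serves both exponents. -/

namespace TauSobolev

/-! ### Hölder's inequality and its converse -/

section Duality

variable {α G : Type*} [MeasurableSpace α] {μ : Measure α} [NormedAddCommGroup G]
  [InnerProductSpace ℂ G] {p q : ℝ≥0∞}

/-- Hölder's inequality for inner products. -/
theorem enorm_integral_inner_le [p.HolderConjugate q] {f g : α → G}
    (hf : AEStronglyMeasurable f μ) (hg : AEStronglyMeasurable g μ) :
    ‖∫ x, inner ℂ (f x) (g x) ∂μ‖ₑ ≤ eLpNorm f p μ * eLpNorm g q μ := by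
  refine (enorm_integral_le_lintegral_enorm _).trans ?_
  rw [← eLpNorm_one_eq_lintegral_enorm]
  have := eLpNorm_le_eLpNorm_mul_eLpNorm_of_nnnorm (p := p) (q := q) (r := 1) hf hg
    (fun a b => inner ℂ a b) 1 (ae_of_all _ fun x => by
      rw [one_mul]; exact nnnorm_inner_le_nnnorm _ _)
  simpa using this

theorem integrable_inner_of_memLp [p.HolderConjugate q] {f g : α → G} (hf : MemLp f p μ)
    (hg : MemLp g q μ) : Integrable (fun x => inner ℂ (f x) (g x)) μ := by
  rw [← memLp_one_iff_integrable]
  refine ⟨hf.1.inner hg.1, (eLpNorm_le_eLpNorm_mul_eLpNorm_of_nnnorm (p := p) (q := q) (r := 1)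
    hf.1 hg.1 (fun a b => inner ℂ a b) 1 (ae_of_all _ fun x => by
      rw [one_mul]; exact nnnorm_inner_le_nnnorm _ _)).trans_lt ?_⟩
  simpa using ENNReal.mul_lt_top hf.2 hg.2

/-- A function in `L²` that is bounded in the `L^p` norm as a functional on `L² ∩ L^p` is in
the conjugate space `L^q`. -/
theorem eLpNorm_le_of_inner [p.HolderConjugate q] (hp : p ≠ ⊤) (hq : q ≠ ⊤) {h : α → G}
    (hh : MemLp h 2 μ) (M : ℝ≥0)
    (H : ∀ ψ : α → G, MemLp ψ 2 μ → MemLp ψ p μ →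
      ‖∫ x, inner ℂ (h x) (ψ x) ∂μ‖ₑ ≤ M * eLpNorm ψ p μ) :
    eLpNorm h q μ ≤ M := by
  wlog hm : StronglyMeasurable h generalizing h
  · have hae := hh.1.ae_eq_mk
    rw [eLpNorm_congr_ae hae]
    refine this ((memLp_congr_ae hae).1 hh) (fun ψ h1 h2 => ?_) hh.1.stronglyMeasurable_mk
    rw [← integral_congr_ae (f := fun x => inner ℂ (h x) (ψ x))]
    · exact H ψ h1 h2
    · filter_upwards [hae] with x hx using by rw [hx]
  have hpq := ENNReal.HolderConjugate.toReal_of_ne_top hp hq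
  have hp0 : p ≠ 0 := by rintro rfl; simpa using hpq.pos
  have hq0 : q ≠ 0 := by rintro rfl; simpa using hpq.symm.pos
  set P := p.toReal
  set Q := q.toReal
  have hQ1 : 0 < Q - 1 := hpq.symm.sub_one_pos
  -- Two-sided truncation: the lower bound gives `E k` finite measure because h ∈ L², the upper
  -- bound makes h bounded there. Test functions built from h on `E k` thus lie in every L^r.
  let E : ℕ → Set α := fun k => {x | ((k : ℝ) + 1)⁻¹ ≤ ‖h x‖ ∧ ‖h x‖ ≤ (k : ℝ) + 1}
  have hE : ∀ k, MeasurableSet (E k) := fun k =>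
    (measurableSet_le measurable_const hm.norm.measurable).inter
      (measurableSet_le hm.norm.measurable measurable_const)
  have hEfin : ∀ k, μ (E k) < ⊤ := fun k => by
    refine lt_of_le_of_lt (measure_mono ?_) (hh.meas_ge_lt_top (by simp) (by simp)
      (ε := ((k : ℝ≥0) + 1)⁻¹) (by positivity))
    intro x hx
    have := hx.1
    simp only [Set.mem_ofPred_eq, ← NNReal.coe_le_coe]
    simpa using this
  have hpos : ∀ k, ∀ x ∈ E k, 0 < ‖h x‖ := fun k x hx => lt_of_lt_of_le (by positivity) hx.1
  have key : ∀ k, ∫⁻ x in E k, ‖h x‖ₑ ^ Q ∂μ ≤ (M : ℝ≥0∞) ^ Q := by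
    intro k
    have : IsFiniteMeasure (μ.restrict (E k)) := ⟨by simpa using hEfin k⟩
    -- The extremal function in Hölder's inequality: ⟨h, ψ₀⟩ = |h|^Q and |ψ₀|^P = |h|^Q.
    let ψ₀ : α → G := fun x => ((‖h x‖ ^ (Q - 2) : ℝ) : ℂ) • h x
    have hψm : AEStronglyMeasurable ψ₀ (μ.restrict (E k)) := by
      refine (StronglyMeasurable.smul ?_ hm).aestronglyMeasurable
      exact (Complex.measurable_ofReal.comp (hm.norm.measurable.pow_const _)).stronglyMeasurable
    have hψn : ∀ x ∈ E k, ‖ψ₀ x‖ = ‖h x‖ ^ (Q - 1) := by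
      intro x hx
      have h0 := hpos k x hx
      simp only [ψ₀, norm_smul, Complex.norm_real]
      rw [Real.norm_of_nonneg (by positivity), ← Real.rpow_add_one h0.ne']
      congr 1; ring
    have hψL : ∀ r : ℝ≥0∞, MemLp ((E k).indicator ψ₀) r μ := by
      intro r
      rw [memLp_indicator_iff_restrict (hE k)]
      refine MemLp.of_bound hψm (((k : ℝ) + 1) ^ (Q - 1)) ?_
      filter_upwards [ae_restrict_mem (hE k)] with x hx
      rw [hψn x hx]
      exact Real.rpow_le_rpow (norm_nonneg _) hx.2 hQ1.le
    have hH := H _ (hψL 2) (hψL p)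
    set I := ∫⁻ x in E k, ‖h x‖ₑ ^ Q ∂μ with hI
    have hIfin : I ≠ ⊤ := by
      refine ne_of_lt (lt_of_le_of_lt (setLIntegral_mono' (hE k)
        (g := fun _ => ENNReal.ofReal (((k : ℝ) + 1) ^ Q)) fun x hx => ?_) ?_)
      · rw [← ofReal_norm, ENNReal.ofReal_rpow_of_nonneg (norm_nonneg _) hpq.symm.nonneg]
        exact ENNReal.ofReal_le_ofReal
          (Real.rpow_le_rpow (norm_nonneg _) hx.2 hpq.symm.nonneg)
      · rw [setLIntegral_const]
        exact ENNReal.mul_lt_top ENNReal.ofReal_lt_top (hEfin k)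
    have e1 : eLpNorm ((E k).indicator ψ₀) p μ = I ^ (1 / P) := by
      rw [eLpNorm_indicator_eq_eLpNorm_restrict (hE k),
        eLpNorm_eq_lintegral_rpow_enorm_toReal hp0 hp]
      congr 1
      refine setLIntegral_congr_fun (hE k) fun x hx => ?_
      rw [← ofReal_norm, hψn x hx, ← ENNReal.ofReal_rpow_of_nonneg (norm_nonneg _) hQ1.le,
        ofReal_norm, ← ENNReal.rpow_mul, hpq.symm.sub_one_mul_conj]
    have e2 : ‖∫ x, inner ℂ (h x) ((E k).indicator ψ₀ x) ∂μ‖ₑ = I := by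
      have e3 : ∀ x, inner ℂ (h x) ((E k).indicator ψ₀ x) =
          (((E k).indicator (fun x => ‖h x‖ ^ Q) x : ℝ) : ℂ) := by
        intro x
        by_cases hx : x ∈ E k
        · have h0 := hpos k x hx
          simp only [Set.indicator_of_mem hx, ψ₀, inner_smul_right, inner_self_eq_norm_sq_to_K]
          have : ‖h x‖ ^ Q = ‖h x‖ ^ (Q - 2) * ‖h x‖ ^ 2 := by
            rw [← Real.rpow_natCast, ← Real.rpow_add h0]; congr 1; norm_num
          rw [this]
          push_cast
          rfl
        · simp [Set.indicator_of_notMem hx]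
      simp_rw [e3]
      rw [integral_complex_ofReal, integral_indicator (hE k), ← ofReal_norm, Complex.norm_real,
        Real.norm_of_nonneg (integral_nonneg fun x => by positivity),
        ofReal_integral_eq_lintegral_ofReal]
      · refine lintegral_congr fun x => ?_
        rw [← ofReal_norm, ENNReal.ofReal_rpow_of_nonneg (norm_nonneg _) hpq.symm.nonneg]
      · refine ⟨(hm.norm.measurable.pow_const _).aestronglyMeasurable, ?_⟩
        rw [hasFiniteIntegral_iff_enorm]
        refine lt_of_eq_of_lt (lintegral_congr fun x => ?_) hIfin.lt_top
        rw [← ofReal_norm, Real.norm_of_nonneg (by positivity), ← ofReal_norm,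
          ENNReal.ofReal_rpow_of_nonneg (norm_nonneg _) hpq.symm.nonneg]
      · exact ae_of_all _ fun x => by positivity
    rw [e1, e2] at hH
    rcases eq_or_ne I 0 with h0 | h0
    · rw [h0]; exact zero_le
    -- The hypothesis now reads I ≤ M I^{1/P}. Truncation made I finite, so I^{1/P} can be
    -- cancelled.
    have h1 : I ^ (1 / Q) ≤ M := by
      have hsplit : I = I ^ (1 / Q) * I ^ (1 / P) := by
        rw [← ENNReal.rpow_add _ _ h0 hIfin, one_div, one_div, add_comm,
          hpq.inv_add_inv_eq_one, ENNReal.rpow_one]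
      have h2 : I ^ (1 / P) ≠ 0 := by simp [ENNReal.rpow_eq_zero_iff, h0, hIfin]
      have h3 : I ^ (1 / P) ≠ ⊤ := ENNReal.rpow_ne_top_of_nonneg (by positivity) hIfin
      exact (ENNReal.mul_le_mul_iff_left h2 h3).1 (hsplit.symm.trans_le hH)
    calc I = (I ^ (1 / Q)) ^ Q := by
          rw [← ENNReal.rpow_mul, one_div_mul_cancel hpq.symm.ne_zero, ENNReal.rpow_one]
      _ ≤ _ := ENNReal.rpow_le_rpow h1 hpq.symm.nonneg
  have hmono : Monotone E := by
    intro j k hjk x hx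
    have hjk' : (j : ℝ) ≤ k := by exact_mod_cast hjk
    exact ⟨(inv_anti₀ (by positivity) (by linarith)).trans hx.1, hx.2.trans (by linarith)⟩
  -- The sets `E k` increase to {h ≠ 0}, so monotone convergence removes the truncation.
  have hU : ∫⁻ x, ‖h x‖ₑ ^ Q ∂μ ≤ ∫⁻ x in ⋃ k, E k, ‖h x‖ₑ ^ Q ∂μ := by
    rw [← lintegral_indicator (MeasurableSet.iUnion hE)]
    refine lintegral_mono fun x => ?_
    by_cases hx : h x = 0
    · simp [hx, hpq.symm.pos]
    · have h0 : 0 < ‖h x‖ := norm_pos_iff.2 hx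
      obtain ⟨k, hk⟩ := exists_nat_ge (max ‖h x‖ ‖h x‖⁻¹)
      have : x ∈ ⋃ k, E k := Set.mem_iUnion.2 ⟨k, by
        refine inv_le_of_inv_le₀ h0 ?_
        linarith [(le_max_right ‖h x‖ ‖h x‖⁻¹).trans hk], by
        linarith [(le_max_left ‖h x‖ ‖h x‖⁻¹).trans hk]⟩
      rw [Set.indicator_of_mem this]
  rw [setLIntegral_iUnion_of_directed _ hmono.directed_le] at hU
  rw [eLpNorm_eq_lintegral_rpow_enorm_toReal hq0 hq]
  calc _ ≤ ((M : ℝ≥0∞) ^ Q) ^ (1 / Q) :=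
        ENNReal.rpow_le_rpow (hU.trans (iSup_le key)) (by have := hpq.symm.pos; positivity)
    _ = M := by rw [← ENNReal.rpow_mul, mul_one_div_cancel hpq.symm.ne_zero, ENNReal.rpow_one]

end Duality

/-! ### L^r norms of averages -/

section Averages

variable {α β F : Type*} [MeasurableSpace α] [MeasurableSpace β] {μ : Measure α} {ν : Measure β}
  [NormedAddCommGroup F] {r : ℝ≥0∞}

theorem eLpNorm_rpow_eq_lintegral (h1 : r ≠ 0) (hr : r ≠ ⊤) (f : α → F) :
    eLpNorm f r μ ^ r.toReal = ∫⁻ x, ‖f x‖ₑ ^ r.toReal ∂μ := by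
  rw [eLpNorm_eq_lintegral_rpow_enorm_toReal h1 hr, ← ENNReal.rpow_mul,
    one_div_mul_cancel (ENNReal.toReal_pos h1 hr).ne', ENNReal.rpow_one]

/-- Jensen's inequality for a function dominated by averages. -/
theorem eLpNorm_rpow_le_of_average [IsProbabilityMeasure ν] [SFinite μ] (h1 : 1 ≤ r) (hr : r ≠ ⊤)
    {Φ : α → F} {K : α → β → ℝ≥0∞} (hK : Measurable (Function.uncurry K))
    (h : ∀ᵐ x ∂μ, ‖Φ x‖ₑ ≤ ∫⁻ y, K x y ∂ν) :
    eLpNorm Φ r μ ^ r.toReal ≤ ∫⁻ y, ∫⁻ x, K x y ^ r.toReal ∂μ ∂ν := by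
  have h0 : r ≠ 0 := (zero_lt_one.trans_le h1).ne'
  rw [eLpNorm_rpow_eq_lintegral h0 hr, ← lintegral_lintegral_swap (hK.pow_const _).aemeasurable]
  refine lintegral_mono_ae ?_
  filter_upwards [h] with x hx
  have hKx : Measurable (K x) := hK.of_uncurry_left
  -- On a probability space the L¹ norm is at most the L^r norm.
  have := eLpNorm_le_eLpNorm_of_exponent_le h1 (μ := ν) (f := K x) hKx.aestronglyMeasurable
  rw [eLpNorm_one_eq_lintegral_enorm, eLpNorm_eq_lintegral_rpow_enorm_toReal h0 hr] at this
  simp only [enorm_eq_self] at this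
  calc _ ≤ ((∫⁻ y, K x y ^ r.toReal ∂ν) ^ (1 / r.toReal)) ^ r.toReal :=
        ENNReal.rpow_le_rpow (hx.trans this) ENNReal.toReal_nonneg
    _ = _ := by
        rw [← ENNReal.rpow_mul, one_div_mul_cancel (ENNReal.toReal_pos h0 hr).ne',
          ENNReal.rpow_one]

/-- A substitute for Minkowski's integral inequality. Mollifications, their errors and increments
along segments are all dominated by averages of functions with a common L^r bound. -/
theorem eLpNorm_le_of_average [IsProbabilityMeasure ν] [SFinite μ] (h1 : 1 ≤ r) (hr : r ≠ ⊤)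
    {Φ : α → F} {K : α → β → ℝ≥0∞} (hK : Measurable (Function.uncurry K))
    (h : ∀ᵐ x ∂μ, ‖Φ x‖ₑ ≤ ∫⁻ y, K x y ∂ν) {δ : ℝ≥0∞}
    (hδ : ∀ᵐ y ∂ν, eLpNorm (fun x => K x y) r μ ≤ δ) :
    eLpNorm Φ r μ ≤ δ := by
  have h0 : r ≠ 0 := (zero_lt_one.trans_le h1).ne'
  have hr0 := ENNReal.toReal_pos h0 hr
  rw [← ENNReal.rpow_le_rpow_iff hr0]
  refine (eLpNorm_rpow_le_of_average h1 hr hK h).trans ?_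
  calc _ ≤ ∫⁻ _, δ ^ r.toReal ∂ν := by
        refine lintegral_mono_ae ?_
        filter_upwards [hδ] with y hy
        rw [eLpNorm_eq_lintegral_rpow_enorm_toReal h0 hr] at hy
        have := ENNReal.rpow_le_rpow hy hr0.le
        rw [← ENNReal.rpow_mul, one_div_mul_cancel hr0.ne', ENNReal.rpow_one] at this
        simpa using this
    _ = _ := by simp

end Averages

/-! ### Translations in L^r -/

section Translates

variable {n : ℕ} {F : Type*} [NormedAddCommGroup F]

theorem eLpNorm_comp_sub_right {r : ℝ≥0∞} {f : EuclideanSpace ℝ (Fin n) → F}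
    (hf : AEStronglyMeasurable f volume) (t : EuclideanSpace ℝ (Fin n)) :
    eLpNorm (fun x => f (x - t)) r = eLpNorm f r volume :=
  eLpNorm_comp_measurePreserving hf (measurePreserving_sub_right volume t)

theorem eLpNorm_comp_add_right {r : ℝ≥0∞} {f : EuclideanSpace ℝ (Fin n) → F}
    (hf : AEStronglyMeasurable f volume) (t : EuclideanSpace ℝ (Fin n)) :
    eLpNorm (fun x => f (x + t)) r = eLpNorm f r volume :=
  eLpNorm_comp_measurePreserving hf (measurePreserving_add_right volume t)

/-- Translations are continuous in `L^r`. -/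
theorem tendsto_eLpNorm_translate {r : ℝ≥0∞} [Fact (1 ≤ r)] (hr : r ≠ ⊤)
    {f : EuclideanSpace ℝ (Fin n) → F} (hf : MemLp f r) :
    Tendsto (fun t => eLpNorm (fun x => f (x - t) - f x) r) (𝓝 0) (𝓝 0) := by
  have : Fact (r ≠ ⊤) := ⟨hr⟩
  -- `DomAddAct.mk s` acts by f ↦ f(s + ·), hence the sign of t.
  have hc : Continuous fun t : EuclideanSpace ℝ (Fin n) =>
      (DomAddAct.mk (-t) +ᵥ hf.toLp f : Lp F r volume) :=
    (DomAddAct.continuous_mk.comp continuous_neg).vadd continuous_const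
  have h2 := (hc.tendsto 0).sub_const (hf.toLp f)
  have h3 := h2.enorm
  simp only [neg_zero, DomAddAct.mk_zero, zero_vadd, sub_self, enorm_zero] at h3
  refine h3.congr fun t => ?_
  rw [Lp.enorm_def]
  refine eLpNorm_congr_ae ?_
  have h4 := DomAddAct.vadd_Lp_ae_eq (DomAddAct.mk (-t)) (hf.toLp f)
  have h5 := (measurePreserving_sub_right volume t).quasiMeasurePreserving.ae hf.coeFn_toLp
  filter_upwards [Lp.coeFn_sub (DomAddAct.mk (-t) +ᵥ hf.toLp f) (hf.toLp f), h4, hf.coeFn_toLp, h5]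
    with x e1 e2 e3 e4
  rw [e1, Pi.sub_apply, e2, e3, ← e4]
  simp [sub_eq_neg_add]

end Translates

/-! ### Mollification in L^r -/

section Mollification

variable {n : ℕ} {F : Type*} [NormedAddCommGroup F] [NormedSpace ℝ F]

/-- Convolution with a normalized bump function. -/
noncomputable def mollify (φ : ContDiffBump (0 : EuclideanSpace ℝ (Fin n)))
    (f : EuclideanSpace ℝ (Fin n) → F) :
    EuclideanSpace ℝ (Fin n) → F :=
  convolution (φ.normed volume) f (ContinuousLinearMap.lsmul ℝ ℝ) volume

/-- The probability measure whose density is a normalized bump function. -/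
noncomputable def bumpMeasure (φ : ContDiffBump (0 : EuclideanSpace ℝ (Fin n))) :
    Measure (EuclideanSpace ℝ (Fin n)) :=
  volume.withDensity fun t => ENNReal.ofReal (φ.normed volume t)

variable (φ : ContDiffBump (0 : EuclideanSpace ℝ (Fin n)))

theorem mollify_apply (f : EuclideanSpace ℝ (Fin n) → F) (x : EuclideanSpace ℝ (Fin n)) :
    mollify φ f x = ∫ t, φ.normed volume t • f (x - t) := rfl

theorem mollify_apply' (f : EuclideanSpace ℝ (Fin n) → F) (x : EuclideanSpace ℝ (Fin n)) :
    mollify φ f x = ∫ y, φ.normed volume (x - y) • f y := by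
  rw [mollify_apply, ← integral_sub_left_eq_self _ volume x]
  simp

theorem mollify_congr {f g : EuclideanSpace ℝ (Fin n) → F} (h : f =ᵐ[volume] g) :
    mollify φ f = mollify φ g :=
  convolution_congr _ ae_eq_rfl h

theorem measurable_ofReal_normed :
    Measurable fun t => ENNReal.ofReal (φ.normed volume t) :=
  φ.continuous_normed.measurable.ennreal_ofReal

theorem lintegral_normed : ∫⁻ t, ENNReal.ofReal (φ.normed volume t) = 1 := by
  rw [← ofReal_integral_eq_lintegral_ofReal φ.integrable_normed
    (ae_of_all _ φ.nonneg_normed), φ.integral_normed, ENNReal.ofReal_one]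

instance : IsProbabilityMeasure (bumpMeasure φ) :=
  ⟨by rw [bumpMeasure, withDensity_apply _ MeasurableSet.univ, Measure.restrict_univ,
    lintegral_normed]⟩

theorem bumpMeasure_ae : ∀ᵐ t ∂(bumpMeasure φ), ‖t‖ ≤ φ.rOut := by
  rw [bumpMeasure, ae_withDensity_iff (measurable_ofReal_normed φ)]
  refine ae_of_all _ fun t ht => ?_
  have h : t ∈ Function.support (φ.normed volume) := fun h0 => ht (by rw [h0, ENNReal.ofReal_zero])
  rw [φ.support_normed_eq, mem_ball_zero_iff] at h
  exact h.le

/-- The density is moved into the measure, so that a convolution becomes an average in the sense of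
`eLpNorm_le_of_average`. -/
theorem enorm_integral_normed_smul_le {f : EuclideanSpace ℝ (Fin n) → F}
    (hf : StronglyMeasurable f) :
    ‖∫ t, φ.normed volume t • f t‖ₑ ≤ ∫⁻ t, ‖f t‖ₑ ∂(bumpMeasure φ) := by
  refine (enorm_integral_le_lintegral_enorm _).trans_eq ?_
  rw [bumpMeasure, lintegral_withDensity_eq_lintegral_mul _ (measurable_ofReal_normed φ)
    hf.enorm]
  refine lintegral_congr fun t => ?_
  rw [enorm_smul, Real.enorm_of_nonneg (φ.nonneg_normed t)]
  rfl

/-- Mollification is a contraction on `L^r`. -/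
theorem eLpNorm_mollify_le {r : ℝ≥0∞} (h1 : 1 ≤ r) (hr : r ≠ ⊤)
    {f : EuclideanSpace ℝ (Fin n) → F} (hf : AEStronglyMeasurable f volume) :
    eLpNorm (mollify φ f) r ≤ eLpNorm f r volume := by
  wlog hm : StronglyMeasurable f generalizing f
  · rw [mollify_congr φ hf.ae_eq_mk, eLpNorm_congr_ae hf.ae_eq_mk]
    exact this hf.stronglyMeasurable_mk.aestronglyMeasurable hf.stronglyMeasurable_mk
  refine eLpNorm_le_of_average (ν := bumpMeasure φ) h1 hr (K := fun x t => ‖f (x - t)‖ₑ)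
    ?_ (ae_of_all _ fun x => ?_) (ae_of_all _ fun t => ?_)
  · exact (hm.comp_measurable measurable_sub).enorm
  · exact enorm_integral_normed_smul_le φ (hm.comp_measurable (measurable_const.sub measurable_id))
  · rw [eLpNorm_enorm, eLpNorm_comp_sub_right hf]

theorem integrable_normed_smul {f : EuclideanSpace ℝ (Fin n) → F} (hf : LocallyIntegrable f)
    (x : EuclideanSpace ℝ (Fin n)) :
    Integrable fun t => φ.normed volume t • f (x - t) := by
  have h := hf.integrable_smul_left_of_hasCompactSupport
    (g := fun y => φ.normed volume (x - y)) (φ.continuous_normed.comp (continuous_sub_left x))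
    (φ.hasCompactSupport_normed.comp_homeomorph (Homeomorph.subLeft x))
  simpa using h.comp_sub_left x

variable [CompleteSpace F]

theorem mollify_sub_self {f : EuclideanSpace ℝ (Fin n) → F} (hf : LocallyIntegrable f)
    (x : EuclideanSpace ℝ (Fin n)) :
    mollify φ f x - f x = ∫ t, φ.normed volume t • (f (x - t) - f x) := by
  simp_rw [smul_sub]
  rw [integral_sub (integrable_normed_smul φ hf x) (φ.integrable_normed.smul_const _),
    φ.integral_normed_smul]
  rfl

/-- As the bump has mass one, the error is the average of f(x - t) - f(x) over t in its support.
Only translations by at most `φ.rOut` matter. -/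
theorem eLpNorm_mollify_sub_le {r : ℝ≥0∞} (h1 : 1 ≤ r) (hr : r ≠ ⊤)
    {f : EuclideanSpace ℝ (Fin n) → F} (hf : LocallyIntegrable f) {δ : ℝ≥0∞}
    (hδ : ∀ t, ‖t‖ ≤ φ.rOut → eLpNorm (fun x => f (x - t) - f x) r ≤ δ) :
    eLpNorm (fun x => mollify φ f x - f x) r ≤ δ := by
  wlog hm : StronglyMeasurable f generalizing f
  · have hae := hf.aestronglyMeasurable.ae_eq_mk
    rw [mollify_congr φ hae, eLpNorm_congr_ae (g := fun x => mollify φ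
      (hf.aestronglyMeasurable.mk f) x - hf.aestronglyMeasurable.mk f x)]
    · refine this (hf.congr hae) (fun t ht => ?_) hf.aestronglyMeasurable.stronglyMeasurable_mk
      refine le_of_eq_of_le (eLpNorm_congr_ae ?_) (hδ t ht)
      filter_upwards [hae, (measurePreserving_sub_right volume t).quasiMeasurePreserving.ae hae]
        with x h2 h3
      rw [h2, h3]
    · filter_upwards [hae] with x hx using by rw [← hx]
  refine eLpNorm_le_of_average (ν := bumpMeasure φ) h1 hr (K := fun x t => ‖f (x - t) - f x‖ₑ)
    ?_ (ae_of_all _ fun x => ?_) ?_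
  · exact ((hm.comp_measurable measurable_sub).sub (hm.comp_measurable measurable_fst)).enorm
  · rw [mollify_sub_self φ hf]
    exact enorm_integral_normed_smul_le φ
      ((hm.comp_measurable (measurable_const.sub measurable_id)).sub stronglyMeasurable_const)
  · filter_upwards [bumpMeasure_ae φ] with t ht
    rw [eLpNorm_enorm]
    exact hδ t ht

end Mollification

/-! ### Approximation by shrinking mollifiers -/

section Sequence

variable {n : ℕ} {F : Type*} [NormedAddCommGroup F] [NormedSpace ℝ F] [CompleteSpace F]

/-- A sequence of bump functions shrinking to the origin. -/
noncomputable def shrinkingBump (n k : ℕ) : ContDiffBump (0 : EuclideanSpace ℝ (Fin n)) where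
  rIn := ((k : ℝ) + 1)⁻¹
  rOut := 2 * ((k : ℝ) + 1)⁻¹
  rIn_pos := by positivity
  rIn_lt_rOut := by
    have : 0 < ((k : ℝ) + 1)⁻¹ := by positivity
    linarith

theorem tendsto_shrinkingBump :
    Tendsto (fun k => (shrinkingBump n k).rOut) atTop (𝓝 0) := by
  have h : Tendsto (fun k : ℕ => 2 * ((k : ℝ) + 1)⁻¹) atTop (𝓝 (2 * 0)) := by
    refine Tendsto.const_mul _ ?_
    simpa using tendsto_one_div_add_atTop_nhds_zero_nat (𝕜 := ℝ)
  rwa [mul_zero] at h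

/-- The outer radius is always twice the inner one, so the bumps are comparable to normalized
indicators of balls and Lebesgue differentiation applies. -/
theorem ae_tendsto_mollify {f : EuclideanSpace ℝ (Fin n) → F} (hf : LocallyIntegrable f) :
    ∀ᵐ x, Tendsto (fun k => mollify (shrinkingBump n k) f x) atTop (𝓝 (f x)) :=
  ContDiffBump.ae_convolution_tendsto_right_of_locallyIntegrable (K := 2)
    tendsto_shrinkingBump (Eventually.of_forall fun _ => le_rfl) hf

theorem tendsto_eLpNorm_mollify_sub {r : ℝ≥0∞} [Fact (1 ≤ r)] (hr : r ≠ ⊤)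
    {f : EuclideanSpace ℝ (Fin n) → F} (hf : MemLp f r) :
    Tendsto (fun k => eLpNorm (fun x => mollify (shrinkingBump n k) f x - f x) r)
      atTop (𝓝 0) := by
  rw [ENNReal.tendsto_nhds_zero]
  intro ε hε
  have h := (ENNReal.tendsto_nhds_zero.1 (tendsto_eLpNorm_translate hr hf)) ε hε
  obtain ⟨δ, hδ, hb⟩ := Metric.eventually_nhds_iff.1 h
  filter_upwards [(tendsto_order.1 (tendsto_shrinkingBump (n := n))).2 δ hδ] with k hk
  refine eLpNorm_mollify_sub_le _ Fact.out hr (hf.locallyIntegrable Fact.out) fun t ht => ?_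
  exact hb (by rw [dist_zero_right]; exact ht.trans_lt hk)

end Sequence

/-! ### Weak gradients, moduli of continuity and Poincaré's inequality -/

section MollifiedGradient

variable {n : ℕ} (φ : ContDiffBump (0 : EuclideanSpace ℝ (Fin n)))
  {u : EuclideanSpace ℝ (Fin n) → ℂ} {g : EuclideanSpace ℝ (Fin n) → EuclideanSpace ℂ (Fin n)}

theorem contDiff_mollify {F : Type*} [NormedAddCommGroup F] [NormedSpace ℝ F]
    {f : EuclideanSpace ℝ (Fin n) → F} (hf : LocallyIntegrable f) :
    ContDiff ℝ ∞ (mollify φ f) :=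
  φ.hasCompactSupport_normed.contDiff_convolution_left _ φ.contDiff_normed hf

theorem mollify_coord (hg : LocallyIntegrable g) (x : EuclideanSpace ℝ (Fin n)) (i : Fin n) :
    mollify φ g x i = mollify φ (fun y => g y i) x :=
  ((EuclideanSpace.proj i : EuclideanSpace ℂ (Fin n) →L[ℂ] ℂ).restrictScalars ℝ).integral_comp_comm
    (integrable_normed_smul φ hg x) |>.symm

/-- The value at x + th is the pairing of u with the test function y ↦ φ(x - y) translated by th,
which `hasDerivAt_pairing` differentiates through the weak gradient. -/
theorem hasDerivAt_mollify (hu : LocallyIntegrable u) (hg : LocallyIntegrable g)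
    (hug : HasWeakGradient u g) (x h : EuclideanSpace ℝ (Fin n)) (t : ℝ) :
    HasDerivAt (fun t : ℝ => mollify φ u (x + t • h))
      (∑ i, (h i : ℂ) * mollify φ g (x + t • h) i) t := by
  let ψ : EuclideanSpace ℝ (Fin n) → ℂ := fun y => (φ.normed volume (x - y) : ℂ)
  have hψ : IsTestFun ψ := by
    refine ⟨Complex.ofRealCLM.contDiff.comp
      (φ.contDiff_normed.comp (contDiff_const.sub contDiff_id)), ?_⟩
    exact (φ.hasCompactSupport_normed.comp_homeomorph (Homeomorph.subLeft x)).comp_left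
      (g := ((↑) : ℝ → ℂ)) (by simp)
  have key := hasDerivAt_pairing hu hg hug hψ h t
  have e0 : ∀ (s : ℝ) (y : EuclideanSpace ℝ (Fin n)),
      x - (y - s • h) = x + s • h - y := fun s y => by abel
  have e1 : (fun t : ℝ => ∫ y, u y * ψ (y - t • h)) = fun t : ℝ => mollify φ u (x + t • h) := by
    funext s
    rw [mollify_apply']
    refine integral_congr_ae (ae_of_all _ fun y => ?_)
    simp only [ψ, e0, Complex.real_smul, mul_comm]
  have hi : ∀ i, Integrable fun y => (h i : ℂ) * (φ.normed volume (x + t • h - y) • g y i) := by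
    intro i
    refine Integrable.const_mul ?_ _
    have := (integrable_normed_smul φ (locallyIntegrable_coord hg i) (x + t • h)).comp_sub_left
      (x + t • h)
    simpa using this
  have e2 : (∫ y, (∑ i, (h i : ℂ) * g y i) * ψ (y - t • h)) =
      ∑ i, (h i : ℂ) * mollify φ g (x + t • h) i := by
    simp_rw [mollify_coord φ hg, mollify_apply', ← integral_const_mul]
    rw [← integral_finsetSum _ fun i _ => hi i]
    refine integral_congr_ae (ae_of_all _ fun y => ?_)
    simp only [ψ, e0, Complex.real_smul, Finset.sum_mul]
    exact Finset.sum_congr rfl fun i _ => by ring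
  rwa [e1, e2] at key

theorem fderiv_mollify (hu : LocallyIntegrable u) (hg : LocallyIntegrable g)
    (hug : HasWeakGradient u g) (x : EuclideanSpace ℝ (Fin n)) (i : Fin n) :
    fderiv ℝ (mollify φ u) x (EuclideanSpace.single i 1) = mollify φ g x i := by
  have h1 := hasDerivAt_mollify φ hu hg hug x (EuclideanSpace.single i 1) 0
  have hd : HasFDerivAt (mollify φ u) (fderiv ℝ (mollify φ u) x)
      (x + (0 : ℝ) • EuclideanSpace.single i 1) := by
    rw [zero_smul, add_zero]
    exact ((contDiff_mollify φ hu).differentiable (by simp) x).hasFDerivAt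
  have hline : HasDerivAt (fun t : ℝ => x + t • EuclideanSpace.single i (1 : ℝ))
      (EuclideanSpace.single i 1) 0 := by
    simpa using ((hasDerivAt_id (0 : ℝ)).smul_const (EuclideanSpace.single i (1 : ℝ))).const_add x
  have h2 := (hd.comp_hasDerivAt 0 hline).unique h1
  rw [h2, zero_smul, add_zero, Finset.sum_eq_single i]
  · simp
  · intro j _ hj
    simp [hj]
  · simp

/-- By the fundamental theorem of calculus the increment is the average over t ∈ (0, 1] of h · G(x +
th), where G is the mollified gradient. Each translate of G has L^r norm at most that of g. -/
theorem eLpNorm_mollify_translate_sub_le {r : ℝ≥0∞} (h1 : 1 ≤ r) (hr : r ≠ ⊤)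
    (hu : LocallyIntegrable u) (hg : LocallyIntegrable g) (hug : HasWeakGradient u g)
    (h : EuclideanSpace ℝ (Fin n)) :
    eLpNorm (fun x => mollify φ u (x + h) - mollify φ u x) r ≤ ‖h‖ₑ * eLpNorm g r := by
  have hG : Continuous (mollify φ g) := (contDiff_mollify φ hg).continuous
  have hcoord : ∀ i : Fin n, Continuous fun x => mollify φ g x i := fun i =>
    (EuclideanSpace.proj i : EuclideanSpace ℂ (Fin n) →L[ℂ] ℂ).continuous.comp hG
  have hprob : IsProbabilityMeasure (volume.restrict (Set.Ioc (0 : ℝ) 1)) := ⟨by simp⟩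
  refine eLpNorm_le_of_average (ν := volume.restrict (Set.Ioc (0 : ℝ) 1)) h1 hr
    (K := fun x t => ‖‖h‖ • mollify φ g (x + t • h)‖ₑ) ?_ (ae_of_all _ fun x => ?_)
    (ae_of_all _ fun t => ?_)
  · have hc : Continuous fun z : EuclideanSpace ℝ (Fin n) × ℝ =>
        ‖h‖ • mollify φ g (z.1 + z.2 • h) := by
      have hz : Continuous fun z : EuclideanSpace ℝ (Fin n) × ℝ => z.1 + z.2 • h := by fun_prop
      exact (hG.comp hz).const_smul ‖h‖
    exact hc.enorm.measurable
  · have hi := intervalIntegral.integral_eq_sub_of_hasDerivAt (a := 0) (b := 1)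
      (fun t _ => hasDerivAt_mollify φ hu hg hug x h t) (by
        refine Continuous.intervalIntegrable (continuous_finsetSum _ fun i _ => ?_) _ _
        exact continuous_const.mul ((hcoord i).comp (by fun_prop)))
    simp only [one_smul, zero_smul, add_zero] at hi
    rw [← hi, intervalIntegral.integral_of_le zero_le_one]
    refine (enorm_integral_le_lintegral_enorm _).trans (lintegral_mono fun t => ?_)
    refine enorm_le_iff_norm_le.2 ((norm_dot_le h _).trans_eq ?_)
    rw [norm_smul, norm_norm]
  · rw [eLpNorm_enorm]
    refine (eLpNorm_const_smul_le (c := ‖h‖) (f := fun x => mollify φ g (x + t • h))).trans ?_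
    rw [enorm_norm, eLpNorm_comp_add_right hG.aestronglyMeasurable]
    gcongr
    exact eLpNorm_mollify_le φ h1 hr hg.aestronglyMeasurable

/-- The `L^r` modulus of continuity of a function with weak gradient in `L^r`. -/
theorem eLpNorm_translate_sub_le_of_weakGradient {r : ℝ≥0∞} (h1 : 1 ≤ r) (hr : r ≠ ⊤)
    (hu : LocallyIntegrable u) (hg : LocallyIntegrable g) (hug : HasWeakGradient u g)
    (h : EuclideanSpace ℝ (Fin n)) :
    eLpNorm (fun x => u (x + h) - u x) r ≤ ‖h‖ₑ * eLpNorm g r := by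
  have hae := ae_tendsto_mollify hu
  -- Fatou's lemma along a.e. convergent mollifications; u itself need not be in L^r.
  refine (Lp.eLpNorm_lim_le_liminf_eLpNorm (f := fun k x =>
    mollify (shrinkingBump n k) u (x + h) - mollify (shrinkingBump n k) u x) (fun k => ?_) _ ?_).trans
    ((liminf_le_liminf (Eventually.of_forall fun k =>
      eLpNorm_mollify_translate_sub_le (shrinkingBump n k) h1 hr hu hg hug h)).trans_eq ?_)
  · have hc := (contDiff_mollify (shrinkingBump n k) hu).continuous
    exact ((hc.comp (by fun_prop)).sub hc).aestronglyMeasurable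
  · filter_upwards [hae, (measurePreserving_add_right volume h).quasiMeasurePreserving.ae hae]
      with x e1 e2 using e2.sub e1
  · simp

/-- The mean of a function over the ball of radius `R` around the origin. -/
noncomputable def ballMean (u : EuclideanSpace ℝ (Fin n) → ℂ) (R : ℝ) : ℂ :=
  ⨍ y in Metric.closedBall 0 R, u y

/-- A Poincaré inequality on balls, with the gradient on the whole space. -/
theorem eLpNorm_sub_ballMean_le {r : ℝ≥0∞} (h1 : 1 ≤ r) (hr : r ≠ ⊤)
    (hu : LocallyIntegrable u) (hg : LocallyIntegrable g) (hug : HasWeakGradient u g)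
    {R : ℝ} (hR : 0 < R) :
    eLpNorm (fun x => u x - ballMean u R) r (volume.restrict (Metric.closedBall 0 R)) ≤
      ENNReal.ofReal (2 ^ (n + 1) * R) * eLpNorm g r := by
  wlog hm : Measurable u generalizing u
  · obtain ⟨v, hv, huv⟩ := hu.aestronglyMeasurable
    have e : ballMean u R = ballMean v R :=
      average_congr (ae_restrict_of_ae huv)
    rw [e, eLpNorm_congr_ae (g := fun x => v x - ballMean v R)]
    · exact this (hu.congr huv) (hug.congr huv ae_eq_rfl) hv.measurable
    · filter_upwards [ae_restrict_of_ae huv] with x hx using by rw [hx]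
  have h0 : r ≠ 0 := (zero_lt_one.trans_le h1).ne'
  have hr0 := ENNReal.toReal_pos h0 hr
  set B : Set (EuclideanSpace ℝ (Fin n)) := Metric.closedBall 0 R with hB
  set B2 : Set (EuclideanSpace ℝ (Fin n)) := Metric.closedBall 0 (2 * R) with hB2
  have hBm : MeasurableSet B := Metric.isClosed_closedBall.measurableSet
  have hB0 : volume B ≠ 0 := (Metric.measure_closedBall_pos volume 0 hR).ne'
  have hBt : volume B ≠ ⊤ := measure_closedBall_lt_top.ne
  set ν := (volume B)⁻¹ • volume.restrict B with hν
  have hprob : IsProbabilityMeasure ν := ⟨by simp [hν, ENNReal.inv_mul_cancel hB0 hBt]⟩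
  have hav : ballMean u R = ∫ y, u y ∂ν := by
    rw [ballMean, average_eq', Measure.restrict_apply_univ]
  have hint : Integrable u ν :=
    ((locallyIntegrable_iff.1 hu) _ (isCompact_closedBall 0 R)).smul_measure
      (ENNReal.inv_ne_top.2 hB0)
  rw [← ENNReal.rpow_le_rpow_iff hr0]
  refine (eLpNorm_rpow_le_of_average (ν := ν) h1 hr (K := fun x y => ‖u x - u y‖ₑ)
    (by unfold Function.uncurry; fun_prop) (ae_of_all _ fun x => ?_)).trans ?_
  · have : u x - ballMean u R = ∫ y, (u x - u y) ∂ν := by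
      rw [integral_sub (integrable_const _) hint, hav]; simp
    rw [this]
    exact enorm_integral_le_lintegral_enorm _
  calc ∫⁻ y, (∫⁻ x in B, ‖u x - u y‖ₑ ^ r.toReal) ∂ν
      = (volume B)⁻¹ * ∫⁻ y in B, ∫⁻ x in B, ‖u x - u y‖ₑ ^ r.toReal := by
        rw [hν, lintegral_smul_measure, smul_eq_mul]
    -- Substitute x = y + h: if x and y lie in B, then h lies in the doubled ball. Letting y range
    -- over the whole space makes the modulus of continuity applicable for each fixed h.
    _ ≤ (volume B)⁻¹ * ∫⁻ y, ∫⁻ h in B2, ‖u (y + h) - u y‖ₑ ^ r.toReal := by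
        refine mul_le_mul' le_rfl ?_
        refine (setLIntegral_mono' hBm (fun y hy => ?_)).trans (setLIntegral_le_lintegral B _)
        rw [← lintegral_indicator hBm, ← lintegral_indicator Metric.isClosed_closedBall.measurableSet,
          ← lintegral_add_left_eq_self _ y]
        refine lintegral_mono fun h => ?_
        by_cases hyh : y + h ∈ B
        · have : h ∈ B2 := by
            rw [hB, mem_closedBall_zero_iff] at hyh hy
            rw [hB2, mem_closedBall_zero_iff]
            calc ‖h‖ = ‖(y + h) - y‖ := by simp
              _ ≤ _ := (norm_sub_le _ _).trans (by linarith)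
          rw [Set.indicator_of_mem hyh, Set.indicator_of_mem this]
        · rw [Set.indicator_of_notMem hyh]; exact zero_le
    _ = (volume B)⁻¹ * ∫⁻ h in B2, ∫⁻ y, ‖u (y + h) - u y‖ₑ ^ r.toReal := by
        rw [lintegral_lintegral_swap]
        unfold Function.uncurry
        fun_prop
    _ ≤ (volume B)⁻¹ * ∫⁻ h in B2, (ENNReal.ofReal (2 * R) * eLpNorm g r) ^ r.toReal := by
        refine mul_le_mul' le_rfl ?_
        refine setLIntegral_mono' Metric.isClosed_closedBall.measurableSet fun h hh => ?_
        rw [← eLpNorm_rpow_eq_lintegral h0 hr]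
        refine ENNReal.rpow_le_rpow ((eLpNorm_translate_sub_le_of_weakGradient h1 hr hu hg hug h).trans
          ?_) hr0.le
        gcongr
        rw [← ofReal_norm]
        exact ENNReal.ofReal_le_ofReal (mem_closedBall_zero_iff.1 hh)
    _ = ENNReal.ofReal (2 ^ n) * (ENNReal.ofReal (2 * R) * eLpNorm g r) ^ r.toReal := by
        have : volume B2 = ENNReal.ofReal (2 ^ n) * volume B := by
          rw [hB2, Measure.addHaar_closedBall_mul _ _ zero_le_two hR.le,
            finrank_euclideanSpace_fin]
        rw [setLIntegral_const, this, mul_comm, mul_assoc, mul_assoc,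
          ENNReal.mul_inv_cancel hB0 hBt, mul_one, mul_comm]
    -- The volume ratio 2^n is at least 1, so it is at most its r-th power. The resulting constant
    -- 2^n · 2R does not depend on r.
    _ ≤ (ENNReal.ofReal (2 ^ n)) ^ r.toReal *
          (ENNReal.ofReal (2 * R) * eLpNorm g r) ^ r.toReal := by
        gcongr
        refine ENNReal.le_rpow_self_of_one_le ?_ ?_
        · rw [ENNReal.one_le_ofReal]; exact one_le_pow₀ one_le_two
        · rw [← ENNReal.toReal_one]; exact ENNReal.toReal_mono hr h1
    _ = _ := by
        rw [← ENNReal.mul_rpow_of_nonneg _ _ hr0.le, ← mul_assoc,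
          ← ENNReal.ofReal_mul (by positivity)]
        ring_nf

end MollifiedGradient

/-! ### Calculus of classical gradients -/

section ClassicalGradient

variable {n : ℕ}

/-- The vector of partial derivatives. -/
noncomputable def classicalGrad (φ : EuclideanSpace ℝ (Fin n) → ℂ) (x : EuclideanSpace ℝ (Fin n)) :
    EuclideanSpace ℂ (Fin n) :=
  WithLp.toLp 2 fun i => fderiv ℝ φ x (EuclideanSpace.single i 1)

theorem continuous_classicalGrad {φ : EuclideanSpace ℝ (Fin n) → ℂ} (hφ : ContDiff ℝ ∞ φ) :
    Continuous (classicalGrad φ) := by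
  refine (PiLp.continuous_toLp 2 _).comp (continuous_pi fun i => ?_)
  exact (hφ.continuous_fderiv (by simp)).clm_apply continuous_const

theorem norm_classicalGrad_le (φ : EuclideanSpace ℝ (Fin n) → ℂ) (x : EuclideanSpace ℝ (Fin n)) :
    ‖classicalGrad φ x‖ ≤ Real.sqrt n * ‖fderiv ℝ φ x‖ := by
  rw [EuclideanSpace.norm_eq]
  refine Real.sqrt_le_iff.2 ⟨by positivity, ?_⟩
  rw [mul_pow, Real.sq_sqrt (Nat.cast_nonneg n)]
  calc ∑ i, ‖(classicalGrad φ x) i‖ ^ 2 ≤ ∑ _i : Fin n, ‖fderiv ℝ φ x‖ ^ 2 := by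
        refine Finset.sum_le_sum fun i _ => ?_
        gcongr
        simpa [classicalGrad] using (fderiv ℝ φ x).le_opNorm (EuclideanSpace.single i 1)
    _ = _ := by simp

/-- Integration by parts. There are no boundary terms because the test function has compact support;
v itself may grow. -/
theorem hasWeakGradient_of_smooth {v : EuclideanSpace ℝ (Fin n) → ℂ} (hv : ContDiff ℝ ∞ v) :
    HasWeakGradient v (classicalGrad v) := by
  intro ψ hψ i
  have hc : Continuous fun x => fderiv ℝ v x (EuclideanSpace.single i 1) :=
    (hv.continuous_fderiv (by simp)).clm_apply continuous_const
  refine integral_mul_fderiv_eq_neg_fderiv_mul_of_integrable (𝕜 := ℂ)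
    (v := EuclideanSpace.single i 1) ?_ ?_ ?_
    (fun x _ => hv.differentiable (by simp) x)
    (fun x _ => hψ.smooth.differentiable (by simp) x)
  · exact integrable_mul_test hc.locallyIntegrable hψ.continuous hψ.compact
  · exact integrable_mul_test hv.continuous.locallyIntegrable (hψ.continuous_partial _)
      (hψ.compact_partial _)
  · exact integrable_mul_test hv.continuous.locallyIntegrable hψ.continuous hψ.compact

theorem IsTestFun.memLp_classicalGrad {φ : EuclideanSpace ℝ (Fin n) → ℂ} (hφ : IsTestFun φ)
    (r : ℝ≥0∞) : MemLp (classicalGrad φ) r volume := by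
  refine MemLp.of_eval_piLp fun i => ?_
  exact (hφ.continuous_partial (EuclideanSpace.single i 1)).memLp_of_hasCompactSupport
    (hφ.compact_partial _)

theorem classicalGrad_mul {a b : EuclideanSpace ℝ (Fin n) → ℂ} {x : EuclideanSpace ℝ (Fin n)}
    (ha : DifferentiableAt ℝ a x) (hb : DifferentiableAt ℝ b x) :
    classicalGrad (fun y => a y * b y) x = a x • classicalGrad b x + b x • classicalGrad a x := by
  ext i
  simp [classicalGrad, fderiv_fun_mul ha hb]

theorem classicalGrad_sub_const (a : EuclideanSpace ℝ (Fin n) → ℂ) (c : ℂ) :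
    classicalGrad (fun y => a y - c) = classicalGrad a := by
  funext x
  ext i
  simp [classicalGrad, fderiv_sub_const c]

theorem classicalGrad_const_mul_sum {ι : Type*} (s : Finset ι) (c : ℂ)
    {a : ι → EuclideanSpace ℝ (Fin n) → ℂ} {x : EuclideanSpace ℝ (Fin n)}
    (ha : ∀ k ∈ s, DifferentiableAt ℝ (a k) x) :
    classicalGrad (fun y => c * ∑ k ∈ s, a k y) x = c • ∑ k ∈ s, classicalGrad (a k) x := by
  ext i
  have hs : DifferentiableAt ℝ (fun y => ∑ k ∈ s, a k y) x := DifferentiableAt.fun_sum ha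
  change fderiv ℝ (fun y => c * ∑ k ∈ s, a k y) x (EuclideanSpace.single i 1) = _
  rw [fderiv_const_mul hs, fderiv_fun_sum ha]
  simp [classicalGrad]

theorem classicalGrad_mollify (φ : ContDiffBump (0 : EuclideanSpace ℝ (Fin n)))
    {u : EuclideanSpace ℝ (Fin n) → ℂ} {g : EuclideanSpace ℝ (Fin n) → EuclideanSpace ℂ (Fin n)}
    (hu : LocallyIntegrable u) (hg : LocallyIntegrable g) (hug : HasWeakGradient u g) :
    classicalGrad (mollify φ u) = mollify φ g := by
  funext x
  ext i
  exact fderiv_mollify φ hu hg hug x i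

end ClassicalGradient

/-! ### Cutoff functions at geometric scales and their means -/

section Cutoff

variable {n : ℕ}

/-- A smooth function that is `1` on the unit ball and `0` outside the ball of radius `2`. -/
noncomputable def unitCutoff (n : ℕ) : ContDiffBump (0 : EuclideanSpace ℝ (Fin n)) where
  rIn := 1
  rOut := 2
  rIn_pos := one_pos
  rIn_lt_rOut := one_lt_two

/-- A smooth cutoff function adapted to the ball of radius `4 ^ k`. -/
noncomputable def cutoff (k : ℕ) (x : EuclideanSpace ℝ (Fin n)) : ℂ :=
  (unitCutoff n (((4 : ℝ) ^ k)⁻¹ • x) : ℂ)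

theorem isTestFun_cutoff (k : ℕ) : IsTestFun (cutoff (n := n) k) := by
  refine ⟨Complex.ofRealCLM.contDiff.comp
    ((unitCutoff n).contDiff.comp (contDiff_const_smul _)), ?_⟩
  have h : HasCompactSupport fun x => unitCutoff n (((4 : ℝ) ^ k)⁻¹ • x) :=
    (unitCutoff n).hasCompactSupport.comp_homeomorph
      (Homeomorph.smulOfNeZero (((4 : ℝ) ^ k)⁻¹) (by positivity))
  exact h.comp_left (g := ((↑) : ℝ → ℂ)) (by simp)

theorem norm_inv_smul_le_iff (k : ℕ) (x : EuclideanSpace ℝ (Fin n)) (R : ℝ) :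
    ‖((4 : ℝ) ^ k)⁻¹ • x‖ ≤ R ↔ ‖x‖ ≤ R * 4 ^ k := by
  rw [norm_smul, Real.norm_of_nonneg (by positivity), inv_mul_le_iff₀ (by positivity), mul_comm]

theorem cutoff_eq_one {k : ℕ} {x : EuclideanSpace ℝ (Fin n)} (hx : ‖x‖ ≤ 4 ^ k) :
    cutoff k x = 1 := by
  rw [cutoff, (unitCutoff n).one_of_mem_closedBall, Complex.ofReal_one]
  rw [mem_closedBall_zero_iff, norm_inv_smul_le_iff]
  simpa [unitCutoff] using hx

theorem norm_one_sub_cutoff_le (k : ℕ) (x : EuclideanSpace ℝ (Fin n)) : ‖cutoff k x - 1‖ ≤ 1 := by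
  rw [cutoff, ← Complex.ofReal_one, ← Complex.ofReal_sub, Complex.norm_real, Real.norm_eq_abs,
    abs_le]
  have h1 := (unitCutoff n).nonneg (x := ((4 : ℝ) ^ k)⁻¹ • x)
  have h2 := (unitCutoff n).le_one (x := ((4 : ℝ) ^ k)⁻¹ • x)
  constructor <;> linarith

/-- All cutoffs are dilates of one function. The decay 4^{-k} will cancel the growth 4^k of the
Poincaré constant on the ball of radius 2 · 4^k. -/
theorem exists_norm_grad_cutoff_le (n : ℕ) : ∃ M : ℝ, 0 ≤ M ∧
    ∀ (k : ℕ) (x : EuclideanSpace ℝ (Fin n)), ‖classicalGrad (cutoff k) x‖ ≤ M * (4 ^ k)⁻¹ := by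
  have h0 := isTestFun_cutoff (n := n) 0
  obtain ⟨M, hM⟩ := (h0.compact.fderiv (𝕜 := ℝ)).exists_bound_of_continuous
    (h0.smooth.continuous_fderiv (by simp))
  have hM0 : 0 ≤ M := (norm_nonneg _).trans (hM 0)
  refine ⟨Real.sqrt n * M, by positivity, fun k x => (norm_classicalGrad_le _ x).trans ?_⟩
  have e : cutoff (n := n) k = fun x => cutoff 0 (((4 : ℝ) ^ k)⁻¹ • x) := by
    funext y; simp [cutoff]
  rw [e, fderiv_comp_smul, norm_smul, Real.norm_of_nonneg (by positivity), mul_assoc]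
  have := hM (((4 : ℝ) ^ k)⁻¹ • x)
  rw [mul_comm ((4 ^ k : ℝ)⁻¹)]
  gcongr

theorem grad_cutoff_ne_zero {k : ℕ} {x : EuclideanSpace ℝ (Fin n)}
    (h : classicalGrad (cutoff k) x ≠ 0) : 4 ^ k ≤ ‖x‖ ∧ ‖x‖ ≤ 2 * 4 ^ k := by
  constructor
  · by_contra! hx
    refine h ?_
    have hev : cutoff (n := n) k =ᶠ[𝓝 x] fun _ => 1 := by
      filter_upwards [continuous_norm.continuousAt.eventually_lt_const hx] with y hy
      exact cutoff_eq_one hy.le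
    ext i
    simp [classicalGrad, hev.fderiv_eq]
  · by_contra! hx
    refine h ?_
    have hev : cutoff (n := n) k =ᶠ[𝓝 x] fun _ => 0 := by
      filter_upwards [continuous_norm.continuousAt.eventually_const_lt hx] with y hy
      rw [cutoff, (unitCutoff n).zero_of_le_dist, Complex.ofReal_zero]
      rw [dist_zero_right]
      by_contra! hc
      have := (norm_inv_smul_le_iff k y 2).1 hc.le
      linarith
    ext i
    simp [classicalGrad, hev.fderiv_eq]

/-- The gradient lives on the annulus 4^k ≤ |x| ≤ 2 · 4^k. Consecutive scales have ratio 4, which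
exceeds the ratio 2 of the radii, so the annuli are disjoint. -/
theorem grad_cutoff_disjoint (x : EuclideanSpace ℝ (Fin n)) {j k : ℕ} (hjk : j ≠ k) :
    classicalGrad (cutoff j) x = 0 ∨ classicalGrad (cutoff k) x = 0 := by
  wlog h : j < k generalizing j k
  · exact (this hjk.symm (lt_of_le_of_ne (not_lt.1 h) hjk.symm)).symm
  by_contra! hc
  have h1 := (grad_cutoff_ne_zero hc.1).2
  have h2 := (grad_cutoff_ne_zero hc.2).1
  have h3 : (4 : ℝ) ^ (j + 1) ≤ 4 ^ k := pow_le_pow_right₀ (by norm_num) h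
  rw [pow_succ] at h3
  have : (0 : ℝ) < 4 ^ j := by positivity
  linarith

/-- Averages of cutoff functions. -/
noncomputable def meanCutoff (N : ℕ) (x : EuclideanSpace ℝ (Fin n)) : ℂ :=
  (N : ℂ)⁻¹ * ∑ k ∈ Finset.range N, cutoff (N + k) x

theorem continuous_meanCutoff (N : ℕ) : Continuous (meanCutoff (n := n) N) :=
  continuous_const.mul (continuous_finsetSum _ fun _ _ => (isTestFun_cutoff _).continuous)

theorem meanCutoff_sub_one {N : ℕ} (hN : N ≠ 0) (x : EuclideanSpace ℝ (Fin n)) :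
    meanCutoff N x - 1 = (N : ℂ)⁻¹ * ∑ k ∈ Finset.range N, (cutoff (N + k) x - 1) := by
  have : (N : ℂ) ≠ 0 := by exact_mod_cast hN
  simp [meanCutoff, Finset.sum_sub_distrib, mul_sub, this]

theorem norm_meanCutoff_sub_one_le (N : ℕ) (x : EuclideanSpace ℝ (Fin n)) :
    ‖meanCutoff N x - 1‖ ≤ 1 := by
  rcases eq_or_ne N 0 with rfl | hN
  · simp [meanCutoff]
  rw [meanCutoff_sub_one hN, norm_mul, norm_inv, Complex.norm_natCast, inv_mul_le_iff₀ (by positivity)]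
  refine (norm_sum_le _ _).trans ((Finset.sum_le_card_nsmul _ _ 1
    fun k _ => norm_one_sub_cutoff_le _ x).trans ?_)
  simp

/-- The scales in the mean start at N, not at 0, so that the whole mean, and not just most of it,
equals 1 on a ball that exhausts the space. -/
theorem meanCutoff_eq_one {N : ℕ} (hN : N ≠ 0) {x : EuclideanSpace ℝ (Fin n)}
    (hx : ‖x‖ ≤ 4 ^ N) : meanCutoff N x = 1 := by
  rw [← sub_eq_zero, meanCutoff_sub_one hN, Finset.sum_eq_zero, mul_zero]
  intro k _
  rw [cutoff_eq_one, sub_self]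
  exact hx.trans (pow_le_pow_right₀ (by norm_num) (Nat.le_add_right _ _))

/-- Dominated convergence: the integrand is bounded by |f|^r and at each point it is eventually
zero. -/
theorem tendsto_eLpNorm_meanCutoff_smul_sub {F : Type*} [NormedAddCommGroup F] [NormedSpace ℂ F]
    {r : ℝ≥0∞} (h0 : r ≠ 0) (hr : r ≠ ⊤) {f : EuclideanSpace ℝ (Fin n) → F} (hf : MemLp f r) :
    Tendsto (fun N => eLpNorm (fun x => (meanCutoff N x - 1) • f x) r) atTop (𝓝 0) := by
  have hr0 := ENNReal.toReal_pos h0 hr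
  have hm : ∀ N, AEStronglyMeasurable (fun x => (meanCutoff N x - 1) • f x) volume := fun N =>
    ((continuous_meanCutoff N).sub continuous_const).aestronglyMeasurable.smul hf.1
  have key : Tendsto (fun N => ∫⁻ x, ‖(meanCutoff N x - 1) • f x‖ₑ ^ r.toReal) atTop
      (𝓝 (∫⁻ _ : EuclideanSpace ℝ (Fin n), 0)) := by
    refine tendsto_lintegral_of_dominated_convergence' (fun x => ‖f x‖ₑ ^ r.toReal)
      (fun N => (hm N).enorm.pow_const _) (fun N => ae_of_all _ fun x => ?_) ?_
      (ae_of_all _ fun x => ?_)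
    · refine ENNReal.rpow_le_rpow (enorm_le_iff_norm_le.2 ?_) hr0.le
      rw [norm_smul]
      exact mul_le_of_le_one_left (norm_nonneg _) (norm_meanCutoff_sub_one_le N x)
    · exact ((eLpNorm_lt_top_iff_lintegral_rpow_enorm_lt_top h0 hr).1 hf.2).ne
    · refine tendsto_const_nhds.congr' ?_
      obtain ⟨m, hm⟩ := pow_unbounded_of_one_lt ‖x‖ (by norm_num : (1 : ℝ) < 4)
      filter_upwards [eventually_ge_atTop m, eventually_ge_atTop 1] with N hN hN1
      rw [meanCutoff_eq_one (by omega)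
        (hm.le.trans (pow_le_pow_right₀ (by norm_num) hN)), sub_self, zero_smul, enorm_zero,
        ENNReal.zero_rpow_of_pos hr0]
  simp only [eLpNorm_eq_lintegral_rpow_enorm_toReal h0 hr]
  have h2 := ((ENNReal.continuous_rpow_const (y := 1 / r.toReal)).tendsto _).comp key
  rw [lintegral_zero, ENNReal.zero_rpow_of_pos (by positivity)] at h2
  exact h2

/-- Averages of a bounded sequence of functions in `L^r`, `r > 1`, with disjoint supports tend
to zero. -/
theorem tendsto_eLpNorm_mean_of_disjoint {α F : Type*} [MeasurableSpace α] {μ : Measure α}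
    [NormedAddCommGroup F] [NormedSpace ℂ F] {r : ℝ≥0∞} (h1 : 1 < r) (hr : r ≠ ⊤)
    {w : ℕ → α → F} (hm : ∀ k, AEStronglyMeasurable (w k) μ)
    (hd : ∀ x j k, j ≠ k → w j x = 0 ∨ w k x = 0) {M : ℝ≥0∞} (hM : M ≠ ⊤)
    (hw : ∀ k, eLpNorm (w k) r μ ≤ M) :
    Tendsto (fun N : ℕ => eLpNorm (fun x => (N : ℂ)⁻¹ • ∑ k ∈ Finset.range N, w (N + k) x) r μ)
      atTop (𝓝 0) := by
  have h0 : r ≠ 0 := (zero_lt_one.trans h1).ne'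
  have hr0 := ENNReal.toReal_pos h0 hr
  have hr1 : 1 < r.toReal := by
    rw [← ENNReal.toReal_one]; exact ENNReal.toReal_strict_mono hr h1
  -- At each point at most one summand is nonzero, so the r-th power passes through the sum.
  -- Integration then yields the factor N^{1/r} instead of N.
  have hpt : ∀ (N : ℕ) x, ‖∑ k ∈ Finset.range N, w (N + k) x‖ₑ ^ r.toReal ≤
      ∑ k ∈ Finset.range N, ‖w (N + k) x‖ₑ ^ r.toReal := by
    intro N x
    by_cases h : ∀ k ∈ Finset.range N, w (N + k) x = 0
    · rw [Finset.sum_eq_zero h, enorm_zero, ENNReal.zero_rpow_of_pos hr0]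
      exact zero_le
    · push Not at h
      obtain ⟨k, hk, hne⟩ := h
      rw [Finset.sum_eq_single_of_mem k hk fun j _ hj =>
        (hd x (N + j) (N + k) (by omega)).resolve_right hne]
      exact Finset.single_le_sum (f := fun k => ‖w (N + k) x‖ₑ ^ r.toReal)
        (fun _ _ => zero_le) hk
  have hbd : ∀ N : ℕ, eLpNorm (fun x => ∑ k ∈ Finset.range N, w (N + k) x) r μ ≤
      (N : ℝ≥0∞) ^ (1 / r.toReal) * M := by
    intro N
    rw [← ENNReal.rpow_le_rpow_iff hr0, eLpNorm_rpow_eq_lintegral h0 hr,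
      ENNReal.mul_rpow_of_nonneg _ _ hr0.le, ← ENNReal.rpow_mul, one_div_mul_cancel hr0.ne',
      ENNReal.rpow_one]
    refine (lintegral_mono (hpt N)).trans ?_
    rw [lintegral_finsetSum' _ fun k _ => (hm _).enorm.pow_const _]
    refine (Finset.sum_le_card_nsmul _ _ (M ^ r.toReal) fun k _ => ?_).trans ?_
    · rw [← eLpNorm_rpow_eq_lintegral h0 hr]
      exact ENNReal.rpow_le_rpow (hw _) hr0.le
    · simp
  -- The prefactor 1/N against N^{1/r} leaves N^{-(1 - 1/r)}; this is where r > 1 is needed.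
  have hlim : Tendsto (fun N : ℕ => (N : ℝ≥0∞) ^ (-(1 - 1 / r.toReal)) * M) atTop (𝓝 0) := by
    have e : 0 < 1 - 1 / r.toReal := by
      rw [sub_pos, div_lt_one hr0]; exact hr1
    have h2 := ENNReal.Tendsto.mul_const (b := M)
      (tendsto_inv_iff.2
        ((ENNReal.tendsto_rpow_at_top e).comp ENNReal.tendsto_nat_nhds_top)) (Or.inr hM)
    simp only [ENNReal.rpow_neg]
    simpa using h2
  refine tendsto_of_tendsto_of_tendsto_of_le_of_le' tendsto_const_nhds hlim
    (Eventually.of_forall fun _ => zero_le) ?_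
  filter_upwards [eventually_ge_atTop 1] with N hN
  refine (eLpNorm_const_smul_le (c := (N : ℂ)⁻¹)
    (f := fun x => ∑ k ∈ Finset.range N, w (N + k) x)).trans ?_
  have hN0 : (N : ℝ≥0∞) ≠ 0 := by simpa using (by omega : N ≠ 0)
  have e1 : ‖(N : ℂ)⁻¹‖ₑ = (N : ℝ≥0∞) ^ (-1 : ℝ) := by
    rw [enorm_inv (by simpa using (by omega : N ≠ 0)), ENNReal.rpow_neg_one, ← ofReal_norm]
    simp
  rw [e1]
  calc _ ≤ (N : ℝ≥0∞) ^ (-1 : ℝ) * ((N : ℝ≥0∞) ^ (1 / r.toReal) * M) :=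
        mul_le_mul' le_rfl (hbd N)
    _ = _ := by
        rw [← mul_assoc, ← ENNReal.rpow_add _ _ hN0 (ENNReal.natCast_ne_top N)]
        congr 2; ring

end Cutoff

/-! ### Simultaneous density of test functions -/

section Density

variable {n : ℕ}

/-- Averages of truncations of `v`, where a constant is subtracted before each truncation. -/
noncomputable def truncation (v : EuclideanSpace ℝ (Fin n) → ℂ) (c : ℕ → ℂ) (N : ℕ)
    (x : EuclideanSpace ℝ (Fin n)) : ℂ :=
  (N : ℂ)⁻¹ * ∑ k ∈ Finset.range N, cutoff (N + k) x * (v x - c (N + k))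

variable {v : EuclideanSpace ℝ (Fin n) → ℂ} {c : ℕ → ℂ}

theorem isTestFun_truncation (hv : ContDiff ℝ ∞ v) (N : ℕ) : IsTestFun (truncation v c N) := by
  have h : truncation v c N = (N : ℂ)⁻¹ • ∑ k ∈ Finset.range N,
      fun x => cutoff (N + k) x * (v x - c (N + k)) := by
    funext x
    simp [truncation]
  rw [h]
  refine (testSubmodule n).smul_mem _ ((testSubmodule n).sum_mem fun k _ => ?_)
  exact ⟨(isTestFun_cutoff _).smooth.mul (hv.sub contDiff_const),
    (isTestFun_cutoff _).compact.mul_right⟩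

/-- The product rule leaves two errors: the loss of gradient outside the cutoffs, and the gradients
of the cutoffs, which carry the subtracted constants. -/
theorem classicalGrad_truncation_sub (hv : ContDiff ℝ ∞ v) (N : ℕ)
    (x : EuclideanSpace ℝ (Fin n)) :
    classicalGrad (truncation v c N) x - classicalGrad v x =
      (meanCutoff N x - 1) • classicalGrad v x + (N : ℂ)⁻¹ • ∑ k ∈ Finset.range N,
        (v x - c (N + k)) • classicalGrad (cutoff (N + k)) x := by
  have hd : ∀ k, DifferentiableAt ℝ (cutoff (n := n) k) x := fun k =>
    (isTestFun_cutoff k).smooth.differentiable (by simp) x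
  have hvd : ∀ k, DifferentiableAt ℝ (fun y => v y - c k) x := fun k =>
    (hv.differentiable (by simp) x).sub_const _
  have h1 : classicalGrad (truncation v c N) x = (N : ℂ)⁻¹ • ∑ k ∈ Finset.range N,
      classicalGrad (fun y => cutoff (N + k) y * (v y - c (N + k))) x :=
    classicalGrad_const_mul_sum _ _ fun k _ => (hd _).mul (hvd _)
  simp_rw [h1, classicalGrad_mul (hd _) (hvd _), classicalGrad_sub_const, meanCutoff]
  rw [Finset.sum_add_distrib, ← Finset.sum_smul, smul_add, smul_smul, sub_smul, one_smul]
  abel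

/-- The hypothesis `hc` is the growth allowed by Poincaré's inequality. It makes each term (v -
c_k)∇χ_k bounded in L^r uniformly in k; smallness comes only from averaging disjointly supported
terms. -/
theorem tendsto_eLpNorm_grad_truncation_sub {r : ℝ≥0∞} (h1 : 1 < r) (hr : r ≠ ⊤)
    (hv : ContDiff ℝ ∞ v) (hg : MemLp (classicalGrad v) r) {B : ℝ≥0∞} (hB : B ≠ ⊤)
    (hc : ∀ k, eLpNorm (fun x => v x - c k) r (volume.restrict (Metric.closedBall 0 (2 * 4 ^ k))) ≤
      ENNReal.ofReal (4 ^ k) * B) :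
    Tendsto (fun N => eLpNorm (fun x => classicalGrad (truncation v c N) x - classicalGrad v x) r)
      atTop (𝓝 0) := by
  obtain ⟨M, hM0, hM⟩ := exists_norm_grad_cutoff_le n
  let w : ℕ → EuclideanSpace ℝ (Fin n) → EuclideanSpace ℂ (Fin n) :=
    fun k x => (v x - c k) • classicalGrad (cutoff k) x
  have hwc : ∀ k, Continuous (w k) := fun k =>
    (hv.continuous.sub continuous_const).smul (continuous_classicalGrad (isTestFun_cutoff k).smooth)
  have hwb : ∀ k, eLpNorm (w k) r ≤ ENNReal.ofReal M * B := by
    intro k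
    have hs : MeasurableSet (Metric.closedBall (0 : EuclideanSpace ℝ (Fin n)) (2 * 4 ^ k)) :=
      Metric.isClosed_closedBall.measurableSet
    -- The gradient of the cutoff vanishes outside this ball, so the local bound `hc` suffices.
    have e : (Metric.closedBall (0 : EuclideanSpace ℝ (Fin n)) (2 * 4 ^ k)).indicator (w k) =
        w k := by
      refine Set.indicator_eq_self.2 fun x hx => ?_
      rw [mem_closedBall_zero_iff]
      refine (grad_cutoff_ne_zero fun h0 => hx ?_).2
      simp [w, h0]
    rw [← e, eLpNorm_indicator_eq_eLpNorm_restrict hs]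
    calc _ ≤ ENNReal.ofReal (M * (4 ^ k)⁻¹) * eLpNorm (fun x => v x - c k) r
          (volume.restrict (Metric.closedBall 0 (2 * 4 ^ k))) := by
          refine eLpNorm_le_mul_eLpNorm_of_ae_le_mul (ae_of_all _ fun x => ?_) r
          simp only [w, norm_smul]
          rw [mul_comm]
          exact mul_le_mul_of_nonneg_right (hM k x) (norm_nonneg _)
      _ ≤ ENNReal.ofReal (M * (4 ^ k)⁻¹) * (ENNReal.ofReal (4 ^ k) * B) := by
          gcongr
          exact hc k
      _ = _ := by
          rw [← mul_assoc, ← ENNReal.ofReal_mul (by positivity), mul_assoc,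
            inv_mul_cancel₀ (by positivity), mul_one]
  have hd : ∀ x j k, j ≠ k → w j x = 0 ∨ w k x = 0 := by
    intro x j k hjk
    refine (grad_cutoff_disjoint x hjk).imp (fun h => ?_) fun h => ?_ <;> simp [w, h]
  have t1 := tendsto_eLpNorm_meanCutoff_smul_sub (zero_lt_one.trans h1).ne' hr hg
  have t2 := tendsto_eLpNorm_mean_of_disjoint h1 hr (fun k => (hwc k).aestronglyMeasurable) hd
    (ENNReal.mul_ne_top ENNReal.ofReal_ne_top hB) hwb
  have t3 := t1.add t2
  rw [add_zero] at t3
  refine tendsto_of_tendsto_of_tendsto_of_le_of_le tendsto_const_nhds t3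
    (fun _ => zero_le) fun N => ?_
  simp_rw [classicalGrad_truncation_sub hv]
  refine eLpNorm_add_le (f := fun x => (meanCutoff N x - 1) • classicalGrad v x)
    (g := fun x => (N : ℂ)⁻¹ • ∑ k ∈ Finset.range N, w (N + k) x) ?_ ?_ h1.le
  · exact ((continuous_meanCutoff N).sub continuous_const).aestronglyMeasurable.smul hg.1
  · exact ((continuous_finsetSum _ fun k _ => hwc _).const_smul (N : ℂ)⁻¹).aestronglyMeasurable

/-- The `W^{1,r}_τ`-distance between a function `φ` with classical gradient and a function `u` with
weak gradient `g`, up to equivalence. -/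
noncomputable def tauDist (τ : ℝ) (r : ℝ≥0∞) (φ u : EuclideanSpace ℝ (Fin n) → ℂ)
    (g : EuclideanSpace ℝ (Fin n) → EuclideanSpace ℂ (Fin n)) : ℝ≥0∞ :=
  ‖τ‖ₑ * eLpNorm (fun x => φ x - u x) r + eLpNorm (fun x => classicalGrad φ x - g x) r

theorem tauDist_congr {τ : ℝ} {r : ℝ≥0∞} {φ u u' : EuclideanSpace ℝ (Fin n) → ℂ}
    {g g' : EuclideanSpace ℝ (Fin n) → EuclideanSpace ℂ (Fin n)} (hu : u =ᵐ[volume] u')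
    (hg : g =ᵐ[volume] g') : tauDist τ r φ u g = tauDist τ r φ u' g' := by
  have e1 : (fun x => φ x - u x) =ᵐ[volume] fun x => φ x - u' x := by
    filter_upwards [hu] with x hx using by rw [hx]
  have e2 : (fun x => classicalGrad φ x - g x) =ᵐ[volume] fun x => classicalGrad φ x - g' x := by
    filter_upwards [hg] with x hx using by rw [hx]
  rw [tauDist, tauDist, eLpNorm_congr_ae e1, eLpNorm_congr_ae e2]

/-- Truncations of a smooth function converge in all spaces `W^{1,r}_τ` that contain it. -/
theorem exists_tendsto_tauDist_of_smooth (τ : ℝ) (hv : ContDiff ℝ ∞ v) :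
    ∃ φ : ℕ → EuclideanSpace ℝ (Fin n) → ℂ, (∀ N, IsTestFun (φ N)) ∧
      ∀ r : ℝ≥0∞, 1 < r → r ≠ ⊤ → MemLp (classicalGrad v) r → (τ ≠ 0 → MemLp v r) →
        Tendsto (fun N => tauDist τ r (φ N) v (classicalGrad v)) atTop (𝓝 0) := by
  by_cases hτ : τ = 0
  · refine ⟨truncation v fun k => ballMean v (2 * 4 ^ k), isTestFun_truncation hv,
      fun r h1 hr hg _ => ?_⟩
    simp only [tauDist, hτ, enorm_zero, zero_mul, zero_add]
    -- The Poincaré constant 2^{n+1} R at R = 2 · 4^k equals 4^k · 2^{n+2}.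
    have hB : ENNReal.ofReal (2 ^ (n + 2)) * eLpNorm (classicalGrad v) r ≠ ⊤ :=
      ENNReal.mul_ne_top ENNReal.ofReal_ne_top hg.eLpNorm_ne_top
    refine tendsto_eLpNorm_grad_truncation_sub h1 hr hv hg hB fun k => ?_
    have hR : (0 : ℝ) < 2 * 4 ^ k := by positivity
    have h := eLpNorm_sub_ballMean_le h1.le hr hv.continuous.locallyIntegrable
      (hg.locallyIntegrable h1.le) (hasWeakGradient_of_smooth hv) hR
    have e : (2 : ℝ) ^ (n + 1) * (2 * 4 ^ k) = 4 ^ k * 2 ^ (n + 2) := by ring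
    rwa [e, ENNReal.ofReal_mul (by positivity), mul_assoc] at h
  · refine ⟨truncation v fun _ => 0, isTestFun_truncation hv, fun r h1 hr hg hvr => ?_⟩
    have hvr := hvr hτ
    have t1 := tendsto_eLpNorm_grad_truncation_sub (c := fun _ => 0) h1 hr hv hg
      hvr.eLpNorm_ne_top fun k => by
        simp only [sub_zero]
        refine (eLpNorm_mono_measure v Measure.restrict_le_self).trans ?_
        refine le_mul_of_one_le_left zero_le ?_
        rw [ENNReal.one_le_ofReal]
        exact one_le_pow₀ (by norm_num)
    have t2 := ENNReal.Tendsto.const_mul (a := ‖τ‖ₑ)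
      (tendsto_eLpNorm_meanCutoff_smul_sub (zero_lt_one.trans h1).ne' hr hvr)
      (Or.inr enorm_ne_top)
    have t3 := t2.add t1
    rw [mul_zero, add_zero] at t3
    refine t3.congr fun N => ?_
    simp only [tauDist]
    congr 3
    funext x
    simp only [truncation, meanCutoff, sub_zero, smul_eq_mul, ← Finset.sum_mul]
    ring

variable {u : EuclideanSpace ℝ (Fin n) → ℂ}
  {g : EuclideanSpace ℝ (Fin n) → EuclideanSpace ℂ (Fin n)}

theorem tendsto_tauDist_mollify {τ : ℝ} {r : ℝ≥0∞} [Fact (1 ≤ r)] (hr : r ≠ ⊤)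
    (hu : LocallyIntegrable u) (hug : HasWeakGradient u g) (hg : MemLp g r)
    (hur : τ ≠ 0 → MemLp u r) :
    Tendsto (fun k => tauDist τ r (mollify (shrinkingBump n k) u) u g) atTop (𝓝 0) := by
  have t1 := tendsto_eLpNorm_mollify_sub hr hg
  have t2 : Tendsto (fun k => ‖τ‖ₑ * eLpNorm (fun x => mollify (shrinkingBump n k) u x - u x) r)
      atTop (𝓝 0) := by
    -- For τ = 0 the product is zero even if the norm is infinite, by the convention 0 · ∞ = 0.
    by_cases hτ : τ = 0
    · simp [hτ]
    · have := ENNReal.Tendsto.const_mul (a := ‖τ‖ₑ) (tendsto_eLpNorm_mollify_sub hr (hur hτ))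
        (Or.inr enorm_ne_top)
      rwa [mul_zero] at this
  have t3 := t2.add t1
  rw [add_zero] at t3
  simpa only [tauDist, classicalGrad_mollify _ hu (locallyIntegrable_of_memLp hg) hug] using t3

theorem tauDist_triangle {τ : ℝ} {r : ℝ≥0∞} (h1 : 1 ≤ r) {φ v : EuclideanSpace ℝ (Fin n) → ℂ}
    (hφ : ContDiff ℝ ∞ φ) (hv : ContDiff ℝ ∞ v) (hu : AEStronglyMeasurable u volume)
    (hg : AEStronglyMeasurable g volume) :
    tauDist τ r φ u g ≤ tauDist τ r φ v (classicalGrad v) + tauDist τ r v u g := by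
  have a1 : eLpNorm (fun x => φ x - u x) r ≤
      eLpNorm (fun x => φ x - v x) r + eLpNorm (fun x => v x - u x) r := by
    refine le_trans (le_of_eq ?_) (eLpNorm_add_le
      (hφ.continuous.sub hv.continuous).aestronglyMeasurable
      (hv.continuous.aestronglyMeasurable.sub hu) h1)
    congr 1
    funext x
    simp
  have a2 : eLpNorm (fun x => classicalGrad φ x - g x) r ≤
      eLpNorm (fun x => classicalGrad φ x - classicalGrad v x) r +
        eLpNorm (fun x => classicalGrad v x - g x) r := by
    have hφc := continuous_classicalGrad hφ
    have hvc := continuous_classicalGrad hv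
    refine le_trans (le_of_eq ?_) (eLpNorm_add_le
      (hφc.sub hvc).aestronglyMeasurable (hvc.aestronglyMeasurable.sub hg) h1)
    congr 1
    funext x
    simp
  calc _ ≤ ‖τ‖ₑ * (eLpNorm (fun x => φ x - v x) r + eLpNorm (fun x => v x - u x) r) +
        (eLpNorm (fun x => classicalGrad φ x - classicalGrad v x) r +
        eLpNorm (fun x => classicalGrad v x - g x) r) := by
        simp only [tauDist]; gcongr
    _ = _ := by simp only [tauDist]; ring

/-- Test functions are dense in the intersection of two spaces `W^{1,r}_τ`. -/
theorem exists_isTestFun_tauDist_le {τ : ℝ} {r s : ℝ≥0∞} (h1r : 1 < r) (hr : r ≠ ⊤)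
    (h1s : 1 < s) (hs : s ≠ ⊤) (hu : LocallyIntegrable u) (hug : HasWeakGradient u g)
    (hgr : MemLp g r) (hgs : MemLp g s) (hur : τ ≠ 0 → MemLp u r) (hus : τ ≠ 0 → MemLp u s)
    {ε : ℝ≥0∞} (hε : 0 < ε) :
    ∃ φ, IsTestFun φ ∧ tauDist τ r φ u g ≤ ε ∧ tauDist τ s φ u g ≤ ε := by
  have : Fact (1 ≤ r) := ⟨h1r.le⟩
  have : Fact (1 ≤ s) := ⟨h1s.le⟩
  have hε2 : 0 < ε / 2 := ENNReal.half_pos hε.ne'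
  have hgl := locallyIntegrable_of_memLp hgr
  -- Mollification and truncation each cost ε/2. One index is chosen for both exponents, so that the
  -- same test function results.
  obtain ⟨k, hkr, hks⟩ := ((ENNReal.tendsto_nhds_zero.1
    (tendsto_tauDist_mollify hr hu hug hgr hur) _ hε2).and (ENNReal.tendsto_nhds_zero.1
    (tendsto_tauDist_mollify hs hu hug hgs hus) _ hε2)).exists
  have hv : ContDiff ℝ ∞ (mollify (shrinkingBump n k) u) := contDiff_mollify _ hu
  have hmem : ∀ t : ℝ≥0∞, 1 ≤ t → t ≠ ⊤ → MemLp g t →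
      MemLp (classicalGrad (mollify (shrinkingBump n k) u)) t := fun t h1 ht hgt => by
    rw [classicalGrad_mollify _ hu hgl hug]
    exact ⟨(contDiff_mollify _ hgl).continuous.aestronglyMeasurable,
      (eLpNorm_mollify_le _ h1 ht hgt.1).trans_lt hgt.2⟩
  have hmem' : ∀ t : ℝ≥0∞, 1 ≤ t → t ≠ ⊤ → MemLp u t →
      MemLp (mollify (shrinkingBump n k) u) t := fun t h1 ht hut =>
    ⟨hv.continuous.aestronglyMeasurable, (eLpNorm_mollify_le _ h1 ht hut.1).trans_lt hut.2⟩
  obtain ⟨φ, hφ, hlim⟩ := exists_tendsto_tauDist_of_smooth τ hv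
  obtain ⟨N, hNr, hNs⟩ := ((ENNReal.tendsto_nhds_zero.1 (hlim r h1r hr (hmem r h1r.le hr hgr)
    fun hτ => hmem' r h1r.le hr (hur hτ)) _ hε2).and (ENNReal.tendsto_nhds_zero.1
    (hlim s h1s hs (hmem s h1s.le hs hgs) fun hτ => hmem' s h1s.le hs (hus hτ)) _ hε2)).exists
  refine ⟨φ N, hφ N, ?_, ?_⟩
  · refine (tauDist_triangle h1r.le (hφ N).smooth hv hu.aestronglyMeasurable hgr.1).trans ?_
    exact (add_le_add hNr hkr).trans_eq (ENNReal.add_halves ε)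
  · refine (tauDist_triangle h1s.le (hφ N).smooth hv hu.aestronglyMeasurable hgr.1).trans ?_
    exact (add_le_add hNs hks).trans_eq (ENNReal.add_halves ε)

end Density

/-! ### Functions common to several Sobolev spaces -/

section Representatives

variable {n : ℕ} {τ : ℝ}

/-- Weak gradients are unique, so the τ-gradient depends on the function alone and not on the
exponent of the space in which it is considered. -/
theorem tauGrad_ae_eq {r s : ℝ≥0∞} [Fact (1 ≤ r)] [Fact (1 ≤ s)] {u : SobolevFun n τ r}
    {v : SobolevFun n τ s} (h : u.toFun =ᵐ[volume] v.toFun) :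
    u.tauGrad =ᵐ[volume] v.tauGrad := by
  have hg := (u.hasWeakGradient.congr h ae_eq_rfl).unique v.hasWeakGradient
    (locallyIntegrable_of_memLp u.memLp_grad) (locallyIntegrable_of_memLp v.memLp_grad)
  filter_upwards [h, hg] with x h1 h2
  simp only [SobolevFun.tauGrad, h1, h2]

theorem norm_cons_le (z : ℂ) (w : EuclideanSpace ℂ (Fin n)) :
    ‖(WithLp.toLp 2 (Fin.cons z fun i => w i) : EuclideanSpace ℂ (Fin (n + 1)))‖ ≤ ‖z‖ + ‖w‖ := by
  rw [EuclideanSpace.norm_eq]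
  refine Real.sqrt_le_iff.2 ⟨by positivity, ?_⟩
  rw [Fin.sum_univ_succ]
  simp only [Fin.cons_zero, Fin.cons_succ]
  rw [← EuclideanSpace.norm_sq_eq]
  nlinarith [norm_nonneg z, norm_nonneg w, mul_nonneg (norm_nonneg z) (norm_nonneg w)]

theorem norm_tauGrad_sub_le {r : ℝ≥0∞} [Fact (1 ≤ r)] (a v : SobolevFun n τ r)
    (x : EuclideanSpace ℝ (Fin n)) :
    ‖a.tauGrad x - v.tauGrad x‖ ≤ ‖τ • (a.toFun x - v.toFun x)‖ + ‖a.grad x - v.grad x‖ := by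
  have e : a.tauGrad x - v.tauGrad x = WithLp.toLp 2
      (Fin.cons (Complex.I * τ * (a.toFun x - v.toFun x)) fun i => (a.grad x - v.grad x) i) := by
    ext i
    refine Fin.cases ?_ (fun i => ?_) i
    · simp [SobolevFun.tauGrad, mul_sub]
    · simp [SobolevFun.tauGrad]
  rw [e]
  refine (norm_cons_le _ _).trans_eq ?_
  simp

theorem eLpNorm_tauGrad_sub_le {r : ℝ≥0∞} [Fact (1 ≤ r)] (a v : SobolevFun n τ r) :
    eLpNorm (fun x => a.tauGrad x - v.tauGrad x) r ≤
      ‖τ‖ₑ * eLpNorm (fun x => a.toFun x - v.toFun x) r +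
        eLpNorm (fun x => a.grad x - v.grad x) r := by
  have hm1 : AEStronglyMeasurable (fun x => τ • (a.toFun x - v.toFun x)) volume :=
    (a.locallyIntegrable.aestronglyMeasurable.sub
      v.locallyIntegrable.aestronglyMeasurable).const_smul τ
  have hm2 : AEStronglyMeasurable (fun x => a.grad x - v.grad x) volume :=
    a.memLp_grad.1.sub v.memLp_grad.1
  refine (eLpNorm_mono_real fun x => norm_tauGrad_sub_le a v x).trans ?_
  refine (eLpNorm_add_le hm1.norm hm2.norm Fact.out).trans ?_
  rw [eLpNorm_norm, eLpNorm_norm]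
  refine add_le_add ?_ le_rfl
  exact eLpNorm_const_smul_le (c := τ) (f := fun x => a.toFun x - v.toFun x)

/-- Translates `tauDist`, which only sees functions, into the norm of the quotient space: the weak
gradient of a representative of φ is the classical gradient of φ. -/
theorem norm_mk_sub_mk_le {r : ℝ≥0∞} [Fact (1 ≤ r)] {φ : EuclideanSpace ℝ (Fin n) → ℂ}
    (hφ : IsTestFun φ) {a v : SobolevFun n τ r} (ha : a.toFun =ᵐ[volume] φ) {ε : ℝ}
    (hε : 0 ≤ ε) (h : tauDist τ r φ v.toFun v.grad ≤ ENNReal.ofReal ε) :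
    ‖(SeparationQuotient.mk a : SobolevSpace n τ r) - SeparationQuotient.mk v‖ ≤ ε := by
  have hag := (a.hasWeakGradient.congr ha ae_eq_rfl).unique (hasWeakGradient_of_smooth hφ.smooth)
    (locallyIntegrable_of_memLp a.memLp_grad)
    (continuous_classicalGrad hφ.smooth).locallyIntegrable
  have e1 : (fun x => a.toFun x - v.toFun x) =ᵐ[volume] fun x => φ x - v.toFun x := by
    filter_upwards [ha] with x hx using by rw [hx]
  have e2 : (fun x => a.grad x - v.grad x) =ᵐ[volume] fun x => classicalGrad φ x - v.grad x := by
    filter_upwards [hag] with x hx using by rw [hx]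
  have e3 : ⇑(tauGradient n τ r (SeparationQuotient.mk a) -
      tauGradient n τ r (SeparationQuotient.mk v)) =ᵐ[volume]
        fun x => a.tauGrad x - v.tauGrad x := by
    refine (Lp.coeFn_sub _ _).trans ?_
    filter_upwards [coe_tauGradient_mk a, coe_tauGradient_mk v] with x h1 h2
    rw [Pi.sub_apply, h1, h2]
  rw [← (tauGradient n τ r).norm_map, map_sub, Lp.norm_def, eLpNorm_congr_ae e3]
  refine ENNReal.toReal_le_of_le_ofReal hε ((eLpNorm_tauGrad_sub_le a v).trans ?_)
  rwa [eLpNorm_congr_ae e1, eLpNorm_congr_ae e2]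

theorem IsTestFun.exists_sobolevFun {φ : EuclideanSpace ℝ (Fin n) → ℂ} (hφ : IsTestFun φ) (τ : ℝ)
    (r : ℝ≥0∞) [Fact (1 ≤ r)] : ∃ a : SobolevFun n τ r, a.toFun =ᵐ[volume] φ := by
  have hL : MemLp φ r volume := hφ.continuous.memLp_of_hasCompactSupport hφ.compact
  obtain ⟨a, ha, -⟩ := TauSobolev.exists_sobolevFun (τ := τ) (p := r)
    (fun K _ => hL.restrict K) (fun _ => hL) (hφ.memLp_classicalGrad r)
    (hasWeakGradient_of_smooth hφ.smooth)
  exact ⟨a, ha⟩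

/-- Functionals that agree on test functions agree on `W^{1,2}_τ ∩ W^{1,q}_τ`. -/
theorem SameDistribution.apply_mk_eq {q : ℝ≥0∞} [Fact (1 ≤ q)] (hq1 : 1 < q) (hq : q ≠ ⊤)
    {F₂ : AntiDual (SobolevSpace n τ 2)} {F : AntiDual (SobolevSpace n τ q)}
    (h : SameDistribution F₂ F) {v₂ : SobolevFun n τ 2} {v : SobolevFun n τ q}
    (hv : v.toFun =ᵐ[volume] v₂.toFun) :
    F₂ (SeparationQuotient.mk v₂) = F (SeparationQuotient.mk v) := by
  have hg := (v₂.hasWeakGradient.congr hv.symm ae_eq_rfl).unique v.hasWeakGradient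
    (locallyIntegrable_of_memLp v₂.memLp_grad) (locallyIntegrable_of_memLp v.memLp_grad)
  rw [← sub_eq_zero, ← norm_le_zero_iff]
  refine le_of_forall_pos_le_add fun δ hδ => ?_
  have hpos : 0 < ‖F₂‖ + ‖F‖ + 1 := by positivity
  -- The summand 1 keeps the denominator positive when both functionals vanish.
  set ε := δ / (‖F₂‖ + ‖F‖ + 1) with hεdef
  have hε : 0 < ε := by positivity
  obtain ⟨φ, hφ, h2, h3⟩ := exists_isTestFun_tauDist_le (τ := τ) (r := 2) (s := q) (by norm_num)
    (by simp) hq1 hq v.locallyIntegrable v.hasWeakGradient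
    ((memLp_congr_ae hg).1 v₂.memLp_grad) v.memLp_grad
    (fun hτ => (memLp_congr_ae hv).2 (v₂.memLp hτ)) v.memLp (ENNReal.ofReal_pos.2 hε)
  obtain ⟨a₂, ha₂⟩ := hφ.exists_sobolevFun τ 2
  obtain ⟨a, ha⟩ := hφ.exists_sobolevFun τ q
  have e : F₂ (SeparationQuotient.mk a₂) = F (SeparationQuotient.mk a) :=
    h φ hφ _ _ ⟨a₂, ha₂, rfl⟩ ⟨a, ha, rfl⟩
  have h2' : tauDist τ 2 φ v₂.toFun v₂.grad ≤ ENNReal.ofReal ε :=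
    (tauDist_congr hv.symm hg).trans_le h2
  have n2 := norm_mk_sub_mk_le hφ ha₂ hε.le h2'
  have n3 := norm_mk_sub_mk_le hφ ha hε.le h3
  have b2 := (F₂.le_opNorm _).trans (mul_le_mul_of_nonneg_left n2 (norm_nonneg F₂))
  have b3 := (F.le_opNorm _).trans (mul_le_mul_of_nonneg_left n3 (norm_nonneg F))
  rw [map_sub] at b2 b3
  rw [zero_add]
  -- The common value of the functionals at the test function is inserted, and each approximation
  -- error is bounded by the norm of its functional.
  calc _ = ‖(F (SeparationQuotient.mk a) - F (SeparationQuotient.mk v)) -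
        (F₂ (SeparationQuotient.mk a₂) - F₂ (SeparationQuotient.mk v₂))‖ := by
        rw [e]; congr 1; ring
    _ ≤ ‖F‖ * ε + ‖F₂‖ * ε := (norm_sub_le _ _).trans (add_le_add b3 b2)
    _ ≤ (‖F₂‖ + ‖F‖ + 1) * ε := by nlinarith
    _ = δ := by rw [hεdef]; field_simp

/-- An element of `W^{1,2}_τ` whose `τ`-gradient is in `L^r` belongs to `W^{1,r}_τ`. -/
theorem SobolevFun.exists_toFun_eq_of_memLp {r : ℝ≥0∞} [Fact (1 ≤ r)] (hr : r ≠ ⊤)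
    (u : SobolevFun n τ 2) (hu : MemLp u.tauGrad r volume) :
    ∃ w : SobolevFun n τ r, w.toFun =ᵐ[volume] u.toFun := by
  have hg : MemLp u.grad r volume :=
    hu.mono u.memLp_grad.1 (ae_of_all _ fun x => norm_grad_le u x)
  have hloc : ∀ K, IsCompact K → MemLp u.toFun r (volume.restrict K) := by
    intro K hK
    obtain ⟨R, hR0, hR⟩ := hK.isBounded.subset_closedBall_lt 0 0
    have hfin : IsFiniteMeasure (volume.restrict
        (Metric.closedBall (0 : EuclideanSpace ℝ (Fin n)) R)) :=
      ⟨by simpa using measure_closedBall_lt_top⟩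
    -- A priori u is only in L²_loc. Poincaré's inequality in L^r upgrades it: minus its mean, u is
    -- in L^r on the ball, and constants are in L^r there.
    have hb := eLpNorm_sub_ballMean_le Fact.out hr u.locallyIntegrable
      (locallyIntegrable_of_memLp hg) u.hasWeakGradient hR0
    have h1 : MemLp (fun x => u.toFun x - ballMean u.toFun R) r
        (volume.restrict (Metric.closedBall 0 R)) :=
      ⟨(u.locallyIntegrable.aestronglyMeasurable.sub aestronglyMeasurable_const).restrict,
        hb.trans_lt (ENNReal.mul_lt_top ENNReal.ofReal_lt_top hg.2)⟩
    have h2 := h1.add (memLp_const (ballMean u.toFun R))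
    refine MemLp.mono_measure (Measure.restrict_mono_set volume hR) ?_
    refine (memLp_congr_ae (ae_of_all _ fun x => ?_)).1 h2
    simp
  have hglob : τ ≠ 0 → MemLp u.toFun r volume := by
    intro hτ
    refine MemLp.of_le_mul (c := |τ|⁻¹) hu u.locallyIntegrable.aestronglyMeasurable
      (ae_of_all _ fun x => ?_)
    rw [inv_mul_eq_div, le_div_iff₀ (by positivity), mul_comm]
    exact norm_toFun_le u x
  obtain ⟨w, hw, -⟩ := TauSobolev.exists_sobolevFun hloc hglob hg u.hasWeakGradient
  exact ⟨w, hw⟩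

end Representatives

/-! ### The adjoint of the Hodge projector -/

section Adjoint

variable {n : ℕ} {A : EuclideanSpace ℝ (Fin n) → Matrix (Fin (n + 1)) (Fin (n + 1)) ℂ} {lam : ℝ}
  {τ : ℝ}

/-- The adjoint of the Hodge projector takes its values in the range of `S_τ`. -/
theorem exists_adjoint_hodgeProjector_eq (hA : IsStronglyElliptic A lam) (φ : LpVec n 2) :
    ∃ v : SobolevSpace n τ 2,
      ContinuousLinearMap.adjoint (hodgeProjector hA τ) φ = tauGradient n τ 2 v := by
  let R := LinearMap.range (tauGradient n τ 2).toLinearMap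
  let S : SobolevSpace n τ 2 ≃ₗᵢ[ℂ] R := (tauGradient n τ 2).equivRange
  have hR : CompleteSpace R :=
    (completeSpace_congr (e := S.toEquiv) S.isometry.isUniformEmbedding).1 inferInstance
  have hmem : ContinuousLinearMap.adjoint (hodgeProjector hA τ) φ ∈ R := by
    -- The range of S_τ is complete, hence equal to its double orthogonal complement. A field
    -- orthogonal to it is annihilated by S_τ^*, and so by the projector.
    rw [← Submodule.orthogonal_orthogonal R, Submodule.mem_orthogonal]
    intro x hx
    have h0 : tauDivergence n τ x = 0 := by
      ext v
      exact (Submodule.mem_orthogonal R x).1 hx _ ⟨v, rfl⟩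
    rw [ContinuousLinearMap.adjoint_inner_right]
    have : hodgeProjector hA τ x = 0 := by simp [hodgeProjector, h0]
    rw [this, inner_zero_left]
  obtain ⟨v, hv⟩ := hmem
  exact ⟨v, hv.symm⟩

/-- With h = A S_τ u one has F₂ = S_τ^*h, so S_τ u is the projector applied to h. Moving the
projector onto φ gives ⟨S_τ v, h⟩ = F₂(v). -/
theorem inner_tauGradient_ellipticEquiv_symm (hA : IsStronglyElliptic A lam)
    (F₂ : AntiDual (SobolevSpace n τ 2)) {φ : LpVec n 2} {v : SobolevSpace n τ 2}
    (hv : ContinuousLinearMap.adjoint (hodgeProjector hA τ) φ = tauGradient n τ 2 v) :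
    inner ℂ φ (tauGradient n τ 2 ((ellipticEquiv hA τ).symm F₂)) = F₂ v := by
  set u := (ellipticEquiv hA τ).symm F₂ with hu
  let h : LpVec n 2 := coeffMul hA (tauGradient n τ 2 u)
  have hF : tauDivergence n τ h = F₂ := (ellipticEquiv hA τ).apply_symm_apply F₂
  have hP : tauGradient n τ 2 u = hodgeProjector hA τ h := by
    simp [hodgeProjector, hF, hu]
  rw [hP, ← ContinuousLinearMap.adjoint_inner_left, hv, ← hF]
  rfl

/-- The usual duality between L^p and L^q bounds. Since the operators are defined on L² only, the
testing is restricted to L² ∩ L^p, as `eLpNorm_le_of_inner` allows. -/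
theorem eLpNorm_adjoint_hodgeProjector_le {p q : ℝ≥0∞} [p.HolderConjugate q] (hp : p ≠ ⊤)
    (hq : q ≠ ⊤) (hA : IsStronglyElliptic A lam) {C : ℝ≥0} (hC : HodgeBounded hA τ p C)
    (φ : LpVec n 2) (hφ : MemLp φ q volume) :
    eLpNorm (ContinuousLinearMap.adjoint (hodgeProjector hA τ) φ) q volume ≤
      C * eLpNorm φ q volume := by
  have hM : ((C * (eLpNorm φ q volume).toNNReal : ℝ≥0) : ℝ≥0∞) = C * eLpNorm φ q volume := by
    rw [ENNReal.coe_mul, ENNReal.coe_toNNReal hφ.eLpNorm_ne_top]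
  rw [← hM]
  refine eLpNorm_le_of_inner (p := p) hp hq (Lp.memLp _) _ fun ψ h2 hψ => ?_
  have e1 : ∫ x, inner ℂ (ContinuousLinearMap.adjoint (hodgeProjector hA τ) φ x) (ψ x) =
      ∫ x, inner ℂ (φ x) (hodgeProjector hA τ (h2.toLp ψ) x) := by
    rw [← L2.inner_def, ← ContinuousLinearMap.adjoint_inner_left, L2.inner_def]
    refine integral_congr_ae ?_
    filter_upwards [h2.coeFn_toLp] with x hx
    rw [hx]
  rw [e1, hM]
  have hqp : q.HolderConjugate p := ENNReal.HolderConjugate.symm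
  refine (enorm_integral_inner_le (p := q) (q := p) hφ.1 (Lp.aestronglyMeasurable _)).trans ?_
  have hb := hC (h2.toLp ψ) ((memLp_congr_ae h2.coeFn_toLp).2 hψ)
  rw [eLpNorm_congr_ae h2.coeFn_toLp] at hb
  calc _ ≤ eLpNorm φ q volume * (C * eLpNorm ψ p volume) := by gcongr
    _ = _ := by ring

end Adjoint

/-- The distribution `S_τ^* f`, `f ∈ L^p`, as an element of `W^{-1,p}_τ`. -/
theorem exists_antiDual_eq_integral {n : ℕ} {p q : ℝ≥0∞} [Fact (1 ≤ q)] [p.HolderConjugate q]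
    (τ : ℝ) {f : EuclideanSpace ℝ (Fin n) → EuclideanSpace ℂ (Fin (n + 1))}
    (hf : MemLp f p volume) : ∃ F : AntiDual (SobolevSpace n τ q),
      (∀ v, F v = ∫ x, inner ℂ (tauGradient n τ q v x) (f x)) ∧
      ‖F‖ ≤ (eLpNorm f p volume).toReal := by
  have hqp : q.HolderConjugate p := ENNReal.HolderConjugate.symm
  have hi : ∀ v : SobolevSpace n τ q,
      Integrable fun x => inner ℂ (tauGradient n τ q v x) (f x) := fun v =>
    integrable_inner_of_memLp (p := q) (q := p) (Lp.memLp _) hf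
  let ℓ : SobolevSpace n τ q →ₗ⋆[ℂ] ℂ :=
    { toFun := fun v => ∫ x, inner ℂ (tauGradient n τ q v x) (f x)
      map_add' := fun v w => by
        rw [← integral_add (hi v) (hi w), map_add]
        refine integral_congr_ae ?_
        filter_upwards [Lp.coeFn_add (tauGradient n τ q v) (tauGradient n τ q w)] with x hx
        rw [hx, Pi.add_apply, inner_add_left]
      map_smul' := fun c v => by
        rw [map_smul, smul_eq_mul, ← integral_const_mul]
        refine integral_congr_ae ?_
        filter_upwards [Lp.coeFn_smul c (tauGradient n τ q v)] with x hx
        rw [hx, Pi.smul_apply, inner_smul_left] }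
  refine ⟨ℓ.mkContinuous (eLpNorm f p volume).toReal fun v => ?_, fun v => rfl,
    LinearMap.mkContinuous_norm_le _ ENNReal.toReal_nonneg _⟩
  have h := enorm_integral_inner_le (p := q) (q := p)
    (Lp.aestronglyMeasurable (tauGradient n τ q v)) hf.1
  have h2 := ENNReal.toReal_mono (ENNReal.mul_ne_top (Lp.memLp _).eLpNorm_ne_top
    hf.eLpNorm_ne_top) h
  rw [toReal_enorm, ENNReal.toReal_mul, ← Lp.norm_def, LinearIsometry.norm_map, mul_comm] at h2
  exact h2

/-! ### The two implications -/

section Equivalence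

variable {n : ℕ} {A : EuclideanSpace ℝ (Fin n) → Matrix (Fin (n + 1)) (Fin (n + 1)) ℂ} {lam : ℝ}
  {τ : ℝ} {p q : ℝ≥0∞} [Fact (1 ≤ p)] [Fact (1 ≤ q)] [p.HolderConjugate q]

/-- Testing S_τ u against L² ∩ L^q turns the estimate into a bound for F at some v with S_τ v the
adjoint projector of the test field; the L^q bound of the adjoint controls v. -/
theorem HodgeBounded.inverseBounded (hp : p ≠ ⊤) (hq1 : 1 < q) (hq : q ≠ ⊤)
    (hA : IsStronglyElliptic A lam) {C : ℝ≥0} (hC : HodgeBounded hA τ p C) :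
    InverseBounded hA τ p q C := by
  intro F₂ F hF
  have hqp : q.HolderConjugate p := ENNReal.HolderConjugate.symm
  set u := (ellipticEquiv hA τ).symm F₂ with hu
  have hbound : eLpNorm (tauGradient n τ 2 u) p volume ≤ (C * ‖F‖₊ : ℝ≥0) := by
    refine eLpNorm_le_of_inner (p := q) hq hp (Lp.memLp _) _ fun ψ h2 hψ => ?_
    let φ : LpVec n 2 := h2.toLp ψ
    have hφ : MemLp φ q volume := (memLp_congr_ae h2.coeFn_toLp).2 hψ
    obtain ⟨v, hv⟩ := exists_adjoint_hodgeProjector_eq (τ := τ) hA φ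
    have e1 : ‖∫ x, inner ℂ (tauGradient n τ 2 u x) (ψ x)‖ₑ = ‖F₂ v‖ₑ := by
      rw [← inner_tauGradient_ellipticEquiv_symm hA F₂ hv, ← ofReal_norm, ← ofReal_norm,
        norm_inner_symm, L2.inner_def]
      congr 2
      refine integral_congr_ae ?_
      filter_upwards [h2.coeFn_toLp] with x hx
      rw [hx]
    have hSv := eLpNorm_adjoint_hodgeProjector_le hp hq hA hC φ hφ
    obtain ⟨v₂, rfl⟩ := SeparationQuotient.surjective_mk v
    rw [hv, eLpNorm_congr_ae (coe_tauGradient_mk v₂), eLpNorm_congr_ae h2.coeFn_toLp] at hSv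
    -- The τ-gradient of v lies in L^q, so v is also an element of W^{1,q}_τ. This lets F act on it
    -- in place of F₂.
    obtain ⟨w, hw⟩ := v₂.exists_toFun_eq_of_memLp hq
      ⟨v₂.memLp_tauGrad.1, hSv.trans_lt (ENNReal.mul_lt_top ENNReal.coe_lt_top hψ.2)⟩
    rw [e1, hF.apply_mk_eq hq1 hq hw]
    have hFw : ‖F (SeparationQuotient.mk w)‖ₑ ≤
        ‖F‖ₑ * ‖(SeparationQuotient.mk w : SobolevSpace n τ q)‖ₑ := F.le_opENorm _
    have hwn : ‖(SeparationQuotient.mk w : SobolevSpace n τ q)‖ₑ = eLpNorm v₂.tauGrad q volume := by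
      rw [← ofReal_norm, norm_mk_eq, ENNReal.ofReal_toReal w.memLp_tauGrad.eLpNorm_ne_top]
      exact eLpNorm_congr_ae (tauGrad_ae_eq hw)
    rw [hwn] at hFw
    calc _ ≤ ‖F‖ₑ * (C * eLpNorm ψ q volume) := hFw.trans (by gcongr)
      _ = _ := by rw [ENNReal.coe_mul, ← enorm_eq_nnnorm]; ring
  obtain ⟨u₂, hu₂⟩ := SeparationQuotient.surjective_mk u
  rw [← hu₂, eLpNorm_congr_ae (coe_tauGradient_mk u₂)] at hbound
  -- The L^p bound on the τ-gradient makes u itself an element of W^{1,p}_τ, represented by the same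
  -- function.
  obtain ⟨w, hw⟩ := u₂.exists_toFun_eq_of_memLp hp
    ⟨u₂.memLp_tauGrad.1, hbound.trans_lt ENNReal.coe_lt_top⟩
  refine ⟨u₂.toFun, SeparationQuotient.mk w, ⟨u₂, ae_eq_rfl, hu₂⟩, ⟨w, hw, rfl⟩, ?_⟩
  rw [norm_mk_eq, eLpNorm_congr_ae (tauGrad_ae_eq hw)]
  exact ENNReal.toReal_mono ENNReal.coe_ne_top hbound

/-- The functional S_τ^*f has norm at most ‖f‖_p on W^{1,q}_τ, and its two incarnations agree on
test functions because τ-gradients do not depend on the exponent. -/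
theorem InverseBounded.hodgeBounded (hA : IsStronglyElliptic A lam) {C : ℝ≥0}
    (hC : InverseBounded hA τ p q C) : HodgeBounded hA τ p C := by
  intro f hf
  obtain ⟨F, hF, hFn⟩ := exists_antiDual_eq_integral (q := q) τ hf
  have hsame : SameDistribution (tauDivergence n τ f) F := by
    rintro φ - v₂ v ⟨w₂, hw₂, rfl⟩ ⟨w, hw, rfl⟩
    rw [tauDivergence_apply, hF]
    refine integral_congr_ae ?_
    filter_upwards [coe_tauGradient_mk w₂, coe_tauGradient_mk w,
      tauGrad_ae_eq (hw₂.trans hw.symm)] with x e1 e2 e3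
    rw [e1, e2, e3]
  obtain ⟨f₀, w, ⟨w₂, hw₂, hu⟩, ⟨w', hw', rfl⟩, hn⟩ := hC _ F hsame
  have e : hodgeProjector hA τ f = tauGradient n τ 2 (SeparationQuotient.mk w₂) := by
    rw [hu]; rfl
  rw [e, eLpNorm_congr_ae ((coe_tauGradient_mk w₂).trans (tauGrad_ae_eq (hw₂.trans hw'.symm))),
    ← ENNReal.ofReal_toReal w'.memLp_tauGrad.eLpNorm_ne_top, ← norm_mk_eq,
    ← ENNReal.ofReal_toReal hf.eLpNorm_ne_top, ← ENNReal.ofReal_coe_nnreal,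
    ← ENNReal.ofReal_mul C.coe_nonneg]
  exact ENNReal.ofReal_le_ofReal (hn.trans (mul_le_mul_of_nonneg_left hFn C.coe_nonneg))

end Equivalence

end TauSobolev

theorem mainTheorem9 (n : ℕ) (hn : 1 ≤ n) (p q : ℝ≥0∞) [Fact (1 ≤ p)] [Fact (1 ≤ q)]
    [p.HolderConjugate q] (hp1 : 1 < p) (hp : p ≠ ⊤) :
    ∃ K : ℝ≥0, ∀ (A : EuclideanSpace ℝ (Fin n) → Matrix (Fin (n + 1)) (Fin (n + 1)) ℂ) (lam : ℝ)
      (hA : TauSobolev.IsStronglyElliptic A lam) (τ : ℝ),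
      ((∃ C : ℝ≥0, TauSobolev.HodgeBounded hA τ p C) ↔
        ∃ C : ℝ≥0, TauSobolev.InverseBounded hA τ p q C) ∧
      (∀ C : ℝ≥0, TauSobolev.HodgeBounded hA τ p C →
        TauSobolev.InverseBounded hA τ p q (K * C)) ∧
      (∀ C : ℝ≥0, TauSobolev.InverseBounded hA τ p q C →
        TauSobolev.HodgeBounded hA τ p (K * C)) := by
  have hpr : 1 < p.toReal := by
    rw [← ENNReal.toReal_one]; exact ENNReal.toReal_strict_mono hp hp1
  have hqr : 1 < q.toReal := (ENNReal.HolderConjugate.toReal (q := q) hpr).symm.lt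
  have hq : q ≠ ⊤ := by
    rintro rfl
    simp at hqr
    linarith
  have hq1 : 1 < q := by
    rw [← ENNReal.toReal_lt_toReal ENNReal.one_ne_top hq, ENNReal.toReal_one]
    exact hqr
  -- Hölder's inequality and its converse both hold with constant 1, so neither implication loses a
  -- factor.
  refine ⟨1, fun A lam hA τ => ⟨⟨?_, ?_⟩, fun C hC => ?_, fun C hC => ?_⟩⟩
  · rintro ⟨C, hC⟩
    exact ⟨C, hC.inverseBounded hp hq1 hq⟩
  · rintro ⟨C, hC⟩
    exact ⟨C, hC.hodgeBounded⟩
  · rw [one_mul]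
    exact hC.inverseBounded hp hq1 hq
  · rw [one_mul]
    exact hC.hodgeBounded
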